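/- \textbf{Halting Problem Theorem.} An \emph{infinite time Turing machine} has input tapes, a scratch tape and an output tape, each with cells indexed by $0,1,2,\dots$ holding digits $0$ or $1$, one head (which reads and writes the cells of the same index on all tapes), and finitely many states, among them a \emph{start}, a \emph{limit} and a \emph{halt} state. It starts with the head on cell $0$ in the start state, the input on the input tapes and zeros on the other tapes, and at successor ordinal stages it proceeds like an ordinary Turing machine. At a limit ordinal stage it is in the limit state with the head on cell $0$, and each cell contains the $\limsup$ of its earlier values. If it ever reaches the halt state, the computation stops, and the content of the output tape is the output. Elements of $\mathbb R = 2^\omega$ are called reals. Programs are coded by natural numbers (every natural number codes a program, in a fixed effective way), and natural numbers are regarded as reals through their binary digits, least significant digit first (so $0=\langle 0,0,0,\dots\rangle$ and $1=\langle 1,0,0,\dots\rangle$). Let $\varphi_p$ be the partial function on $\mathbb R^k$ computed by the program $p$ run with $k$ input tapes. A set $A\subseteq\mathbb R^k$ is \emph{decidable} if its characteristic function is some $\varphi_p$, and \emph{semi-decidable} if the partial function with domain $A$ and constant value $1$ is some $\varphi_p$. Let $$H=\{(p,x)\in\omega\times\mathbb R : p \text{ halts on input } x\}\subseteq\mathbb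 R^2,\qquad h=\{p\in\omega : p\text{ halts on input }0\}\subseteq\mathbb R .$$ Then $H$ and $h$ are both semi-decidable, and neither of them is decidable. -/

import Mathlib

namespace ITTM

/-- Cantor space `2^ω`, whose elements are called reals. -/
abbrev Cantor : Type := ℕ → Bool

/-- The real that represents the natural number `n`: its binary digits, least significant first, so
that `0` is `⟨0,0,0,…⟩` and `1` is `⟨1,0,0,…⟩`. -/
def ofNat (n : ℕ) : Cantor := fun i => n.testBit i

/-! ### Programs

A machine for functions of `k` arguments has `k` input tapes (numbers `0, …, k - 1`), a scratch tape
(number `k`) and an output tape (number `k + 1`), each with cells `0, 1, 2, …`, and one head that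
overlies the cells of the same index on all tapes. States are natural numbers, of which a program
uses only finitely many. -/

def startState : ℕ := 0

def limitState : ℕ := 1

def haltState : ℕ := 2

/-- The finite table of actions of program `p`: the successive numbers of `1`s between `0`s in the
binary expansion of `p`, from the least significant digit on. The number with the digits
`1^(a₀) 0 1^(a₁) 0 … 1^(aₘ)` has the table `[a₀, a₁, …, aₘ]`. -/
def table (p : ℕ) : List ℕ := (p.bits.splitOn false).map List.length

/-- What the machine does in one step: the digit it writes on each tape, whether the head moves
right (otherwise it moves left), and the new state. -/
structure Action (k : ℕ) where
  write : Fin (k + 2) → Bool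
  right : Bool
  next : ℕ

/-- The action with number `a`: the binary digits `0, …, k + 1` of `a` are to be written on the
respective tapes, the next digit is the direction, and the remaining digits give the new state. -/
def Action.ofCode (k a : ℕ) : Action k where
  write i := a.testBit i
  right := a.testBit (k + 2)
  next := a / 2 ^ (k + 3)

/-- The action of program `p` in state `q` when it reads the digits `r` on the tapes: it is the
action in row `q` and column `∑ r i * 2 ^ i` of the table, each row having `2 ^ (k + 2)` columns
(entries beyond the end of the table are `0`). -/
def action {k : ℕ} (p q : ℕ) (r : Fin (k + 2) → Bool) : Action k :=
  Action.ofCode k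
    ((table p).getD (q * 2 ^ (k + 2) + ∑ i : Fin (k + 2), (r i).toNat * 2 ^ (i : ℕ)) 0)

/-! ### Computations -/

/-- A snapshot: state, head position, and contents of all tapes. -/
structure Config (k : ℕ) where
  state : ℕ
  head : ℕ
  tape : Fin (k + 2) → Cantor

/-- The input is on the input tapes, the scratch and output tapes are filled with zeros. -/
def Config.init {k : ℕ} (x : Fin k → Cantor) : Config k where
  state := startState
  head := 0
  tape i := if h : (i : ℕ) < k then x ⟨i, h⟩ else fun _ => false

/-- One step of program `p`. A head on the first cell that is told to move left stays there. -/
def Config.step {k : ℕ} (p : ℕ) (c : Config k) : Config k :=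
  let a : Action k := action p c.state fun i => c.tape i c.head
  { state := a.next
    head := if a.right then c.head + 1 else c.head - 1
    tape := fun i => Function.update (c.tape i) c.head (a.write i) }

open Classical in
/-- The snapshot at a limit stage `l` from those at the earlier stages: limit state, head on the
first cell, and each cell holds the `limsup` of its earlier values, that is, `1` if it was `1`
unboundedly often before `l`, and `0` if it was `0` from some stage before `l` on. -/
noncomputable def Config.limit {k : ℕ} (l : Ordinal.{0})
    (run : ∀ a : Ordinal.{0}, a < l → Config k) : Config k where
  state := limitState
  head := 0
  tape i j := decide (∀ b < l, ∃ (a : Ordinal.{0}) (h : a < l), b ≤ a ∧ (run a h).tape i j = true)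

/-- The snapshot of program `p` on input `x` at stage `a`. It is meaningful only up to the first
stage at which the machine is in the halt state; later values are never used. -/
noncomputable def run {k : ℕ} (p : ℕ) (x : Fin k → Cantor) (a : Ordinal.{0}) : Config k :=
  Ordinal.limitRecOn a (Config.init x) (fun _ c => c.step p) (fun l _ prev => Config.limit l prev)

/-- Program `p` halts on input `x`. -/
def Halts {k : ℕ} (p : ℕ) (x : Fin k → Cantor) : Prop :=
  ∃ a : Ordinal.{0}, (run p x a).state = haltState

/-- The first stage at which program `p` is in the halt state (used only if there is one). -/
noncomputable def haltTime {k : ℕ} (p : ℕ) (x : Fin k → Cantor) : Ordinal.{0} :=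
  sInf {a | (run p x a).state = haltState}

/-- The partial function `φ_p` of `k` arguments: its value is what is on the output tape when the
machine halts. -/
noncomputable def phi {k : ℕ} (p : ℕ) : (Fin k → Cantor) →. Cantor := fun x =>
  ⟨Halts p x, fun _ => (run p x (haltTime p x)).tape (Fin.last (k + 1))⟩

/-! ### Computability -/

/-- A partial function on the reals is infinite time computable. -/
def InfComputable {k : ℕ} (f : (Fin k → Cantor) →. Cantor) : Prop :=
  ∃ p : ℕ, f = phi p

open Classical in
/-- `A` is infinite time decidable: its characteristic function is computable. -/
def InfDecidable {k : ℕ} (A : Set (Fin k → Cantor)) : Prop :=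
  InfComputable fun x => Part.some (if x ∈ A then ofNat 1 else ofNat 0)

/-- `A` is infinite time semi-decidable: the partial function with domain `A` and constant value `1`
is computable. -/
def InfSemiDecidable {k : ℕ} (A : Set (Fin k → Cantor)) : Prop :=
  InfComputable fun x => ⟨x ∈ A, fun _ => ofNat 1⟩

/-! ### The halting problems -/

/-- The boldface halting problem `H = {(p, x) | p halts on input x}`. -/
def boldHalt : Set (Fin 2 → Cantor) :=
  {v | ∃ (p : ℕ) (x : Cantor), v = ![ofNat p, x] ∧ Halts p ![x]}

/-- The lightface halting problem `h = {p | p halts on input 0}`. -/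
def lightHalt : Set (Fin 1 → Cantor) :=
  {v | ∃ p : ℕ, v = ![ofNat p] ∧ Halts p ![ofNat 0]}

end ITTM

namespace ITTM

/-! Semi-decidability comes from a universal machine. Given reals P and y, it first finds out
whether P is a natural number, that is, has only finitely many digits 1: it runs along P and raises
and lowers a flag at each 1, so at stage ω the limsup of the flag is 1 exactly if there were
infinitely many. In that case it loops; otherwise it simulates the program P on y
(`universal_haltsFrom_iff`). Restricting how P and y are read off the input gives both H and h
(`infSemiDecidable_of_haltsFrom`).

Undecidability is one diagonal argument for both sets. A decision procedure for H or h would be a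
program d whose output on (q, 0, …, 0) begins with 1 exactly if q halts on 0. For each p ≠ 0 there
is a program q(p) that writes p on its input tape and then runs p on p, so that q(p) halts on 0 if
and only if p halts on p (`exists_quote`). A machine can generate the digits of q(p) from those of
p, run d on the result, and halt exactly if the answer begins with 0. A code p of this machine halts
on p if and only if it does not (`not_exists_decider`).

These machines have many tapes and several heads, whereas a program has k + 2 tapes and one head
that never rests. Everything rests on a notion of simulation, `Sys.Sim`: one step of B becomes
finitely many steps of A, and meanwhile each cell of A that represents a cell of B holds its old or
its new value. Then limsups on the two time scales agree, and the simulation passes through limit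
stages (`Sys.Sim.reach_aux`). It is applied to programs for finite tables (`Implements.sim`), to
tapes interleaved in blocks (`blockMachine_sim`), to heads replaced by marks (`oneHead_sim`), to the
universal machine (`universal_sim`) and to the copy of d inside the diagonal machine
(`diagonal_sim`).

A limit stage erases state and head positions and leaves only the tapes. So the designed machines
start in their limit state, and where a limit must be told from the start, flags or marks on the
tapes do it. -/

/-- A transfinite system: a control part of type `κ` and tapes indexed by `I`. -/
structure Sys (κ I : Type) where
  lim : κ
  step : κ × (I → ℕ → Bool) → κ × (I → ℕ → Bool)
  halt : κ → Prop

/-! ### Runs through the ordinals, reachability, finite paths -/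

namespace Sys

open Order

variable {κ I κ' I' : Type}

open Classical in
/-- The configuration of `s` at each ordinal stage, started in `c`. -/
noncomputable def run (s : Sys κ I) (c : κ × (I → ℕ → Bool)) (a : Ordinal.{0}) :
    κ × (I → ℕ → Bool) :=
  Ordinal.limitRecOn a c (fun _ c => s.step c) (fun l _ prev =>
    (s.lim, fun i j => decide (∀ b < l, ∃ (a : Ordinal.{0}) (h : a < l),
      b ≤ a ∧ (prev a h).2 i j = true)))

@[simp] theorem run_zero (s : Sys κ I) (c) : s.run c 0 = c := Ordinal.limitRecOn_zero ..

theorem run_add_one (s : Sys κ I) (c) (a) : s.run c (a + 1) = s.step (s.run c a) :=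
  Ordinal.limitRecOn_add_one ..

open Classical in
theorem run_limit (s : Sys κ I) (c) {l : Ordinal.{0}} (hl : IsSuccLimit l) :
    s.run c l = (s.lim, fun i j => decide (∀ b < l, ∃ a < l, b ≤ a ∧
      (s.run c a).2 i j = true)) := by
  unfold run
  rw [Ordinal.limitRecOn_limit _ _ _ _ hl]
  simp only [exists_prop]

theorem run_limit_fst (s : Sys κ I) (c) {l : Ordinal.{0}} (hl : IsSuccLimit l) :
    (s.run c l).1 = s.lim := by rw [run_limit s c hl]

theorem run_limit_snd (s : Sys κ I) (c) {l : Ordinal.{0}} (hl : IsSuccLimit l) (i : I) (j : ℕ) :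
    (s.run c l).2 i j = true ↔ ∀ b < l, ∃ a < l, b ≤ a ∧ (s.run c a).2 i j = true := by
  rw [run_limit s c hl]; simp

theorem run_add (s : Sys κ I) (c) (a b) : s.run c (a + b) = s.run (s.run c a) b := by
  induction b using Ordinal.limitRecOn with
  | zero => simp
  | add_one b ih => rw [← add_assoc, run_add_one, run_add_one, ih]
  | limit l hl ih =>
    have hal : IsSuccLimit (a + l) := Ordinal.isSuccLimit_add a hl
    ext1
    · rw [run_limit_fst s _ hal, run_limit_fst s _ hl]
    funext i j
    rw [Bool.eq_iff_iff, run_limit_snd s _ hal, run_limit_snd s _ hl]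
    constructor
    · intro h b hb
      obtain ⟨x, hx, hbx, hr⟩ := h (a + b) (by gcongr)
      obtain ⟨y, rfl⟩ : ∃ y, x = a + y := exists_add_of_le (le_self_add.trans hbx)
      have hy : y < l := by simpa using hx
      exact ⟨y, hy, by simpa using hbx, by rw [← ih y hy]; exact hr⟩
    · intro h b hb
      obtain ⟨x, hx, hbx, hr⟩ := h (b - a) (Ordinal.sub_lt_of_lt_add hb hl.bot_lt)
      exact ⟨a + x, by gcongr, by simpa [Ordinal.sub_le] using hbx, by rw [ih x hx]; exact hr⟩

theorem run_natCast (s : Sys κ I) (c) (n : ℕ) : s.run c n = s.step^[n] c := by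
  induction n with
  | zero => simp
  | succ n ih => rw [Nat.cast_succ, run_add_one, ih, Function.iterate_succ_apply']

/-- `s` gets from `c` to `c'` without halting in between. -/
def Reach (s : Sys κ I) (c c' : κ × (I → ℕ → Bool)) : Prop :=
  ∃ t, s.run c t = c' ∧ ∀ u < t, ¬ s.halt (s.run c u).1

def HaltsFrom (s : Sys κ I) (c : κ × (I → ℕ → Bool)) : Prop := ∃ t, s.halt (s.run c t).1

theorem Reach.refl (s : Sys κ I) (c) : s.Reach c c := ⟨0, by simp, by simp⟩

theorem Reach.trans {s : Sys κ I} {c c' c''} (h : s.Reach c c') (h' : s.Reach c' c'') :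
    s.Reach c c'' := by
  obtain ⟨t, rfl, ht⟩ := h
  obtain ⟨t', rfl, ht'⟩ := h'
  refine ⟨t + t', run_add .., fun u hu => ?_⟩
  rcases lt_or_ge u t with h | h
  · exact ht u h
  · obtain ⟨y, rfl⟩ := exists_add_of_le h
    rw [run_add]
    exact ht' y (by simpa using hu)

theorem Reach.step {s : Sys κ I} {c} (h : ¬ s.halt c.1) : s.Reach c (s.step c) :=
  ⟨1, by simpa using s.run_add_one c 0, by simpa using h⟩

theorem Reach.haltsFrom_iff {s : Sys κ I} {c c'} (h : s.Reach c c') :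
    s.HaltsFrom c ↔ s.HaltsFrom c' := by
  obtain ⟨t, rfl, ht⟩ := h
  constructor
  · rintro ⟨u, hu⟩
    rcases lt_or_ge u t with h | h
    · exact absurd hu (ht u h)
    · obtain ⟨y, rfl⟩ := exists_add_of_le h
      exact ⟨y, by rwa [run_add] at hu⟩
  · rintro ⟨u, hu⟩
    exact ⟨t + u, by rwa [run_add]⟩

/-- A finite path from `c` to `c'`, with `P` at each configuration before `c'`. -/
def Path (s : Sys κ I) (P : κ × (I → ℕ → Bool) → Prop) (c c' : κ × (I → ℕ → Bool)) : Prop :=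
  ∃ n, s.step^[n] c = c' ∧ ∀ m < n, P (s.step^[m] c)

theorem Path.refl (s : Sys κ I) (P) (c) : s.Path P c c := ⟨0, rfl, by simp⟩

theorem Path.trans {s : Sys κ I} {P} {c c' c''} (h : s.Path P c c') (h' : s.Path P c' c'') :
    s.Path P c c'' := by
  obtain ⟨t, rfl, ht⟩ := h
  obtain ⟨t', rfl, ht'⟩ := h'
  refine ⟨t' + t, Function.iterate_add_apply .., fun u hu => ?_⟩
  rcases lt_or_ge u t with h | h
  · exact ht u h
  · obtain ⟨y, rfl⟩ := Nat.exists_eq_add_of_le' h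
    rw [Function.iterate_add_apply]
    exact ht' y (by simpa using hu)

theorem Path.head {s : Sys κ I} {P} {c c' c''} (hc : P c) (h : s.step c = c')
    (h' : s.Path P c' c'') : s.Path P c c'' :=
  Path.trans ⟨1, h, by simpa using hc⟩ h'

theorem Path.single {s : Sys κ I} {P} {c c'} (hc : P c) (h : s.step c = c') : s.Path P c c' :=
  Path.head hc h (Path.refl ..)

theorem Path.tail {s : Sys κ I} {P} {c c' c''} (h' : s.Path P c c') (hc : P c')
    (h : s.step c' = c'') : s.Path P c c'' :=
  h'.trans (Path.single hc h)

/-- Concatenation of a family of paths. -/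
theorem Path.iter {s : Sys κ I} {P} (f : ℕ → κ × (I → ℕ → Bool)) (n : ℕ)
    (h : ∀ m < n, s.Path P (f m) (f (m + 1))) : s.Path P (f 0) (f n) := by
  induction n with
  | zero => exact Path.refl ..
  | succ n ih => exact (ih fun m hm => h m (by omega)).trans (h n (by omega))

theorem Path.of_ne {s : Sys κ I} {P : κ × (I → ℕ → Bool) → Prop} {c c'} (h : s.Path P c c')
    (hne : c ≠ c') : P c ∧ s.Path P (s.step c) c' := by
  obtain ⟨n, h, hn⟩ := h
  cases n with
  | zero => exact absurd h hne
  | succ n => exact ⟨hn 0 n.succ_pos, n, h, fun m hm => hn (m + 1) (by omega)⟩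

theorem Path.reach {s : Sys κ I} {P : κ × (I → ℕ → Bool) → Prop} {c c'} (h : s.Path P c c')
    (hP : ∀ c, P c → ¬ s.halt c.1) : s.Reach c c' := by
  obtain ⟨n, rfl, hn⟩ := h
  refine ⟨n, run_natCast .., fun u hu => ?_⟩
  obtain ⟨m, rfl⟩ := Ordinal.lt_omega0.1 (hu.trans (Ordinal.natCast_lt_omega0 n))
  rw [run_natCast]
  exact hP _ (hn m (by exact_mod_cast hu))

/-- If from `c` on the tapes stay the same for `ω` steps, then they are the same at stage `ω`. -/
theorem reach_omega_of_const {s : Sys κ I} {τ : I → ℕ → Bool} (f : ℕ → κ)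
    (hf : ∀ n, s.step (f n, τ) = (f (n + 1), τ)) (hh : ∀ n, ¬ s.halt (f n)) :
    s.Reach (f 0, τ) (s.lim, τ) := by
  have key : ∀ n : ℕ, s.run (f 0, τ) n = (f n, τ) := by
    intro n
    induction n with
    | zero => simp
    | succ n ih => rw [Nat.cast_succ, run_add_one, ih, hf]
  refine ⟨Ordinal.omega0, ?_, fun u hu => ?_⟩
  · ext1
    · exact run_limit_fst s _ Ordinal.isSuccLimit_omega0
    funext i j
    rw [Bool.eq_iff_iff, run_limit_snd s _ Ordinal.isSuccLimit_omega0]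
    constructor
    · intro h
      obtain ⟨a, ha, -, h⟩ := h 0 Ordinal.omega0_pos
      obtain ⟨n, rfl⟩ := Ordinal.lt_omega0.1 ha
      rwa [key] at h
    · intro h b hb
      obtain ⟨n, rfl⟩ := Ordinal.lt_omega0.1 hb
      exact ⟨n, hb, le_rfl, by rwa [key]⟩
  · obtain ⟨n, rfl⟩ := Ordinal.lt_omega0.1 hu
    rw [key]; exact hh n

/-! ### Simulations that pass through limit stages -/

/-- What holds between stages of a simulation: no halting, the cells of `B` have their value in `b`
or in the next configuration, and the cells in `K` have value `v`. -/
def Between (A : Sys κ I) (B : Sys κ' I') (emb : I' → ℕ → I × ℕ) (K : I → ℕ → Prop)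
    (v : I → ℕ → Bool) (b : κ' × (I' → ℕ → Bool)) (c : κ × (I → ℕ → Bool)) : Prop :=
  ¬ A.halt c.1 ∧
  (∀ j n, c.2 (emb j n).1 (emb j n).2 = b.2 j n ∨
    c.2 (emb j n).1 (emb j n).2 = (B.step b).2 j n) ∧
  ∀ i n, K i n → c.2 i n = v i n

/-- `A` simulates `B`. -/
structure Sim (A : Sys κ I) (B : Sys κ' I') (emb : I' → ℕ → I × ℕ) (K : I → ℕ → Prop)
    (v : I → ℕ → Bool) (R : κ × (I → ℕ → Bool) → κ' × (I' → ℕ → Bool) → Prop) : Prop where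
  cells : ∀ a b, R a b → ∀ j n, a.2 (emb j n).1 (emb j n).2 = b.2 j n
  step : ∀ a b, R a b → ¬ B.halt b.1 → ∃ a', R a' (B.step b) ∧
    A.Between B emb K v b a ∧ A.Path (A.Between B emb K v b) (A.step a) a'
  lim : ∀ (τ : I → ℕ → Bool) (σ : I' → ℕ → Bool),
    (∀ j n, τ (emb j n).1 (emb j n).2 = σ j n) → (∀ i n, K i n → τ i n = v i n) →
    R (A.lim, τ) (B.lim, σ)

/-- The function `t` sends a stage of `B` to the corresponding stage of `A`. Normality makes `t l` a
limit when `l` is one, and the stages of `A` below `t l` are then covered by the intervals from `t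
γ` to `t (γ + 1)` with `γ < l`, on which `Between` controls the tapes. -/
theorem Sim.reach_aux {A : Sys κ I} {B : Sys κ' I'} {emb K v R} (S : Sim A B emb K v R)
    {a0 b0} (h0 : R a0 b0) : ∃ t : Ordinal.{0} → Ordinal.{0}, IsNormal t ∧ t 0 = 0 ∧
      ∀ β, (∀ γ < β, ¬ B.halt (B.run b0 γ).1) → R (A.run a0 (t β)) (B.run b0 β) ∧
        ∀ u < t β, ∃ γ < β, u < t (γ + 1) ∧ A.Between B emb K v (B.run b0 γ) (A.run a0 u) := by
  classical
  have hN : ∀ a b, ∃ n : ℕ, R a b → ¬ B.halt b.1 → R (A.step^[n + 1] a) (B.step b) ∧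
      ∀ m < n + 1, A.Between B emb K v b (A.step^[m] a) := by
    intro a b
    by_cases h : R a b ∧ ¬ B.halt b.1
    · obtain ⟨a', h1, h2, n, h3, h4⟩ := S.step a b h.1 h.2
      refine ⟨n, fun _ _ => ⟨by rwa [Function.iterate_succ_apply, h3], ?_⟩⟩
      rintro (_ | m) hm
      · exact h2
      · exact h4 m (by omega)
    · exact ⟨0, fun h1 h2 => absurd ⟨h1, h2⟩ h⟩
  choose N hN using hN
  let t : Ordinal.{0} → Ordinal.{0} := fun β => Ordinal.limitRecOn β 0
    (fun γ tγ => tγ + (N (A.run a0 tγ) (B.run b0 γ) + 1 : ℕ))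
    (fun l _ ih => ⨆ x : Set.Iio l, ih x.1 x.2)
  have t0 : t 0 = 0 := Ordinal.limitRecOn_zero ..
  have t1 : ∀ γ, t (γ + 1) = t γ + (N (A.run a0 (t γ)) (B.run b0 γ) + 1 : ℕ) :=
    fun γ => Ordinal.limitRecOn_add_one ..
  have tl : ∀ l, IsSuccLimit l → t l = ⨆ x : Set.Iio l, t x.1 :=
    fun l hl => Ordinal.limitRecOn_limit _ _ _ _ hl
  have tn : IsNormal t := by
    refine IsNormal.of_succ_lt ?_ ?_
    · intro a
      rw [succ_eq_add_one, t1]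
      exact lt_add_of_pos_right _ (by exact_mod_cast Nat.succ_pos _)
    · intro l hl
      rw [tl l hl]
      have : Nonempty (Set.Iio l) := ⟨0, hl.bot_lt⟩
      have := isLUB_ciSup (f := fun x : Set.Iio l => t x.1) Ordinal.bddAbove_of_small
      rwa [Set.image_eq_range]
  have tlim : ∀ {l}, IsSuccLimit l → IsSuccLimit (t l) := fun hl => tn.map_isSuccLimit hl
  refine ⟨t, tn, t0, fun β => ?_⟩
  induction β using Ordinal.limitRecOn with
  | zero => simpa [t0] using h0
  | add_one β ih =>
    intro hβ
    obtain ⟨hR, hB⟩ := ih fun γ hγ => hβ γ (hγ.trans (lt_add_one β))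
    obtain ⟨h1, h2⟩ := hN _ _ hR (hβ β (lt_add_one β))
    refine ⟨?_, fun u hu => ?_⟩
    · rw [t1, run_add, run_natCast, run_add_one]; exact h1
    · rcases lt_or_ge u (t β) with h | h
      · obtain ⟨γ, hγ, h⟩ := hB u h
        exact ⟨γ, hγ.trans (lt_add_one β), h⟩
      · obtain ⟨y, rfl⟩ := exists_add_of_le h
        rw [t1] at hu
        have hy := (add_lt_add_iff_left _).1 hu
        obtain ⟨m, rfl⟩ := Ordinal.lt_omega0.1 (hy.trans (Ordinal.natCast_lt_omega0 _))
        refine ⟨β, lt_add_one β, by rw [t1]; gcongr, ?_⟩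
        rw [run_add, run_natCast]
        exact h2 m (by exact_mod_cast hy)
  | limit l hl ih =>
    intro hβ
    have hbel : ∀ u < t l, ∃ γ < l, u < t (γ + 1) ∧
        A.Between B emb K v (B.run b0 γ) (A.run a0 u) := by
      intro u hu
      obtain ⟨γ, hγ, hu⟩ := (tn.lt_iff_exists_lt hl).1 hu
      obtain ⟨δ, hδ, h⟩ := (ih γ hγ fun x hx => hβ x (hx.trans hγ)).2 u hu
      exact ⟨δ, hδ.trans hγ, h⟩
    refine ⟨?_, hbel⟩
    have hA : A.run a0 (t l) = (A.lim, (A.run a0 (t l)).2) := by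
      rw [← run_limit_fst A a0 (tlim hl)]
    have hB : B.run b0 l = (B.lim, (B.run b0 l).2) := by
      rw [← run_limit_fst B b0 hl]
    rw [hA, hB]
    refine S.lim _ _ (fun j n => ?_) (fun i n hK => ?_)
    · rw [Bool.eq_iff_iff, run_limit_snd A _ (tlim hl), run_limit_snd B _ hl]
      constructor
      · intro h b hb
        -- A 1 at stage `u` of `A` lies in the interval of some `δ ≥ b`, so it is a 1 of `B` at
        -- stage `δ` or at stage `δ + 1`; both are below `l`.
        obtain ⟨u, hu, hbu, h⟩ := h (t b) (tn.strictMono hb)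
        obtain ⟨δ, hδ, hδu, hbet⟩ := hbel u hu
        have hbδ : b ≤ δ := lt_add_one_iff.1 (tn.strictMono.lt_iff_lt.1 (hbu.trans_lt hδu))
        rcases hbet.2.1 j n with h' | h'
        · exact ⟨δ, hδ, hbδ, by rw [← h', h]⟩
        · exact ⟨δ + 1, hl.add_one_lt hδ, hbδ.trans (lt_add_one δ).le, by
            rw [run_add_one, ← h', h]⟩
      · intro h b hb
        -- Conversely, a 1 of `B` at a late stage `δ` is a 1 of `A` at stage `t δ`, and these stages
        -- are cofinal in `t l`.
        obtain ⟨γ, hγ, hb⟩ := (tn.lt_iff_exists_lt hl).1 hb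
        obtain ⟨δ, hδ, hγδ, h⟩ := h γ hγ
        refine ⟨t δ, tn.strictMono hδ, hb.le.trans (tn.strictMono.monotone hγδ), ?_⟩
        rw [S.cells _ _ (ih δ hδ fun x hx => hβ x (hx.trans hδ)).1, h]
    · rw [Bool.eq_iff_iff, run_limit_snd A _ (tlim hl)]
      constructor
      · intro h
        obtain ⟨u, hu, -, h⟩ := h 0 (tlim hl).bot_lt
        obtain ⟨γ, -, -, hbet⟩ := hbel u hu
        rw [← hbet.2.2 i n hK, h]
      · intro h b hb
        obtain ⟨γ, -, -, hbet⟩ := hbel b hb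
        exact ⟨b, hb, le_rfl, by rw [hbet.2.2 i n hK, h]⟩

theorem Sim.reach {A : Sys κ I} {B : Sys κ' I'} {emb K v R} (S : Sim A B emb K v R)
    {a0 b0 b} (h0 : R a0 b0) (hb : B.Reach b0 b) : ∃ a, A.Reach a0 a ∧ R a b := by
  obtain ⟨t, -, -, h⟩ := S.reach_aux h0
  obtain ⟨β, rfl, hβ⟩ := hb
  obtain ⟨h1, h2⟩ := h β hβ
  refine ⟨_, ⟨t β, rfl, fun u hu => ?_⟩, h1⟩
  obtain ⟨γ, -, -, h⟩ := h2 u hu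
  exact h.1

theorem HaltsFrom.exists_reach {s : Sys κ I} {c} (h : s.HaltsFrom c) :
    ∃ c', s.Reach c c' ∧ s.halt c'.1 := by
  let S : Set Ordinal.{0} := {t | s.halt (s.run c t).1}
  have hS : S.Nonempty := h
  exact ⟨_, ⟨sInf S, rfl, fun u hu h => (notMem_of_lt_csInf' hu) h⟩, csInf_mem hS⟩

/-- A normal function satisfies `β ≤ t β`, so the stage `u` of `A` lies below `t (u + 1)` and falls
within the simulation, where `A` does not halt. -/
theorem Sim.not_haltsFrom {A : Sys κ I} {B : Sys κ' I'} {emb K v R} (S : Sim A B emb K v R)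
    {a0 b0} (h0 : R a0 b0) (hb : ¬ B.HaltsFrom b0) : ¬ A.HaltsFrom a0 := by
  obtain ⟨t, tn, -, h⟩ := S.reach_aux h0
  rintro ⟨u, hu⟩
  obtain ⟨γ, -, -, h⟩ := (h (u + 1) fun γ _ h => hb ⟨γ, h⟩).2 u
    ((lt_add_one u).trans_le tn.strictMono.le_apply)
  exact h.1 hu

theorem Sim.haltsFrom_iff {A : Sys κ I} {B : Sys κ' I'} {emb K v R} (S : Sim A B emb K v R)
    (hR : ∀ a b, R a b → B.halt b.1 → A.HaltsFrom a) {a0 b0} (h0 : R a0 b0) :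
    A.HaltsFrom a0 ↔ B.HaltsFrom b0 := by
  refine ⟨fun h => by_contra fun hb => S.not_haltsFrom h0 hb h, fun h => ?_⟩
  obtain ⟨b, hb, hh⟩ := h.exists_reach
  obtain ⟨a, ha, hab⟩ := S.reach h0 hb
  exact ha.haltsFrom_iff.2 (hR a b hab hh)

end Sys

end ITTM

namespace ITTM

open Order

/-! ### Programs as transfinite systems -/

/-- The transfinite system of program `p`, with control part the state and the head position. -/
def ittm (k p : ℕ) : Sys (ℕ × ℕ) (Fin (k + 2)) where
  lim := (limitState, 0)
  step c :=
    let c' := Config.step p ⟨c.1.1, c.1.2, c.2⟩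
    ((c'.state, c'.head), c'.tape)
  halt c := c.1 = haltState

/-- The tapes of a program at the start. -/
def initTape {k : ℕ} (x : Fin k → Cantor) : Fin (k + 2) → ℕ → Bool := (Config.init x).tape

theorem ittm_run {k : ℕ} (p : ℕ) (x : Fin k → Cantor) (a : Ordinal.{0}) :
    (ittm k p).run ((startState, 0), initTape x) a =
      (((run p x a).state, (run p x a).head), (run p x a).tape) := by
  induction a using Ordinal.limitRecOn with
  | zero => simp only [Sys.run_zero]; unfold run; rw [Ordinal.limitRecOn_zero]; rfl
  | add_one a ih =>
    rw [Sys.run_add_one, ih]; unfold run; rw [Ordinal.limitRecOn_add_one]; rfl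
  | limit l hl ih =>
    rw [Sys.run_limit _ _ hl]
    unfold run
    rw [Ordinal.limitRecOn_limit _ _ _ _ hl]
    refine Prod.ext rfl ?_
    funext i j
    refine decide_eq_decide.2 (forall₂_congr fun b _ => exists_congr fun a => ?_)
    rw [← exists_prop]
    refine exists_congr fun ha => ?_
    rw [ih a ha]; rfl

theorem halts_iff {k : ℕ} (p : ℕ) (x : Fin k → Cantor) :
    Halts p x ↔ (ittm k p).HaltsFrom ((startState, 0), initTape x) := by
  simp only [Halts, Sys.HaltsFrom, ittm_run]; rfl

/-- `Reach` excludes earlier halting, so a halting configuration that is reached is the one at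
`haltTime`. -/
theorem phi_eq_of_reach {k : ℕ} {p : ℕ} {x : Fin k → Cantor} {c}
    (h : (ittm k p).Reach ((startState, 0), initTape x) c) (hc : c.1.1 = haltState)
    (hx : (phi p x).Dom) : (phi p x).get hx = c.2 (Fin.last (k + 1)) := by
  obtain ⟨t, rfl, ht⟩ := h
  have : haltTime p x = t := by
    rw [ittm_run] at hc
    refine le_antisymm (csInf_le' hc) (le_csInf ⟨t, hc⟩ fun b hb => le_of_not_gt fun hbt => ?_)
    have := ht b hbt
    rw [ittm_run] at this
    exact this hb
  subst this
  rw [ittm_run]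
  rfl

theorem exists_reach_of_dom {k : ℕ} {p : ℕ} {x : Fin k → Cantor} (hx : (phi p x).Dom) :
    ∃ c, (ittm k p).Reach ((startState, 0), initTape x) c ∧ c.1.1 = haltState ∧
      c.2 (Fin.last (k + 1)) = (phi p x).get hx := by
  obtain ⟨c, hc, hh⟩ := ((halts_iff p x).1 hx).exists_reach
  exact ⟨c, hc, hh, (phi_eq_of_reach hc hh hx).symm⟩

/-! ### Multi-head machines -/

inductive Dir
  | left
  | stay
  | right
  deriving DecidableEq

def Dir.move : Dir → ℕ → ℕ
  | .left, n => n - 1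
  | .stay, n => n
  | .right, n => n + 1

/-- A machine with tapes `I`, heads `M` and states `Q`, in each of which one of the heads is active.
The machine starts in its limit state. -/
structure MH (I M Q : Type) where
  lim : Q
  halt : Q
  hd : Q → M
  act : Q → (I → Bool) → (I → Bool) × Dir × Q

namespace MH

variable {I M Q : Type}

def stepAux [DecidableEq M] (pos : M → ℕ) (τ : I → ℕ → Bool) (h : M)
    (a : (I → Bool) × Dir × Q) : (Q × (M → ℕ)) × (I → ℕ → Bool) :=
  ((a.2.2, Function.update pos h (a.2.1.move (pos h))),
    fun i => Function.update (τ i) (pos h) (a.1 i))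

def sys [DecidableEq M] (W : MH I M Q) : Sys (Q × (M → ℕ)) I where
  lim := (W.lim, fun _ => 0)
  step c := stepAux c.1.2 c.2 (W.hd c.1.1) (W.act c.1.1 fun i => c.2 i (c.1.2 (W.hd c.1.1)))
  halt c := c.1 = W.halt

/-- The configuration in which the machine starts on tapes `τ`. -/
def start (W : MH I M Q) (τ : I → ℕ → Bool) : (Q × (M → ℕ)) × (I → ℕ → Bool) :=
  ((W.lim, fun _ => 0), τ)

/-- A machine with one head that moves in each step. -/
structure Simple (W : MH I Unit Q) : Prop where
  act_ne_stay : ∀ q r, (W.act q r).2.1 ≠ .stay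
  lim_ne_halt : W.lim ≠ W.halt

end MH

/-! ### The coding of programs -/

/-- The digits `1^(a₀) 0 1^(a₁) 0 …` of a table. -/
def enc (l : List ℕ) : List Bool := l.flatMap fun a => List.replicate a true ++ [false]

def toReal (L : List Bool) : Cantor := fun i => L.getD i false

theorem update_toReal (L : List Bool) (b : Bool) :
    Function.update (toReal L) L.length b = toReal (L ++ [b]) := by
  funext i
  by_cases h : i = L.length
  · subst h; simp [toReal]
  · rw [Function.update_of_ne h]
    simp only [toReal, List.getD_eq_getElem?_getD, List.getElem?_append]
    split_ifs with h'
    · rfl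
    · rw [List.getElem?_eq_none (by omega), List.getElem?_eq_none (by simp; omega)]

theorem toReal_append_false (L : List Bool) : toReal (L ++ [false]) = toReal L := by
  rw [← update_toReal, Function.update_eq_self_iff]; simp [toReal]

theorem ofNat_eq_toReal (n : ℕ) : ofNat n = toReal n.bits := by
  funext i
  rw [ofNat, Nat.testBit_eq_inth, List.getI_eq_getElem?_getD, toReal,
    List.getD_eq_getElem?_getD]; rfl

theorem exists_ofNat_eq (L : List Bool) : ∃ n, ofNat n = toReal L := by
  induction L with
  | nil => exact ⟨0, by funext i; simp [ofNat, toReal]⟩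
  | cons b L ih =>
    obtain ⟨n, hn⟩ := ih
    refine ⟨Nat.bit b n, ?_⟩
    funext i
    cases i with
    | zero => simp [ofNat, toReal]
    | succ i => simpa [ofNat, toReal, Nat.testBit_bit_succ] using congrFun hn i

/-- Re-encoding adds a final 0 to the digits, which is invisible in the real; hence the digits of
`p` are the code of `table p`. -/
theorem enc_splitOn (L : List Bool) : enc ((L.splitOn false).map List.length) = L ++ [false] := by
  induction L with
  | nil => simp [enc]
  | cons b L ih =>
    rw [List.splitOn, List.splitOnP_cons_eq_if_modifyHead]
    rw [List.splitOn] at ih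
    cases b
    · simpa [enc] using ih
    · obtain ⟨a, t, h⟩ := List.exists_cons_of_ne_nil (List.splitOnP_ne_nil (· == false) L)
      rw [h] at ih ⊢
      simpa [enc, List.replicate_succ] using ih

/-- The position of entry `e` of a table with entries `a`. -/
def entryPos (a : ℕ → ℕ) (e : ℕ) : ℕ := ∑ i ∈ Finset.range e, (a i + 1)

theorem entryPos_succ (a : ℕ → ℕ) (e : ℕ) : entryPos a (e + 1) = entryPos a e + a e + 1 := by
  rw [entryPos, Finset.sum_range_succ, entryPos, add_assoc]

theorem entryPos_zero (a : ℕ → ℕ) : entryPos a 0 = 0 := rfl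

/-- The real `P` is the table with entries `a`. -/
def Parse (P : Cantor) (a : ℕ → ℕ) : Prop :=
  ∀ e, (∀ j < a e, P (entryPos a e + j) = true) ∧ P (entryPos a e + a e) = false

/-- Unary blocks closed by a 0 are self-delimiting: once the earlier entries agree, the next one
starts at the same cell and ends at the first 0. This recovers table entries from a real. -/
theorem Parse.unique {P : Cantor} {a b : ℕ → ℕ} (ha : Parse P a) (hb : Parse P b) : a = b := by
  funext e
  induction e using Nat.strong_induction_on with
  | _ e ih =>
    have h : entryPos a e = entryPos b e :=
      Finset.sum_congr rfl fun i hi => by rw [ih i (Finset.mem_range.1 hi)]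
    obtain ⟨h1, h2⟩ := ha e
    obtain ⟨h3, h4⟩ := hb e
    rw [h] at h1 h2
    rcases lt_trichotomy (a e) (b e) with hlt | heq | hlt
    · rw [h3 _ hlt] at h2; cases h2
    · exact heq
    · rw [h1 _ hlt] at h4; cases h4

theorem parse_enc (l : List ℕ) : Parse (toReal (enc l)) fun e => l.getD e 0 := by
  induction l with
  | nil => intro e; simp [toReal, enc]
  | cons a l ih =>
    have hpos : ∀ e, entryPos (fun e => (a :: l).getD e 0) (e + 1) =
        a + 1 + entryPos (fun e => l.getD e 0) e := by
      intro e; rw [entryPos, Finset.sum_range_succ', add_comm]; rfl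
    have hlo : ∀ j < a, toReal (enc (a :: l)) j = true := by
      intro j hj
      simp only [toReal, enc, List.flatMap_cons, List.append_assoc]
      rw [List.getD_append _ _ _ _ (by simpa using hj)]
      simp [hj]
    have hmid : toReal (enc (a :: l)) a = false := by
      simp [toReal, enc]
    have hhi : ∀ j, toReal (enc (a :: l)) (a + 1 + j) = toReal (enc l) j := by
      intro j
      simp only [toReal, enc, List.flatMap_cons]
      rw [List.getD_append_right _ _ _ _ (by simp)]
      simp
    intro e
    cases e with
    | zero => exact ⟨by simpa [entryPos_zero] using hlo, by simpa [entryPos_zero] using hmid⟩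
    | succ e =>
      rw [hpos]
      refine ⟨fun j hj => ?_, ?_⟩
      · rw [add_assoc, hhi]; exact (ih e).1 j hj
      · rw [add_assoc, hhi]; exact (ih e).2

theorem parse_table (p : ℕ) : Parse (ofNat p) fun e => (table p).getD e 0 := by
  have := parse_enc (table p)
  rwa [table, enc_splitOn, toReal_append_false, ← ofNat_eq_toReal] at this

theorem exists_program (l : List ℕ) :
    ∃ p, ofNat p = toReal (enc l) ∧ ∀ i, (table p).getD i 0 = l.getD i 0 := by
  obtain ⟨p, hp⟩ := exists_ofNat_eq (enc l)
  exact ⟨p, hp, congrFun ((hp ▸ parse_table p).unique (parse_enc l))⟩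

/-! ### Tables of finite machines -/

/-- The number of an action. -/
def actionCode {k : ℕ} (w : Fin (k + 2) → Bool) (right : Bool) (next : ℕ) : ℕ :=
  2 ^ (k + 3) * next + Nat.ofBits (Fin.snoc w right : Fin (k + 3) → Bool)

theorem ofCode_actionCode {k : ℕ} (w : Fin (k + 2) → Bool) (right : Bool) (next : ℕ) :
    Action.ofCode k (actionCode w right next) = ⟨w, right, next⟩ := by
  have hlt := Nat.ofBits_lt_two_pow (Fin.snoc w right : Fin (k + 3) → Bool)
  simp only [Action.ofCode, actionCode, Action.mk.injEq]
  refine ⟨?_, ?_, ?_⟩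
  · funext i
    rw [Nat.testBit_two_pow_mul_add _ hlt, if_pos (by omega),
      Nat.testBit_ofBits_lt _ _ (by omega)]
    exact Fin.snoc_castSucc (α := fun _ => Bool) right w i
  · rw [Nat.testBit_two_pow_mul_add _ hlt, if_pos (by omega),
      Nat.testBit_ofBits_lt _ _ (by omega)]
    exact Fin.snoc_last (α := fun _ => Bool) right w
  · rw [Nat.mul_add_div (by positivity), Nat.div_eq_of_lt hlt, add_zero]

theorem sum_toNat_eq_ofBits {n : ℕ} (r : Fin n → Bool) :
    ∑ i : Fin n, (r i).toNat * 2 ^ (i : ℕ) = Nat.ofBits r := by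
  induction n with
  | zero => simp [Nat.ofBits]
  | succ n ih =>
    rw [Nat.ofBits_succ, Fin.sum_univ_succ, ← ih, Finset.mul_sum, add_comm]
    congr 1
    · exact Finset.sum_congr rfl fun i _ => by simp [pow_succ]; ring
    · simp

theorem ofBits_testBit {n : ℕ} (r : Fin n → Bool) :
    (fun i : Fin n => (Nat.ofBits r).testBit i) = r := by
  funext i; exact Nat.testBit_ofBits_lt _ _ _

theorem action_eq {k : ℕ} (p q : ℕ) (r : Fin (k + 2) → Bool) :
    action p q r = Action.ofCode k ((table p).getD (q * 2 ^ (k + 2) + Nat.ofBits r) 0) := by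
  rw [action, sum_toNat_eq_ofBits]

variable {k : ℕ} {Q : Type}

/-- In the states with numbers `ν q`, program `p` behaves like `G`. -/
def Implements (G : MH (Fin (k + 2)) Unit Q) (ν : Q → ℕ) (p : ℕ) : Prop :=
  ∀ q r, action p (ν q) r =
    ⟨(G.act q r).1, decide ((G.act q r).2.1 = .right), ν (G.act q r).2.2⟩

/-- No state of `G` gets the number 0, so row 0 of the table is free. It is filled with a copy of
row 1, which makes the start state act like the limit state; the self-quoting program will put
something else there. -/
theorem exists_table [Finite Q] (G : MH (Fin (k + 2)) Unit Q) (hG : G.lim ≠ G.halt) :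
    ∃ (ν : Q → ℕ) (N : ℕ) (l : List ℕ), ν G.lim = limitState ∧ (∀ q, ν q = haltState ↔ q = G.halt) ∧
      2 < N ∧ l.length = N * 2 ^ (k + 2) ∧
      (∀ p, (∀ i, 2 ^ (k + 2) ≤ i → i < l.length → (table p).getD i 0 = l.getD i 0) →
        Implements G ν p) ∧
      ∀ i < 2 ^ (k + 2), l.getD i 0 = l.getD (2 ^ (k + 2) + i) 0 := by
  classical
  obtain ⟨n, ⟨e⟩⟩ := Finite.exists_equiv_fin Q
  -- Limit and halt state get their prescribed numbers 1 and 2, all other states numbers from 3 on.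
  let ν : Q → ℕ := fun q => if q = G.lim then 1 else if q = G.halt then 2 else e q + 3
  have hν : Function.Injective ν := by
    intro q q' h
    simp only [ν] at h
    split_ifs at h <;> first | (simp_all; done) | omega | skip
    exact e.injective (Fin.ext (by omega))
  have hpos : ∀ q, 1 ≤ ν q := by intro q; simp only [ν]; split_ifs <;> omega
  have hlt : ∀ q, ν q < n + 3 := by intro q; simp only [ν]; split_ifs <;> omega
  let f : ℕ → (Fin (k + 2) → Bool) → ℕ := fun s r =>
    if h : ∃ q, ν q = s then
      actionCode (G.act h.choose r).1 (decide ((G.act h.choose r).2.1 = .right))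
        (ν (G.act h.choose r).2.2)
    else 0
  have hf : ∀ q r, f (ν q) r =
      actionCode (G.act q r).1 (decide ((G.act q r).2.1 = .right)) (ν (G.act q r).2.2) := by
    intro q r
    have h : ∃ q', ν q' = ν q := ⟨q, rfl⟩
    have hq : h.choose = q := hν h.choose_spec
    simp only [f, dif_pos h, hq]
  -- The maximum with 1 makes row 0 a copy of row 1.
  let g : ℕ → ℕ := fun i =>
    f (max 1 (i / 2 ^ (k + 2))) fun j => (i % 2 ^ (k + 2)).testBit j
  have hg : ∀ s r, g (s * 2 ^ (k + 2) + Nat.ofBits r) = f (max 1 s) r := by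
    intro s r
    have h := Nat.ofBits_lt_two_pow r
    have h1 : (s * 2 ^ (k + 2) + Nat.ofBits r) / 2 ^ (k + 2) = s := by
      rw [mul_comm, Nat.mul_add_div (by positivity), Nat.div_eq_of_lt h, add_zero]
    have h2 : (s * 2 ^ (k + 2) + Nat.ofBits r) % 2 ^ (k + 2) = Nat.ofBits r := by
      rw [mul_comm, Nat.mul_add_mod, Nat.mod_eq_of_lt h]
    simp only [g, h1, h2, ofBits_testBit]
  refine ⟨ν, n + 3, (List.range ((n + 3) * 2 ^ (k + 2))).map g, by simp [ν, limitState], ?_,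
    by omega, by simp, ?_, ?_⟩
  · intro q
    simp only [ν, haltState]
    split_ifs with h1 h2
    · simp [h1, hG]
    · simp [h2]
    · simp [h2]
  · intro p hp q r
    have h := Nat.ofBits_lt_two_pow r
    have hi : ν q * 2 ^ (k + 2) + Nat.ofBits r < (n + 3) * 2 ^ (k + 2) :=
      calc _ < ν q * 2 ^ (k + 2) + 2 ^ (k + 2) := by omega
        _ = (ν q + 1) * 2 ^ (k + 2) := by ring
        _ ≤ _ := Nat.mul_le_mul_right _ (hlt q)
    rw [action_eq, hp _ ((Nat.le_mul_of_pos_left _ (hpos q)).trans le_self_add) (by simpa using hi),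
      List.getD_eq_getElem?_getD, List.getElem?_map, List.getElem?_range hi]
    simp only [Option.map_some, Option.getD_some]
    rw [hg, max_eq_right (hpos q), hf, ofCode_actionCode]
  · intro i hi
    have h1 : i < (n + 3) * 2 ^ (k + 2) := by nlinarith
    have h2 : 2 ^ (k + 2) + i < (n + 3) * 2 ^ (k + 2) := by nlinarith
    simp only [List.getD_eq_getElem?_getD, List.getElem?_map, List.getElem?_range h1,
      List.getElem?_range h2, Option.map_some, Option.getD_some]
    simp only [g, Nat.div_eq_of_lt hi, Nat.add_mod_left, Nat.add_div_left i (Nat.two_pow_pos (k + 2))]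
    rfl

/-- A program that implements `G` simulates it step by step. -/
theorem Implements.sim {G : MH (Fin (k + 2)) Unit Q} (hG : G.Simple) {ν : Q → ℕ} {p : ℕ}
    (h : Implements G ν p) (hlim : ν G.lim = limitState) (hhalt : ∀ q, ν q = haltState ↔ q = G.halt)
    {s : ℕ} (hs : s ≠ haltState) (hs' : ∀ r : Fin (k + 2) → Bool, action p s r = action p 1 r) :
    Sys.Sim (ittm k p) G.sys (fun i n => (i, n)) (fun _ _ => False) (fun _ _ => false)
      (fun a b => a.1.2 = b.1.2 () ∧ a.2 = b.2 ∧ (a.1.1 = ν b.1.1 ∨ a.1.1 = s ∧ b.1.1 = G.lim)) := by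
  refine ⟨?_, ?_, ?_⟩
  · rintro a b ⟨-, h, -⟩ j n; rw [h]
  · rintro ⟨⟨s', n⟩, τ⟩ ⟨⟨q, pos⟩, τ'⟩ ⟨h1, h2, h3⟩ hb
    obtain rfl : n = pos () := h1
    obtain rfl : τ = τ' := h2
    simp only at h3
    have hact : ∀ r : Fin (k + 2) → Bool, action p s' r = action p (ν q) r := by
      rcases h3 with rfl | ⟨rfl, rfl⟩
      · exact fun r => rfl
      · intro r; rw [hs', hlim]; rfl
    refine ⟨_, ?_, ?_, Sys.Path.refl ..⟩
    · simp only [ittm, Config.step, MH.sys, MH.stepAux, hact, h q]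
      refine ⟨?_, trivial, by simp⟩
      rw [show G.hd q = () from rfl, Function.update_self]
      have := hG.act_ne_stay q fun i => τ i (pos ())
      revert this
      generalize (G.act q fun i => τ i (pos ())).2.1 = d
      cases d <;> simp [Dir.move]
    · refine ⟨?_, fun j m => Or.inl rfl, by simp⟩
      change s' ≠ haltState
      rcases h3 with rfl | ⟨rfl, rfl⟩
      · exact fun h => hb ((hhalt q).1 h)
      · exact hs
  · intro τ σ h _
    exact ⟨rfl, funext fun j => funext fun n => h j n, Or.inl hlim.symm⟩

end ITTM

namespace ITTM

open Order

namespace MH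

variable {I Q : Type}

/-- A configuration of a machine with one head. -/
def conf (q : Q) (n : ℕ) (τ : I → ℕ → Bool) : (Q × (Unit → ℕ)) × (I → ℕ → Bool) :=
  ((q, fun _ => n), τ)

theorem step_conf (W : MH I Unit Q) (q : Q) (n : ℕ) (τ : I → ℕ → Bool) :
    W.sys.step (conf q n τ) = conf (W.act q fun i => τ i n).2.2
      ((W.act q fun i => τ i n).2.1.move n)
      (fun i => Function.update (τ i) n ((W.act q fun i => τ i n).1 i)) := by
  simp only [sys, stepAux, conf, Function.update_eq_const_of_subsingleton]; rfl

end MH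

theorem Sys.run_omega_of_eventually {κ I : Type} (s : Sys κ I) (c) (σ : I → ℕ → Bool)
    (h : ∀ i j, ∃ N : ℕ, ∀ n ≥ N, (s.run c (n : ℕ)).2 i j = σ i j) :
    s.run c Ordinal.omega0 = (s.lim, σ) := by
  ext1
  · exact run_limit_fst s _ Ordinal.isSuccLimit_omega0
  funext i j
  obtain ⟨N, hN⟩ := h i j
  rw [Bool.eq_iff_iff, run_limit_snd s _ Ordinal.isSuccLimit_omega0]
  constructor
  · intro h
    obtain ⟨a, ha, hNa, h⟩ := h N (Ordinal.natCast_lt_omega0 N)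
    obtain ⟨n, rfl⟩ := Ordinal.lt_omega0.1 ha
    rwa [hN n (by exact_mod_cast hNa)] at h
  · intro h b hb
    obtain ⟨n, rfl⟩ := Ordinal.lt_omega0.1 hb
    exact ⟨(max n N : ℕ), Ordinal.natCast_lt_omega0 _, by exact_mod_cast le_max_left .., by
      rw [hN _ (le_max_right ..)]; exact h⟩

/-! ### Many tapes in blocks on the scratch tape -/

/-- States of the machine that keeps the tapes of another one in blocks on its scratch tape. -/
inductive BlockState (I Q : Type) (k w : ℕ)
  | lim
  | halt
  | copy (v : Fin k → Bool) (z : Bool) (s : Fin w)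
  | mark
  | back
  | got (v : Fin k → Bool)
  | fwd (v : Fin k → Bool)
  | read (q : Q) (s : Fin w) (acc : Fin w → Bool)
  | rewind (n : Fin w) (a : (I → Bool) × Dir × Q)
  | write (s : Fin w) (a : (I → Bool) × Dir × Q)
  | move (n : Fin (2 * w)) (q : Q)

namespace BlockState

variable {I Q : Type} {k w : ℕ}

instance : Finite Dir :=
  Finite.of_injective (β := Fin 3) (fun | .left => 0 | .stay => 1 | .right => 2) (by
    intro a b; cases a <;> cases b <;> simp)

instance [Finite I] [Finite Q] : Finite (BlockState I Q k w) :=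
  Finite.of_equiv _ (proxy_equiv% (BlockState I Q k w))

def copyFrom (v : Fin k → Bool) (z : Bool) (s : ℕ) : BlockState I Q k w :=
  if h : s < w then .copy v z ⟨s, h⟩ else .mark

/-- `n` moves to the left before state `q` is simulated. -/
def moveFrom [NeZero w] (W : MH I Unit Q) [DecidableEq Q] : ℕ → Q → BlockState I Q k w
  | 0, q => if q = W.halt then .halt else .read q 0 fun _ => false
  | n + 1, q => if h : n < 2 * w then .move ⟨n, h⟩ q else .halt

def writeFrom [NeZero w] (W : MH I Unit Q) [DecidableEq Q] (s : ℕ) (a : (I → Bool) × Dir × Q) :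
    BlockState I Q k w :=
  if h : s < w then .write ⟨s, h⟩ a
  else moveFrom W (match a.2.1 with | .left => 2 * w | .stay => w | .right => 0) a.2.2

def rewindFrom [NeZero w] (W : MH I Unit Q) [DecidableEq Q] (n : ℕ) (a : (I → Bool) × Dir × Q) :
    BlockState I Q k w :=
  match n with
  | 0 => writeFrom W 0 a
  | n + 1 => if h : n < w then .rewind ⟨n, h⟩ a else .halt

def readFrom [NeZero w] (W : MH I Unit Q) [DecidableEq Q] (e : I ≃ Fin w) (q : Q) (s : ℕ)
    (acc : Fin w → Bool) : BlockState I Q k w :=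
  if h : s < w then .read q ⟨s, h⟩ acc else rewindFrom W w (W.act q fun i => acc (e i))

end BlockState

open BlockState

section Block

variable {I Q : Type} {k w : ℕ} [NeZero w] [DecidableEq Q]

/-- The scratch tape. -/
def scratch (k : ℕ) : Fin (k + 2) := ⟨k, by omega⟩

/-- The output tape. -/
def output (k : ℕ) : Fin (k + 2) := Fin.last (k + 1)

theorem scratch_ne_output (k : ℕ) : scratch k ≠ output k := by
  simp [scratch, output, Fin.ext_iff]

/-- The digits on the input tapes. -/
def inputs (r : Fin (k + 2) → Bool) : Fin k → Bool := fun i => r ⟨i, by omega⟩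

open Function in
/-- The machine that first copies its input (transformed by `ini`) in blocks to the scratch tape and
then simulates `W`. In the first phase, there are marks on the output tape at cell `0`, at the next
cell `n` to be copied, and at the block for it. -/
def blockMachine (W : MH I Unit Q) (e : I ≃ Fin w) (ini : (Fin k → Bool) → Bool → I → Bool) :
    MH (Fin (k + 2)) Unit (BlockState I Q k w) where
  lim := .lim
  halt := .halt
  hd _ := ()
  act
    | .lim, r =>
      -- At the start the output tape is blank; after the first phase, cell 0 of it carries a mark
      -- at every limit. Moving left on cell 0 serves as staying there.
      if r (output k) then (r, .left, moveFrom W 0 W.lim)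
      else (update (update r (output k) true) (scratch k) (ini (inputs r) true (e.symm 0)),
        .right, copyFrom (inputs r) true 1)
    | .halt, r => (r, .left, .halt)
    | .copy v z s, r =>
      (update (update r (scratch k) (ini v z (e.symm s))) (output k)
        (r (output k) || (z && decide (s.1 = 1))), .right, copyFrom v z (s + 1))
    | .mark, r => (update r (output k) true, .left, .back)
    | .back, r =>
      if r (output k) then (update r (output k) false, .right, .got (inputs r))
      else (r, .left, .back)
    | .got v, r => (update r (output k) true, .right, .fwd v)
    | .fwd v, r =>
      if r (output k) then
        (update (update r (output k) false) (scratch k) (ini v false (e.symm 0)),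
          .right, copyFrom v false 1)
      else (r, .right, .fwd v)
    | .read q s acc, r =>
      (r, .right, readFrom W e q (s + 1) (update acc s (r (scratch k))))
    | .rewind n a, r => (r, .left, rewindFrom W n a)
    | .write s a, r => (update r (scratch k) (a.1 (e.symm s)), .right, writeFrom W (s + 1) a)
    | .move n q, r => (r, .left, moveFrom W n q)

variable (W : MH I Unit Q) (e : I ≃ Fin w) (ini : (Fin k → Bool) → Bool → I → Bool)

theorem blockMachine_simple : (blockMachine W e ini).Simple := by
  refine ⟨fun q r => ?_, by simp [blockMachine]⟩
  cases q <;> simp only [blockMachine] <;> (try split_ifs) <;> simp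

/-- The tapes during the simulation, where `σ` is on the simulated tapes. -/
def blockTape (x : Fin k → Cantor) (σ : I → ℕ → Bool) : Fin (k + 2) → ℕ → Bool := fun i j =>
  if i = scratch k then σ (e.symm (Fin.ofNat w j)) (j / w)
  else if i = output k then decide (j = 0) else initTape x i j

theorem blockTape_scratch (x : Fin k → Cantor) (σ : I → ℕ → Bool) (n : ℕ) (s : Fin w) :
    blockTape e x σ (scratch k) (w * n + s) = σ (e.symm s) n := by
  have h1 : Fin.ofNat w (w * n + s) = s := by
    ext; simp [Fin.ofNat, Nat.mod_eq_of_lt s.2]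
  have h2 : (w * n + s) / w = n := by
    rw [Nat.mul_add_div (NeZero.pos w), Nat.div_eq_of_lt s.2, add_zero]
  simp only [blockTape, if_true, h1, h2]

/-- The mark that distinguishes later limits from the start is also the desired output 1. -/
theorem blockTape_output (x : Fin k → Cantor) (σ : I → ℕ → Bool) :
    blockTape e x σ (output k) = ofNat 1 := by
  funext j
  rw [blockTape, if_neg (scratch_ne_output k).symm, if_pos rfl, ofNat]
  cases j with
  | zero => rfl
  | succ j => simp [Nat.testBit_succ]

theorem block_cases (j : ℕ) : ∃ n, ∃ s : Fin w, j = w * n + s :=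
  ⟨j / w, ⟨j % w, Nat.mod_lt _ (NeZero.pos w)⟩, (Nat.div_add_mod j w).symm⟩

theorem blockTape_eq_of {x : Fin k → Cantor} {τ : Fin (k + 2) → ℕ → Bool} {σ : I → ℕ → Bool}
    (h1 : ∀ i n, τ (scratch k) (w * n + e i) = σ i n)
    (h2 : ∀ i j, i ≠ scratch k → τ i j = blockTape e x σ i j) : τ = blockTape e x σ := by
  funext i j
  by_cases hi : i = scratch k
  · subst hi
    obtain ⟨n, s, rfl⟩ := block_cases (w := w) j
    rw [blockTape_scratch, ← h1, e.apply_symm_apply]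
  · exact h2 i j hi

open Classical in
theorem blockTape_update (x : Fin k → Cantor) (σ : I → ℕ → Bool) (n : ℕ) (s : Fin w) (b : Bool) :
    (fun i => Function.update (blockTape e x σ i) (w * n + s)
      (Function.update (fun i => blockTape e x σ i (w * n + s)) (scratch k) b i)) =
    blockTape e x (fun i => if i = e.symm s then Function.update (σ i) n b else σ i) := by
  refine blockTape_eq_of e (fun i m => ?_) fun i j hi => ?_
  · rw [Function.update_self]
    by_cases h : i = e.symm s ∧ m = n
    · obtain ⟨rfl, rfl⟩ := h
      simp
    · rw [Function.update_of_ne, blockTape_scratch, e.symm_apply_apply]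
      · split_ifs with h'
        · rw [Function.update_of_ne fun h'' => h ⟨h', h''⟩]
        · rfl
      · intro h'
        apply h
        have h1 : e i = s := by
          have := congrArg (· % w) h'
          ext
          simpa [Nat.mod_eq_of_lt (e i).2, Nat.mod_eq_of_lt s.2] using this
        refine ⟨by rw [← h1, e.symm_apply_apply], ?_⟩
        rw [h1, Nat.add_right_cancel_iff] at h'
        exact Nat.eq_of_mul_eq_mul_left (NeZero.pos w) h'
  · rw [Function.update_of_ne hi, Function.update_eq_self]
    simp [blockTape, hi]

theorem update_self_col {I : Type} (τ : I → ℕ → Bool) (n : ℕ) :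
    (fun i => Function.update (τ i) n (τ i n)) = τ := by
  funext i; rw [Function.update_eq_self]

open MH

/-- The relation between the two machines in the second phase. -/
def BlockRel (x : Fin k → Cantor)
    (a : (BlockState I Q k w × (Unit → ℕ)) × (Fin (k + 2) → ℕ → Bool))
    (b : (Q × (Unit → ℕ)) × (I → ℕ → Bool)) : Prop :=
  a = conf (moveFrom W 0 b.1.1) (w * b.1.2 ()) (blockTape e x b.2) ∨
  a = conf .lim 0 (blockTape e x b.2) ∧ b.1 = (W.lim, fun _ => 0)

theorem path_moveFrom {P} (τ : Fin (k + 2) → ℕ → Bool) (q : Q) (p m : ℕ) (hm : m ≤ 2 * w)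
    (hP : ∀ m p, m < 2 * w → P (conf (moveFrom W (m + 1) q) p τ)) :
    (blockMachine W e ini).sys.Path P (conf (moveFrom W m q) p τ)
      (conf (moveFrom W 0 q) (p - m) τ) := by
  induction m generalizing p with
  | zero => exact Sys.Path.refl ..
  | succ m ih =>
    refine Sys.Path.head (hP m p (by omega)) ?_ (by simpa [Nat.sub_sub, add_comm] using ih (p - 1) (by omega))
    rw [step_conf, moveFrom, dif_pos (by omega)]
    simp only [blockMachine, Dir.move, update_self_col]

theorem path_rewindFrom {P} (τ : Fin (k + 2) → ℕ → Bool) (a : (I → Bool) × Dir × Q) (p m : ℕ)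
    (hm : m ≤ w) (hP : ∀ m p, m < w → P (conf (rewindFrom W (m + 1) a) p τ)) :
    (blockMachine W e ini).sys.Path P (conf (rewindFrom W m a) (p + m) τ)
      (conf (writeFrom W 0 a) p τ) := by
  induction m with
  | zero => exact Sys.Path.refl ..
  | succ m ih =>
    refine Sys.Path.head (hP m _ (by omega)) ?_ (ih (by omega))
    rw [step_conf, rewindFrom, dif_pos (by omega)]
    simp only [blockMachine, Dir.move, update_self_col]
    rfl

theorem path_readFrom {P} (x : Fin k → Cantor) (σ : I → ℕ → Bool) (q : Q) (n : ℕ)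
    (hP : ∀ s p acc, s < w → P (conf (readFrom W e q s acc) p (blockTape e x σ))) :
    (blockMachine W e ini).sys.Path P
      (conf (readFrom W e q 0 fun _ => false) (w * n) (blockTape e x σ))
      (conf (rewindFrom W w (W.act q fun i => σ i n)) (w * n + w) (blockTape e x σ)) := by
  have := Sys.Path.iter (s := (blockMachine W e ini).sys) (P := P) (fun s =>
    conf (readFrom W e q s fun t => decide (t.1 < s) && σ (e.symm t) n) (w * n + s)
      (blockTape e x σ)) w (by
    intro s hs
    refine Sys.Path.single (hP s _ _ hs) ?_
    rw [step_conf, readFrom, dif_pos hs]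
    simp only [blockMachine, Dir.move, update_self_col]
    rw [blockTape_scratch e x σ n ⟨s, hs⟩]
    refine congrArg (fun acc => conf (readFrom W e q (s + 1) acc) _ _) (funext fun t => ?_)
    by_cases h : t = ⟨s, hs⟩
    · subst h; simp
    · have : t.1 ≠ s := fun h' => h (Fin.ext h')
      rw [Function.update_of_ne h]
      congr 1
      exact decide_eq_decide.2 (by omega))
  have h0 : (readFrom W e q w fun t => decide (t.1 < w) && σ (e.symm t) n : BlockState I Q k w) =
      rewindFrom W w (W.act q fun i => σ i n) := by
    simp [readFrom]
  rw [h0] at this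
  simpa using this

theorem path_writeFrom {P} (x : Fin k → Cantor) (σ : I → ℕ → Bool) (a : (I → Bool) × Dir × Q)
    (n : ℕ) (hP : ∀ s p (σ' : I → ℕ → Bool), s < w →
      (∀ i j, σ' i j = σ i j ∨ σ' i j = Function.update (σ i) n (a.1 i) j) →
      P (conf (writeFrom W s a) p (blockTape e x σ'))) :
    (blockMachine W e ini).sys.Path P (conf (writeFrom W 0 a) (w * n) (blockTape e x σ))
      (conf (writeFrom W w a) (w * n + w)
        (blockTape e x fun i => Function.update (σ i) n (a.1 i))) := by
  have := Sys.Path.iter (s := (blockMachine W e ini).sys) (P := P) (fun s =>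
    conf (writeFrom W s a) (w * n + s)
      (blockTape e x fun i => if (e i).1 < s then Function.update (σ i) n (a.1 i) else σ i)) w (by
    intro s hs
    refine Sys.Path.single (hP s _ _ hs ?_) ?_
    · intro i j
      split_ifs <;> simp
    rw [step_conf, writeFrom, dif_pos hs]
    simp only [blockMachine, Dir.move]
    rw [blockTape_update e x _ n ⟨s, hs⟩]
    congr 1
    congr 1
    funext i
    by_cases h : i = e.symm ⟨s, hs⟩
    · subst h; simp
    · have : (e i).1 ≠ s := fun h' => h (by rw [← e.symm_apply_apply i]; congr 1; exact Fin.ext h')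
      rw [if_neg h]
      congr 1
      exact propext (by omega))
  simpa using this

/-- One simulated step is a sweep over a block: read its `w` cells into the state, rewind, write
them, then go to the next block to be visited. A partially written block holds only old and new
digits, as `Between` demands. -/
theorem blockMachine_sim (x : Fin k → Cantor) :
    Sys.Sim (blockMachine W e ini).sys W.sys (fun i n => (scratch k, w * n + e i))
      (fun i _ => i ≠ scratch k) (blockTape e x fun _ _ => false) (BlockRel W e x) := by
  have hwpos : 0 < w := NeZero.pos w
  refine ⟨?_, ?_, ?_⟩
  · rintro a b (rfl | ⟨rfl, -⟩) i n <;>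
    · simp only [conf]
      rw [blockTape_scratch, e.symm_apply_apply]
  · rintro a ⟨⟨q, pos⟩, σ⟩ hR hq'
    obtain ⟨n, rfl⟩ : ∃ n, pos = fun _ => n := ⟨pos (), rfl⟩
    have hq : q ≠ W.halt := hq'
    let c := W.act q fun i => σ i n
    let σn : I → ℕ → Bool := fun i => Function.update (σ i) n (c.1 i)
    have hstep : W.sys.step ((q, fun _ => n), σ) = conf c.2.2 (c.2.1.move n) σn := step_conf W q n σ
    let P := (blockMachine W e ini).sys.Between W.sys (fun i n => (scratch k, w * n + e i))
      (fun i _ => i ≠ scratch k) (blockTape e x fun _ _ => false) ((q, fun _ => n), σ)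
    have hP : ∀ s p (σ' : I → ℕ → Bool), s ≠ .halt → (∀ i j, σ' i j = σ i j ∨ σ' i j = σn i j) →
        P (conf s p (blockTape e x σ')) := by
      intro s p σ' hs h
      refine ⟨hs, fun i j => ?_, fun i j hi => ?_⟩
      · rw [hstep]
        simp only [conf]
        rw [blockTape_scratch, e.symm_apply_apply]
        exact h i j
      · simp [conf, blockTape, hi]
    have hmove0 : ∀ p, P (conf (moveFrom W 0 q) p (blockTape e x σ)) := fun p =>
      hP _ _ _ (by simp [moveFrom, hq]) fun i j => Or.inl rfl
    have hread0 : (moveFrom W 0 q : BlockState I Q k w) = readFrom W e q 0 fun _ => false := by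
      simp only [moveFrom, if_neg hq, readFrom, dif_pos hwpos]
      rfl
    have hpath : P (conf (moveFrom W 0 q) (w * n) (blockTape e x σ)) ∧
        (blockMachine W e ini).sys.Path P
        ((blockMachine W e ini).sys.step (conf (moveFrom W 0 q) (w * n) (blockTape e x σ)))
        (conf (moveFrom W 0 c.2.2) (w * c.2.1.move n) (blockTape e x σn)) := by
      rw [hread0]
      obtain ⟨h1, h2⟩ := (path_readFrom W e ini (P := P) x σ q n fun s p acc hs =>
        hP _ _ _ (by simp [readFrom, hs]) fun i j => Or.inl rfl).of_ne fun h => by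
          have := congrArg (·.1.1) h
          obtain ⟨w', rfl⟩ := Nat.exists_eq_succ_of_ne_zero hwpos.ne'
          simp [conf, readFrom, rewindFrom] at this
      refine ⟨h1, h2.trans
        ((path_rewindFrom W e ini _ c (w * n) w le_rfl fun m p hm => hP _ _ _ ?_ fun i j =>
          Or.inl rfl).trans
        ((path_writeFrom W e ini x σ c n fun s p σ' hs h => hP _ _ _ ?_ h).trans ?_))⟩
      · simp [rewindFrom, hm]
      · simp [writeFrom, hs]
      · have hmP : ∀ m p, m < 2 * w → P (conf (moveFrom W (m + 1) c.2.2) p (blockTape e x σn)) :=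
          fun m p hm => hP _ _ _ (by simp [moveFrom, hm]) fun i j => Or.inr rfl
        rw [writeFrom, dif_neg (lt_irrefl w)]
        generalize c.2.1 = d
        cases d
        · have := path_moveFrom W e ini (blockTape e x σn) c.2.2 (w * n + w) (2 * w) le_rfl hmP
          -- For `n = 0` truncated subtraction gives 0 on both sides: the left end of the scratch
          -- tape acts as the left end of the simulated tapes.
          rwa [show w * n + w - 2 * w = w * Dir.left.move n by
            rw [Dir.move, Nat.mul_sub]; omega] at this
        · have := path_moveFrom W e ini (blockTape e x σn) c.2.2 (w * n + w) w (by omega) hmP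
          rwa [show w * n + w - w = w * Dir.stay.move n by rw [Dir.move]; omega] at this
        · exact Sys.Path.refl ..
    obtain ⟨hP0, hpath⟩ := hpath
    refine ⟨_, Or.inl (by rw [hstep]), ?_⟩
    rcases hR with rfl | ⟨rfl, h⟩
    · exact ⟨hP0, hpath⟩
    · obtain ⟨rfl, h⟩ := Prod.ext_iff.1 h
      obtain rfl : n = 0 := congrFun h ()
      refine ⟨hP _ _ _ (by simp) fun i j => Or.inl rfl, ?_⟩
      have h1 : (blockMachine W e ini).sys.step (conf .lim 0 (blockTape e x σ)) =
          conf (moveFrom W 0 W.lim) (w * 0) (blockTape e x σ) := by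
        rw [step_conf]
        have h : blockTape e x σ (output k) 0 = true := by rw [blockTape_output]; rfl
        simp only [blockMachine, h, if_true, Dir.move, update_self_col]
        rfl
      rw [h1]
      exact Sys.Path.head hP0 rfl hpath
  · intro τ σ h1 h2
    refine Or.inr ⟨?_, rfl⟩
    have : τ = blockTape e x σ := by
      refine blockTape_eq_of e h1 fun i j hi => ?_
      rw [h2 i j hi]
      simp [blockTape, hi]
    rw [this]; rfl

end Block

end ITTM

/-! ### Copying the input into blocks -/

namespace ITTM

open Order BlockState MH

section Copy

variable {I Q : Type} {k w : ℕ} [NeZero w] [DecidableEq Q]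
variable (W : MH I Unit Q) (e : I ≃ Fin w) (ini : (Fin k → Bool) → Bool → I → Bool)

/-- The tapes on which the simulated machine starts. -/
def iniTape (ini : (Fin k → Bool) → Bool → I → Bool) (x : Fin k → Cantor) : I → ℕ → Bool :=
  fun i n => ini (fun l => x l n) (decide (n = 0)) i

/-- The tapes during the first phase: marks `A`, and `c` cells copied. -/
def copyTape (x : Fin k → Cantor) (A : ℕ → Bool) (c : ℕ) : Fin (k + 2) → ℕ → Bool := fun i j =>
  if i = scratch k then decide (j < c) && iniTape ini x (e.symm (Fin.ofNat w j)) (j / w)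
  else if i = output k then A j else initTape x i j

variable {ini} in
theorem copyTape_output (x : Fin k → Cantor) (A : ℕ → Bool) (c n : ℕ) :
    copyTape e ini x A c (output k) n = A n := by
  rw [copyTape, if_neg (scratch_ne_output k).symm, if_pos rfl]

theorem inputs_copyTape (x : Fin k → Cantor) (A : ℕ → Bool) (c n : ℕ) :
    inputs (fun i => copyTape e ini x A c i n) = fun l => x l n := by
  funext l
  have h1 : (⟨l, by omega⟩ : Fin (k + 2)) ≠ scratch k := by simp [scratch, l.2.ne]
  have h2 : (⟨l, by omega⟩ : Fin (k + 2)) ≠ output k := by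
    simp only [output, ne_eq, Fin.ext_iff, Fin.val_last]; omega
  simp [inputs, copyTape, h1, h2, initTape, Config.init]

theorem copyTape_mark (x : Fin k → Cantor) (A : ℕ → Bool) (c n : ℕ) (b : Bool) :
    (fun i => Function.update (copyTape e ini x A c i) n
      (Function.update (fun i => copyTape e ini x A c i n) (output k) b i)) =
    copyTape e ini x (Function.update A n b) c := by
  funext i j
  by_cases hi : i = output k
  · subst hi
    rw [Function.update_self, copyTape_output]
    by_cases hj : j = n
    · subst hj; simp
    · rw [Function.update_of_ne hj, Function.update_of_ne hj, copyTape_output]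
  · rw [Function.update_of_ne hi, Function.update_eq_self]
    simp [copyTape, hi]

theorem copyTape_write (x : Fin k → Cantor) (A : ℕ → Bool) (n : ℕ) (s : Fin w) (b v : Bool)
    (hv : iniTape ini x (e.symm s) n = v) :
    (fun i => Function.update (copyTape e ini x A (w * n + s) i) (w * n + s)
      (Function.update (Function.update (fun i => copyTape e ini x A (w * n + s) i (w * n + s))
        (scratch k) v) (output k) b i)) =
    copyTape e ini x (Function.update A (w * n + s) b) (w * n + s + 1) := by
  subst hv
  have h1 : Fin.ofNat w (w * n + s) = s := by
    ext; simp [Fin.ofNat, Nat.mod_eq_of_lt s.2]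
  have h2 : (w * n + s) / w = n := by
    rw [Nat.mul_add_div (NeZero.pos w), Nat.div_eq_of_lt s.2, add_zero]
  funext i j
  by_cases hi : i = output k
  · subst hi
    rw [Function.update_self, copyTape_output]
    by_cases hj : j = w * n + s
    · subst hj; simp
    · rw [Function.update_of_ne hj, Function.update_of_ne hj, copyTape_output]
  rw [Function.update_of_ne hi]
  by_cases hi' : i = scratch k
  · subst hi'
    rw [Function.update_self]
    by_cases hj : j = w * n + s
    · subst hj
      rw [Function.update_self, copyTape, if_pos rfl, h1, h2]
      simp
    · rw [Function.update_of_ne hj]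
      simp only [copyTape, if_true]
      congr 1
      exact decide_eq_decide.2 (by omega)
  · rw [Function.update_of_ne hi', Function.update_eq_self]
    simp [copyTape, hi, hi']

/-- The marks when `n` cells have been copied. -/
def marks (w n : ℕ) : ℕ → Bool := fun j => decide (j = 0 ∨ j = n ∨ j = w * n)

theorem path_copyFrom {P} (x : Fin k → Cantor) (A : ℕ → Bool) (n s : ℕ) (z : Bool)
    (hz : z = decide (n = 0)) (hs : z = true → 2 ≤ s) (hsw : s ≤ w)
    (hP : ∀ s' q, s ≤ s' → s' ≤ w → q ≠ .halt →
      P (conf q (w * n + s') (copyTape e ini x A (w * n + s')))) :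
    (blockMachine W e ini).sys.Path P
      (conf (copyFrom (fun l => x l n) z s) (w * n + s) (copyTape e ini x A (w * n + s)))
      (conf .mark (w * n + w) (copyTape e ini x A (w * n + w))) := by
  have := Sys.Path.iter (s := (blockMachine W e ini).sys) (P := P) (fun i =>
    conf (copyFrom (fun l => x l n) z (s + i)) (w * n + (s + i))
      (copyTape e ini x A (w * n + (s + i)))) (w - s) (by
    intro i hi
    have hsi : s + i < w := by omega
    refine Sys.Path.single (hP _ _ (by omega) (by omega) (by simp [copyFrom, hsi])) ?_
    rw [step_conf, copyFrom, dif_pos hsi]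
    -- The mark on cell 1 is set by the second digit of block 0, which comes before this path.
    have hz1 : (z && decide (s + i = 1)) = false := by
      cases z
      · rfl
      · have := hs rfl
        simp only [Bool.true_and, decide_eq_false_iff_not]; omega
    simp only [blockMachine, Dir.move, hz1, Bool.or_false]
    rw [copyTape_write e ini x A n ⟨s + i, hsi⟩ _ _ (by rw [iniTape, hz]), copyTape_output,
      Function.update_eq_self]
    rfl)
  have h0 : s + (w - s) = w := by omega
  rw [h0] at this
  have h1 : (copyFrom (fun l => x l n) z w : BlockState I Q k w) = .mark := by simp [copyFrom]
  rw [h1] at this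
  exact this

theorem path_mark {P} (x : Fin k → Cantor) (A : ℕ → Bool) (c n : ℕ)
    (hP : P (conf .mark n (copyTape e ini x A c))) :
    (blockMachine W e ini).sys.Path P (conf .mark n (copyTape e ini x A c))
      (conf .back (n - 1) (copyTape e ini x (Function.update A n true) c)) := by
  refine Sys.Path.single hP ?_
  rw [step_conf]
  simp only [blockMachine, Dir.move]
  rw [copyTape_mark]

theorem path_back {P} (x : Fin k → Cantor) (A : ℕ → Bool) (c n m : ℕ)
    (hA : ∀ j, n < j → j ≤ n + m → A j = false)
    (hP : ∀ j, P (conf .back j (copyTape e ini x A c))) :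
    (blockMachine W e ini).sys.Path P (conf .back (n + m) (copyTape e ini x A c))
      (conf .back n (copyTape e ini x A c)) := by
  induction m with
  | zero => exact Sys.Path.refl ..
  | succ m ih =>
    refine Sys.Path.head (hP _) ?_ (ih fun j h h' => hA j h (by omega))
    rw [step_conf]
    simp only [blockMachine, copyTape_output, hA (n + (m + 1)) (by omega) le_rfl,
      Bool.false_eq_true, if_false, Dir.move, update_self_col]
    rfl

theorem path_fwd {P} (x : Fin k → Cantor) (v : Fin k → Bool) (A : ℕ → Bool) (c n m : ℕ)
    (hA : ∀ j, n ≤ j → j < n + m → A j = false)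
    (hP : ∀ j, P (conf (.fwd v) j (copyTape e ini x A c))) :
    (blockMachine W e ini).sys.Path P (conf (.fwd v) n (copyTape e ini x A c))
      (conf (.fwd v) (n + m) (copyTape e ini x A c)) := by
  induction m with
  | zero => exact Sys.Path.refl ..
  | succ m ih =>
    refine Sys.Path.tail (ih fun j h h' => hA j h (by omega)) (hP _) ?_
    rw [step_conf]
    simp only [blockMachine, copyTape_output, hA (n + m) (by omega) (by omega),
      Bool.false_eq_true, if_false, Dir.move, update_self_col]
    rfl

/-- One round moves the marks from `n` and `w * n` to `n + 1` and `w * (n + 1)`. The marks change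
one at a time, so on each cell every intermediate pattern agrees with the old or the new one; this
is what lets rounds count as single steps of `copySys`. -/
theorem copy_round (hw : 3 ≤ w) (x : Fin k → Cantor) (n : ℕ) (hn : 1 ≤ n) {P}
    (hP : ∀ q m A c, q ≠ .halt → w * n ≤ c → c ≤ w * (n + 1) →
      (∀ j, A j = marks w n j ∨ A j = marks w (n + 1) j) →
      P (conf q m (copyTape e ini x A c))) :
    (blockMachine W e ini).sys.Path P
      (conf .back (w * n - 1) (copyTape e ini x (marks w n) (w * n)))
      (conf .back (w * (n + 1) - 1) (copyTape e ini x (marks w (n + 1)) (w * (n + 1)))) := by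
  -- This needs `3 ≤ w`: when the head starts forward from cell `n + 2`, it must not already have
  -- passed the mark at `w * n`.
  have hwn : n + 2 ≤ w * n := by nlinarith
  have hwn1 : w * (n + 1) = w * n + w := by ring
  obtain ⟨m, hm⟩ : ∃ m, w * n = n + 2 + m := Nat.exists_eq_add_of_le hwn
  let A1 := Function.update (marks w n) n false
  let A2 := Function.update A1 (n + 1) true
  let A3 := Function.update A2 (w * n) false
  have hA1 : ∀ j, A1 j = marks w n j ∨ A1 j = marks w (n + 1) j := by
    intro j
    by_cases hj : j = n
    · subst hj
      right
      simp only [A1, Function.update_self, marks]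
      symm; simp only [decide_eq_false_iff_not]; omega
    · left; simp only [A1, Function.update_of_ne hj]
  have hA2 : ∀ j, A2 j = marks w n j ∨ A2 j = marks w (n + 1) j := by
    intro j
    by_cases hj : j = n + 1
    · subst hj
      right
      simp [A2, Function.update_self, marks]
    · simp only [A2, Function.update_of_ne hj]; exact hA1 j
  have hA3 : ∀ j, A3 j = marks w n j ∨ A3 j = marks w (n + 1) j := by
    intro j
    by_cases hj : j = w * n
    · subst hj
      right
      simp only [A3, Function.update_self, marks]
      symm; simp only [decide_eq_false_iff_not]; omega
    · simp only [A3, Function.update_of_ne hj]; exact hA2 j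
  have hA4 : Function.update A3 (w * n + w) true = marks w (n + 1) := by
    funext j
    simp only [A3, A2, A1, Function.update_apply, marks, hwn1]
    split_ifs <;> symm <;>
      simp only [decide_eq_true_eq, decide_eq_false_iff_not, decide_eq_decide] <;> omega
  refine Sys.Path.trans (c' := conf .back n (copyTape e ini x (marks w n) (w * n))) ?_ ?_
  · have := path_back W e ini (P := P) x (marks w n) (w * n) n (m + 1) (fun j h h' => by
      simp only [marks, decide_eq_false_iff_not]; omega) fun j =>
      hP _ _ _ _ (by simp) le_rfl (by omega) fun j => Or.inl rfl
    rwa [show n + (m + 1) = w * n - 1 by omega] at this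
  refine Sys.Path.head (c' := conf (.got fun l => x l n) (n + 1) (copyTape e ini x A1 (w * n)))
    (hP _ _ _ _ (by simp) le_rfl (by omega) fun j => Or.inl rfl) ?_ ?_
  · rw [step_conf]
    have : marks w n n = true := by simp [marks]
    simp only [blockMachine, copyTape_output, this, if_true, Dir.move, inputs_copyTape]
    rw [copyTape_mark]
  refine Sys.Path.head (c' := conf (.fwd fun l => x l n) (n + 2) (copyTape e ini x A2 (w * n)))
    (hP _ _ _ _ (by simp) le_rfl (by omega) hA1) ?_ ?_
  · rw [step_conf]
    simp only [blockMachine, Dir.move]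
    rw [copyTape_mark]
  refine Sys.Path.trans (c' := conf (.fwd fun l => x l n) (w * n) (copyTape e ini x A2 (w * n)))
    ?_ ?_
  · rw [hm]
    refine path_fwd W e ini (P := P) x _ _ _ (n + 2) m (fun j h h' => ?_) fun j =>
      hP _ _ _ _ (by simp) (by omega) (by omega) hA2
    simp only [A2, A1, Function.update_apply, marks]
    rw [if_neg (by omega), if_neg (by omega)]
    simp only [decide_eq_false_iff_not]; omega
  refine Sys.Path.head (c' := conf (copyFrom (fun l => x l n) false 1) (w * n + 1)
    (copyTape e ini x A3 (w * n + 1))) (hP _ _ _ _ (by simp) le_rfl (by omega) hA2) ?_ ?_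
  · rw [step_conf]
    have : A2 (w * n) = true := by
      simp only [A2, A1, Function.update_apply, marks]
      rw [if_neg (by omega), if_neg (by omega)]
      simp
    simp only [blockMachine, copyTape_output, this, if_true, Dir.move]
    have h := copyTape_write e ini x A2 n 0 false _ rfl
    rw [Fin.val_zero, add_zero] at h
    rw [Function.update_comm (scratch_ne_output k).symm]
    have hn0 : decide (n = 0) = false := by simp; omega
    rw [iniTape, hn0] at h
    rw [h]
  have hn0 : false = decide (n = 0) := by symm; simp; omega
  refine (path_copyFrom W e ini (P := P) x A3 n 1 false hn0 (by simp) (by omega)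
    fun s' q h h' hq => hP _ _ _ _ hq (by omega) (by omega) hA3).trans ?_
  have := path_mark W e ini (P := P) x A3 (w * n + w) (w * n + w)
    (hP _ _ _ _ (by simp) (by omega) (by omega) hA3)
  rw [hA4] at this
  rwa [hwn1]

theorem copyTape_zero (x : Fin k → Cantor) :
    copyTape e ini x (fun _ => false) 0 = initTape x := by
  funext i j
  simp only [copyTape, initTape, Config.init]
  split_ifs with h1 h2 h3 h4 <;> first | rfl | (simp [scratch, output, Fin.ext_iff] at *; try omega)

theorem reach_back (hw : 3 ≤ w) (x : Fin k → Cantor) :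
    (blockMachine W e ini).sys.Reach (conf .lim 0 (initTape x))
      (conf .back (w * 1 - 1) (copyTape e ini x (marks w 1) (w * 1))) := by
  let A0 : ℕ → Bool := Function.update (fun _ => false) 0 true
  let A1 : ℕ → Bool := Function.update A0 1 true
  have hA : Function.update A1 w true = marks w 1 := by
    funext j
    simp only [A1, A0, Function.update_apply, marks, mul_one]
    split_ifs <;> symm <;> simp only [decide_eq_true_eq, decide_eq_false_iff_not] <;> omega
  have hx : (fun l => x l 0) = inputs fun i => initTape x i 0 := by
    rw [← copyTape_zero e ini, inputs_copyTape]
  refine Sys.Path.reach (s := (blockMachine W e ini).sys)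
    (P := fun c => c.1.1 ≠ (blockMachine W e ini).halt) ?_ fun c hc => hc
  rw [← copyTape_zero e ini]
  refine Sys.Path.head (c' := conf (copyFrom (fun l => x l 0) true 1) 1 (copyTape e ini x A0 1))
    (by simp [conf, blockMachine]) ?_ ?_
  · rw [step_conf]
    simp only [blockMachine, copyTape_output, Bool.false_eq_true, if_false, Dir.move,
      inputs_copyTape]
    have h := copyTape_write e ini x (fun _ => false) 0 0 true _ rfl
    simp only [Fin.val_zero, add_zero, mul_zero, zero_add] at h
    rw [Function.update_comm (scratch_ne_output k).symm, ← h]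
    rfl
  refine Sys.Path.head (c' := conf (copyFrom (fun l => x l 0) true 2) 2 (copyTape e ini x A1 2))
    (by simp [conf, copyFrom, show 1 < w by omega, blockMachine]) ?_ ?_
  · rw [step_conf, copyFrom, dif_pos (by omega)]
    simp only [blockMachine, Dir.move]
    have h := copyTape_write e ini x A0 0 ⟨1, by omega⟩ true _ rfl
    simp only [mul_zero, zero_add] at h
    simp only [decide_true, Bool.and_true, Bool.or_true]
    rw [← h]
    rfl
  have h1 := path_copyFrom W e ini (P := fun c => c.1.1 ≠ (blockMachine W e ini).halt) x A1 0 2 true rfl (fun _ => le_rfl)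
    (by omega) fun s' q h h' hq => hq
  simp only [mul_zero, zero_add] at h1
  refine h1.trans ?_
  have := path_mark W e ini (P := fun c => c.1.1 ≠ (blockMachine W e ini).halt) x A1 w w
    (by simp [conf, blockMachine])
  rw [hA] at this
  rwa [mul_one]

/-- The first phase, in rounds. -/
def copySys (x : Fin k → Cantor) : Sys (Option ℕ) (Fin (k + 2)) where
  lim := none
  step c := match c.1 with
    | some n => (some (n + 1), copyTape e ini x (marks w (n + 2)) (w * (n + 2)))
    | none => c
  halt c := c = none

/-- Every cell is eventually constant: its digit is copied once, and the two moving marks pass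
beyond it. Only the mark on cell 0 survives at stage ω. -/
theorem copySys_reach (x : Fin k → Cantor) :
    (copySys e ini x).Reach (some 0, copyTape e ini x (marks w 1) (w * 1))
      (none, blockTape e x (iniTape ini x)) := by
  have key : ∀ n : ℕ, (copySys e ini x).run (some 0, copyTape e ini x (marks w 1) (w * 1)) n =
      (some n, copyTape e ini x (marks w (n + 1)) (w * (n + 1))) := by
    intro n
    induction n with
    | zero => simp
    | succ n ih => rw [Nat.cast_succ, Sys.run_add_one, ih]; rfl
  refine ⟨Ordinal.omega0, Sys.run_omega_of_eventually _ _ _ fun i j => ⟨j + 1, fun n hn => ?_⟩, ?_⟩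
  · have hw : 1 ≤ w := NeZero.pos w
    have h1 : j + 2 ≤ n + 1 := by omega
    have h2 : n + 1 ≤ w * (n + 1) := by nlinarith
    rw [key]
    simp only [copyTape, blockTape]
    split_ifs
    · rw [decide_eq_true (by omega), Bool.true_and]
    · simp only [marks, decide_eq_decide]; omega
    · rfl
  · intro u hu
    obtain ⟨n, rfl⟩ := Ordinal.lt_omega0.1 hu
    rw [key]
    simp [copySys]

/-- The rounds take growing finite times, so the limit at stage ω of the actual machine is obtained
from that of the rounds by the general simulation argument. -/
theorem copySys_sim (hw : 3 ≤ w) (x : Fin k → Cantor) :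
    Sys.Sim (blockMachine W e ini).sys (copySys e ini x) (fun i n => (i, n)) (fun _ _ => False)
      (fun _ _ => false) (fun a b => match b.1 with
        | some n => b.2 = copyTape e ini x (marks w (n + 1)) (w * (n + 1)) ∧
            a = conf .back (w * (n + 1) - 1) b.2
        | none => a = conf .lim 0 b.2) := by
  refine ⟨?_, ?_, ?_⟩
  · rintro a ⟨_ | n, σ⟩ h i j
    · rw [show a = _ from h]; rfl
    · rw [h.2]; rfl
  · rintro a ⟨_ | n, σ⟩ h hb
    · exact absurd rfl hb
    · obtain ⟨h1, rfl⟩ := h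
      have h1 : σ = _ := h1
      subst h1
      refine ⟨_, ⟨rfl, rfl⟩, (copy_round W e ini hw x (n + 1) (by omega) ?_).of_ne ?_⟩
      · intro q m A c hq hc hc' hA
        refine ⟨hq, fun i j => ?_, fun _ _ h => h.elim⟩
        simp only [copySys, conf, copyTape]
        split_ifs
        · by_cases hj : j < c
          · right
            rw [decide_eq_true hj, decide_eq_true (hj.trans_le hc')]
          · left
            rw [decide_eq_false hj, decide_eq_false fun h => hj (h.trans_le hc)]
        · exact hA j
        · left; rfl
      · intro h
        have := congrArg (·.1.2 ()) h
        simp only [conf] at this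
        rw [mul_add w (n + 1) 1] at this
        have : w ≤ w * (n + 1) := Nat.le_mul_of_pos_right _ (by omega)
        omega
  · intro τ σ h _
    rw [show τ = σ from funext fun i => funext fun n => h i n]
    rfl

/-- The machine with blocks halts if and only if the simulated one does, and then `1` is on the
output tape. -/
theorem blockMachine_correct (hw : 3 ≤ w) (hW : W.lim ≠ W.halt) (x : Fin k → Cantor) :
    (W.sys.HaltsFrom (W.start (iniTape ini x)) →
      ∃ c, (blockMachine W e ini).sys.Reach (conf .lim 0 (initTape x)) c ∧ c.1.1 = .halt ∧
        c.2 (output k) = ofNat 1) ∧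
    (¬ W.sys.HaltsFrom (W.start (iniTape ini x)) →
      ¬ (blockMachine W e ini).sys.HaltsFrom (conf .lim 0 (initTape x))) := by
  obtain ⟨a, h1, h2⟩ := (copySys_sim W e ini hw x).reach
    (a0 := conf .back (w * 1 - 1) (copyTape e ini x (marks w 1) (w * 1))) (And.intro rfl rfl)
    (copySys_reach e ini x)
  have h2 : a = conf .lim 0 (blockTape e x (iniTape ini x)) := h2
  subst h2
  have hreach := (reach_back W e ini hw x).trans h1
  have hR : BlockRel W e x (conf .lim 0 (blockTape e x (iniTape ini x)))
    (W.start (iniTape ini x)) := Or.inr ⟨rfl, rfl⟩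
  have hsim := blockMachine_sim W e ini x
  constructor
  · intro h
    obtain ⟨b, hb, hh⟩ := h.exists_reach
    obtain ⟨a, ha, hab⟩ := hsim.reach hR hb
    have hh : b.1.1 = W.halt := hh
    refine ⟨a, hreach.trans ha, ?_⟩
    rcases hab with rfl | ⟨-, h⟩
    · exact ⟨by simp [conf, moveFrom, hh], blockTape_output ..⟩
    · rw [h] at hh; exact absurd hh hW
  · intro h
    rw [hreach.haltsFrom_iff]
    exact hsim.not_haltsFrom hR h

end Copy

/-! ### From machines to programs -/

/-- Tables for single-head machines with many tapes. The table is correct no matter what is in its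
first row and how it continues. -/
theorem exists_table_of_mh {I Q : Type} [Finite I] [Finite Q] [DecidableEq Q] {k : ℕ}
    (hI : 3 ≤ Nat.card I) (W : MH I Unit Q) (hW : W.lim ≠ W.halt)
    (ini : (Fin k → Bool) → Bool → I → Bool) :
    ∃ (N : ℕ) (l : List ℕ), 2 < N ∧ l.length = N * 2 ^ (k + 2) ∧
      (∀ i < 2 ^ (k + 2), l.getD i 0 = l.getD (2 ^ (k + 2) + i) 0) ∧
      ∀ p, (∀ i, 2 ^ (k + 2) ≤ i → i < l.length → (table p).getD i 0 = l.getD i 0) →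
      ∀ s, s ≠ haltState → (∀ r : Fin (k + 2) → Bool, action p s r = action p 1 r) →
      ∀ x : Fin k → Cantor,
        (W.sys.HaltsFrom (W.start (iniTape ini x)) →
          ∃ c, (ittm k p).Reach ((s, 0), initTape x) c ∧ c.1.1 = haltState ∧
            c.2 (Fin.last (k + 1)) = ofNat 1) ∧
        (¬ W.sys.HaltsFrom (W.start (iniTape ini x)) →
          ¬ (ittm k p).HaltsFrom ((s, 0), initTape x)) := by
  have : NeZero (Nat.card I) := ⟨by omega⟩
  have e := Finite.equivFin I
  have hG := blockMachine_simple W e ini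
  obtain ⟨ν, N, l, hlim, hhalt, hN, hl, himp, hrow⟩ := exists_table _ hG.lim_ne_halt
  refine ⟨N, l, hN, hl, hrow, fun p hp s hs hs' x => ?_⟩
  have hsim := (himp p hp).sim hG hlim hhalt hs hs'
  obtain ⟨h1, h2⟩ := blockMachine_correct W e ini hI hW x
  constructor
  · intro h
    obtain ⟨b, hb, hbh, hbo⟩ := h1 h
    obtain ⟨a, ha, hab⟩ := hsim.reach (a0 := ((s, 0), initTape x)) ⟨rfl, rfl, Or.inr ⟨rfl, rfl⟩⟩ hb
    refine ⟨a, ha, ?_, by rw [hab.2.1]; exact hbo⟩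
    rcases hab.2.2 with h | ⟨-, h⟩
    · rw [h, hhalt]; exact hbh
    · exact absurd (hbh.symm.trans h).symm hG.lim_ne_halt
  · intro h
    exact hsim.not_haltsFrom (a0 := ((s, 0), initTape x)) ⟨rfl, rfl, Or.inr ⟨rfl, rfl⟩⟩ (h2 h)

end ITTM

namespace ITTM

open Order

/-! ### From many heads to one -/

inductive OneHeadState (M Q : Type)
  | lim
  | halt
  | home (q : Q)
  | find (q : Q)
  | put (h : M) (q : Q)

instance {M Q : Type} [Finite M] [Finite Q] : Finite (OneHeadState M Q) :=
  Finite.of_equiv _ (proxy_equiv% (OneHeadState M Q))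

open OneHeadState MH

variable {I M Q : Type} [DecidableEq M] [DecidableEq Q]

def homeState (W : MH I M Q) (q : Q) : OneHeadState M Q := if q = W.halt then .halt else .home q

/-- The position of each head of `W` is the first `1` on a tape for it. One more tape marks the
first cell. -/
def oneHead [DecidableEq I] (W : MH I M Q) : MH (I ⊕ Option M) Unit (OneHeadState M Q) where
  lim := .lim
  halt := .halt
  hd _ := ()
  act
    | .lim, r => (Sum.elim (fun i => r (.inl i)) fun h => h.elim (r (.inr none)) fun _ => true,
        .stay, .home W.lim)
    | .halt, r => (r, .stay, .halt)
    | .home q, r => if r (.inr none) then (r, .stay, .find q) else (r, .left, .home q)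
    | .find q, r =>
      if r (.inr (some (W.hd q))) then
        let a := W.act q fun i => r (.inl i)
        (Sum.elim a.1 (Function.update (fun h => r (.inr h)) (some (W.hd q)) false), a.2.1,
          .put (W.hd q) a.2.2)
      else (r, .right, .find q)
    | .put h q, r => (Function.update r (.inr (some h)) true, .stay, homeState W q)

def oneHeadIni {k : ℕ} (M : Type) (ini : (Fin k → Bool) → Bool → I → Bool) :
    (Fin k → Bool) → Bool → I ⊕ Option M → Bool := fun v z =>
  Sum.elim (ini v z) fun h => h.elim z fun _ => false

structure OneHeadTape (T : I ⊕ Option M → ℕ → Bool) (pos : M → ℕ) (σ : I → ℕ → Bool) : Prop where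
  cells : ∀ i n, T (.inl i) n = σ i n
  zero : ∀ n, T (.inr none) n = decide (n = 0)
  head : ∀ h, T (.inr (some h)) (pos h) = true
  before : ∀ h, ∀ j < pos h, T (.inr (some h)) j = false

variable [DecidableEq I] (W : MH I M Q)

theorem path_home {P} (T : I ⊕ Option M → ℕ → Bool) (hT : ∀ n, T (.inr none) n = decide (n = 0))
    (q : Q) (n : ℕ) (hP : ∀ j, P (conf (.home q) j T)) :
    (oneHead W).sys.Path P (conf (.home q) n T) (conf (.find q) 0 T) := by
  induction n with
  | zero =>
    refine Sys.Path.single (hP 0) ?_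
    rw [step_conf]
    simp only [oneHead, hT, decide_true, if_true, update_self_col, Dir.move]
  | succ n ih =>
    refine Sys.Path.head (hP _) ?_ ih
    rw [step_conf]
    simp only [oneHead, hT, Nat.succ_ne_zero, decide_false, Bool.false_eq_true, if_false,
      update_self_col, Dir.move, Nat.add_sub_cancel]

theorem path_find {P} (T : I ⊕ Option M → ℕ → Bool) (q : Q) (n : ℕ)
    (hT : ∀ j < n, T (.inr (some (W.hd q))) j = false)
    (hP : ∀ j, P (conf (.find q) j T)) :
    (oneHead W).sys.Path P (conf (.find q) 0 T) (conf (.find q) n T) := by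
  induction n with
  | zero => exact Sys.Path.refl ..
  | succ n ih =>
    refine Sys.Path.tail (ih fun j hj => hT j (by omega)) (hP _) ?_
    rw [step_conf]
    simp only [oneHead, hT n (by omega), Bool.false_eq_true, if_false, update_self_col, Dir.move]

/-- At a limit the head tapes may hold arbitrary limsups. Because only the first 1 on a head tape
counts, writing 1 on cell 0 of each of them puts all heads on cell 0 whatever lies beyond. Hence
only the tape that marks cell 0 has to be preserved. -/
theorem oneHead_sim :
    Sys.Sim (oneHead W).sys W.sys (fun i n => (.inl i, n)) (fun i _ => i = .inr none)
      (fun _ n => decide (n = 0)) (fun a b =>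
        (∃ n T, a = conf (homeState W b.1.1) n T ∧ OneHeadTape T b.1.2 b.2) ∨
        ∃ T, a = conf .lim 0 T ∧ b.1 = (W.lim, fun _ => 0) ∧ (∀ i n, T (.inl i) n = b.2 i n) ∧
          ∀ n, T (.inr none) n = decide (n = 0)) := by
  refine ⟨?_, ?_, ?_⟩
  · rintro a b (⟨n, T, rfl, h⟩ | ⟨T, rfl, -, h, -⟩)
    · exact h.cells
    · exact h
  · rintro a ⟨⟨q, pos⟩, σ⟩ hR hq'
    have hq : q ≠ W.halt := hq'
    let c := W.act q fun i => σ i (pos (W.hd q))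
    let σn : I → ℕ → Bool := fun i => Function.update (σ i) (pos (W.hd q)) (c.1 i)
    let posn := Function.update pos (W.hd q) (c.2.1.move (pos (W.hd q)))
    have hstep : W.sys.step ((q, pos), σ) = ((c.2.2, posn), σn) := rfl
    let P := (oneHead W).sys.Between W.sys (fun i n => (.inl i, n)) (fun i _ => i = .inr none)
      (fun _ n => decide (n = 0)) ((q, pos), σ)
    have hP : ∀ s p T, s ≠ .halt → (∀ i j, T (.inl i) j = σ i j ∨ T (.inl i) j = σn i j) →
        (∀ n, T (.inr none) n = decide (n = 0)) → P (conf s p T) := by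
      intro s p T hs h hZ
      refine ⟨hs, h, ?_⟩
      rintro _ n rfl
      exact hZ n
    have main : ∀ n T, OneHeadTape T pos σ → ∃ n' T', OneHeadTape T' posn σn ∧
        P (conf (.home q) n T) ∧ (oneHead W).sys.Path P
          ((oneHead W).sys.step (conf (.home q) n T)) (conf (homeState W c.2.2) n' T') := by
      intro n T hT
      let T1 : I ⊕ Option M → ℕ → Bool := fun i => Function.update (T i) (pos (W.hd q))
        ((Sum.elim c.1 (Function.update (fun h => T (.inr h) (pos (W.hd q))) (some (W.hd q)) false) :
          I ⊕ Option M → Bool) i)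
      let T2 : I ⊕ Option M → ℕ → Bool := Function.update T1 (.inr (some (W.hd q)))
        (Function.update (T1 (.inr (some (W.hd q)))) (posn (W.hd q)) true)
      have h1cells : ∀ i n, T1 (.inl i) n = σn i n := by
        intro i n
        simp only [T1, σn, Sum.elim_inl, Function.update_apply, hT.cells]
      have h1none : ∀ n, T1 (.inr none) n = decide (n = 0) := by
        intro n
        simp only [T1, Sum.elim_inr, Function.update_of_ne (Option.some_ne_none (W.hd q)).symm,
          Function.update_apply, hT.zero]
        split_ifs with h
        · rw [h]
        · rfl
      have h1other : ∀ h, h ≠ W.hd q → T1 (.inr (some h)) = T (.inr (some h)) := by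
        intro h hh
        have : some h ≠ some (W.hd q) := by simpa using hh
        simp only [T1, Sum.elim_inr, Function.update_of_ne this, Function.update_eq_self]
      have h1self : ∀ j ≤ pos (W.hd q), T1 (.inr (some (W.hd q))) j = false := by
        intro j hj
        simp only [T1, Sum.elim_inr, Function.update_self, Function.update_apply]
        split_ifs with h
        · rfl
        · exact hT.before _ _ (by omega)
      have h2 : ∀ i, i ≠ .inr (some (W.hd q)) → T2 i = T1 i := fun i hi =>
        Function.update_of_ne hi ..
      refine ⟨posn (W.hd q), T2, ⟨?_, ?_, ?_, ?_⟩, ?_⟩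
      · intro i n; rw [h2 _ (by simp), h1cells]
      · intro n; rw [h2 _ (by simp), h1none]
      · intro h
        by_cases hh : h = W.hd q
        · subst hh; simp [T2]
        · rw [h2 _ (by simpa using hh), h1other h hh]
          simp only [posn, Function.update_of_ne hh]
          exact hT.head h
      · intro h j hj
        by_cases hh : h = W.hd q
        · subst hh
          simp only [T2, Function.update_self]
          rw [Function.update_of_ne hj.ne]
          -- The old mark is erased, so the head tape is 0 up to and including the old position, and
          -- the new position is at most one further.
          refine h1self j ?_
          simp only [posn, Function.update_self] at hj
          revert hj
          generalize c.2.1 = d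
          cases d <;> simp only [Dir.move] <;> omega
        · rw [h2 _ (by simpa using hh), h1other h hh]
          simp only [posn, Function.update_of_ne hh] at hj
          exact hT.before h j hj
      · have hPT : ∀ s p, s ≠ .halt → P (conf s p T) := fun s p hs =>
          hP s p T hs (fun i j => Or.inl (hT.cells i j)) hT.zero
        obtain ⟨h3, h4⟩ := (path_home W (P := P) T hT.zero q n fun j => hPT _ _ (by simp)).of_ne
          fun h => by simpa [conf] using congrArg (·.1.1) h
        refine ⟨h3, h4.trans
          ((path_find W T q (pos (W.hd q)) (hT.before _) fun j => hPT _ _ (by simp)).trans ?_)⟩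
        refine Sys.Path.head (c' := conf (.put (W.hd q) c.2.2) (posn (W.hd q)) T1)
          (hPT _ _ (by simp)) ?_ (Sys.Path.single
            (hP _ _ _ (by simp) (fun i j => Or.inr (h1cells i j)) h1none) ?_)
        · rw [step_conf]
          simp only [oneHead, hT.head, if_true, hT.cells]
          simp only [posn, Function.update_self]
          rfl
        · rw [step_conf]
          simp only [oneHead, Dir.move]
          congr 1
          funext i j
          by_cases hi : i = .inr (some (W.hd q))
          · subst hi; simp only [T2, Function.update_self]
          · rw [Function.update_of_ne hi, Function.update_eq_self, h2 _ hi]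
    have hhome : homeState W q = .home q := if_neg hq
    rcases hR with ⟨n, T, rfl, hT⟩ | ⟨T, rfl, hb, hTc, hTz⟩
    · obtain ⟨n', T', hT', hpath⟩ := main n T hT
      simp only [hhome]
      exact ⟨_, Or.inl ⟨n', T', rfl, hT'⟩, hpath⟩
    · obtain ⟨rfl, h⟩ := Prod.ext_iff.1 hb
      obtain rfl : pos = fun _ => 0 := h
      let T0 : I ⊕ Option M → ℕ → Bool := fun i => Function.update (T i) 0
        ((Sum.elim (fun i => T (.inl i) 0) (fun h => h.elim (T (.inr none) 0) fun _ => true) :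
          I ⊕ Option M → Bool) i)
      have hT0 : OneHeadTape T0 (fun _ : M => 0) σ := by
        refine ⟨?_, ?_, ?_, by simp⟩
        · exact fun i n => (congrFun (Function.update_eq_self ..) n).trans (hTc i n)
        · exact fun n => (congrFun (Function.update_eq_self ..) n).trans (hTz n)
        · intro h; simp [T0]
      obtain ⟨n', T', hT', hP0, hpath⟩ := main 0 T0 hT0
      refine ⟨_, Or.inl ⟨n', T', rfl, hT'⟩,
        hP _ _ _ (by simp) (fun i j => Or.inl (hTc i j)) hTz, ?_⟩
      have : (oneHead W).sys.step (conf .lim 0 T) = conf (.home W.lim) 0 T0 := by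
        rw [step_conf]; rfl
      rw [this]
      exact Sys.Path.head hP0 rfl hpath
  · intro τ σ h1 h2
    exact Or.inr ⟨τ, rfl, rfl, h1, fun n => h2 _ n rfl⟩

theorem oneHead_haltsFrom_iff {k : ℕ} (hW : W.lim ≠ W.halt)
    (ini : (Fin k → Bool) → Bool → I → Bool) (x : Fin k → Cantor) :
    (oneHead W).sys.HaltsFrom ((oneHead W).start (iniTape (oneHeadIni M ini) x)) ↔
      W.sys.HaltsFrom (W.start (iniTape ini x)) := by
  refine (oneHead_sim W).haltsFrom_iff ?_ ?_
  · rintro a b (⟨n, T, rfl, -⟩ | ⟨T, rfl, h, -⟩) hb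
    · have hb : b.1.1 = W.halt := hb
      exact ⟨0, by simp only [Sys.run_zero, conf, homeState, hb, if_true]; rfl⟩
    · have hb : b.1.1 = W.halt := hb
      rw [h] at hb
      exact absurd hb hW
  · exact Or.inr ⟨_, rfl, rfl, fun i n => rfl, fun n => rfl⟩

/-- Tables for machines with many tapes and heads. -/
theorem exists_table_of_multihead [Finite I] [Finite M] [Finite Q] {k : ℕ}
    (hI : 3 ≤ Nat.card I) (hW : W.lim ≠ W.halt) (ini : (Fin k → Bool) → Bool → I → Bool) :
    ∃ (N : ℕ) (l : List ℕ), 2 < N ∧ l.length = N * 2 ^ (k + 2) ∧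
      (∀ i < 2 ^ (k + 2), l.getD i 0 = l.getD (2 ^ (k + 2) + i) 0) ∧
      ∀ p, (∀ i, 2 ^ (k + 2) ≤ i → i < l.length → (table p).getD i 0 = l.getD i 0) →
      ∀ s, s ≠ haltState → (∀ r : Fin (k + 2) → Bool, action p s r = action p 1 r) →
      ∀ x : Fin k → Cantor,
        (W.sys.HaltsFrom (W.start (iniTape ini x)) →
          ∃ c, (ittm k p).Reach ((s, 0), initTape x) c ∧ c.1.1 = haltState ∧
            c.2 (Fin.last (k + 1)) = ofNat 1) ∧
        (¬ W.sys.HaltsFrom (W.start (iniTape ini x)) →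
          ¬ (ittm k p).HaltsFrom ((s, 0), initTape x)) := by
  classical
  have hcard : 3 ≤ Nat.card (I ⊕ Option M) := by
    rw [Nat.card_sum]; omega
  obtain ⟨N, l, h1, h2, h3, h4⟩ := exists_table_of_mh hcard (oneHead W)
    (show OneHeadState.lim ≠ .halt by simp)
    (oneHeadIni M ini)
  refine ⟨N, l, h1, h2, h3, fun p hp s hs hs' x => ?_⟩
  simpa only [oneHead_haltsFrom_iff W hW ini x] using h4 p hp s hs hs' x

/-- Semi-deciders from machines. -/
theorem exists_program_of_multihead [Finite I] [Finite M] [Finite Q] {k : ℕ}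
    (hI : 3 ≤ Nat.card I) (hW : W.lim ≠ W.halt) (ini : (Fin k → Bool) → Bool → I → Bool) :
    ∃ p, p ≠ 0 ∧ ∀ x : Fin k → Cantor,
      (Halts p x ↔ W.sys.HaltsFrom (W.start (iniTape ini x))) ∧
      ∀ h : (phi p x).Dom, (phi p x).get h = ofNat 1 := by
  obtain ⟨N, l, h1, h2, h3, h4⟩ := exists_table_of_multihead W hI hW ini
  -- The extra entry 1 after the table ensures `p ≠ 0`; the self-quoting program needs a last digit
  -- 1 in `p`.
  obtain ⟨p, -, hp'⟩ := exists_program (l ++ [1])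
  have hp : ∀ i < l.length, (table p).getD i 0 = l.getD i 0 := fun i hi => by
    rw [hp', List.getD_append _ _ _ _ hi]
  have hact : ∀ r : Fin (k + 2) → Bool, action p startState r = action p 1 r := by
    intro r
    have hr := Nat.ofBits_lt_two_pow r
    have hl : 2 ^ (k + 2) + 2 ^ (k + 2) ≤ l.length := by rw [h2]; nlinarith
    rw [action_eq, action_eq, one_mul, startState, zero_mul, zero_add, hp _ (by omega),
      hp _ (by omega), h3 _ hr]
  refine ⟨p, ?_, fun x => ?_⟩
  · rintro rfl
    have := hp' l.length
    rw [List.getD_append_right _ _ _ _ le_rfl] at this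
    have h0 : table 0 = [0] := by simp [table]
    rw [h0, h2] at this
    have h5 : N * 2 ^ (k + 2) ≠ 0 := by positivity
    obtain ⟨m, hm⟩ := Nat.exists_eq_succ_of_ne_zero h5
    simp [hm] at this
  obtain ⟨h5, h6⟩ := h4 p (fun i _ hi => hp i hi) startState (by simp [startState, haltState]) hact x
  have hiff : Halts p x ↔ W.sys.HaltsFrom (W.start (iniTape ini x)) := by
    rw [halts_iff]
    refine ⟨fun h => by_contra fun h' => h6 h' h, fun h => ?_⟩
    obtain ⟨c, hc, hc', -⟩ := h5 h
    exact hc.haltsFrom_iff.2 ⟨0, by rw [Sys.run_zero]; exact hc'⟩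
  refine ⟨hiff, fun h => ?_⟩
  obtain ⟨c, hc, hc', hc''⟩ := h5 (hiff.1 h)
  rw [phi_eq_of_reach hc hc' h, hc'']

end ITTM

namespace ITTM

open Order MH

namespace MH

variable {I M Q : Type} [DecidableEq M]

theorem step_keep (W : MH I M Q) {q : Q} {pos : M → ℕ} {τ : I → ℕ → Bool} {d : Dir} {q' : Q}
    (h : W.act q (fun i => τ i (pos (W.hd q))) = (fun i => τ i (pos (W.hd q)), d, q')) :
    W.sys.step ((q, pos), τ) =
      ((q', Function.update pos (W.hd q) (d.move (pos (W.hd q)))), τ) := by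
  simp only [sys, stepAux, h, update_self_col]

theorem step_keep_stay (W : MH I M Q) {q : Q} {pos : M → ℕ} {τ : I → ℕ → Bool} {q' : Q}
    (h : W.act q (fun i => τ i (pos (W.hd q))) = (fun i => τ i (pos (W.hd q)), .stay, q')) :
    W.sys.step ((q, pos), τ) = ((q', pos), τ) := by
  rw [step_keep W h]; simp only [Dir.move, Function.update_eq_self]

theorem step_write_stay (W : MH I M Q) {q : Q} {pos : M → ℕ} {τ : I → ℕ → Bool} {w : I → Bool}
    {q' : Q} (h : W.act q (fun i => τ i (pos (W.hd q))) = (w, .stay, q')) :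
    W.sys.step ((q, pos), τ) =
      ((q', pos), fun i => Function.update (τ i) (pos (W.hd q)) (w i)) := by
  simp only [sys, stepAux, h, Dir.move, Function.update_eq_self]

/-- A loop has to survive limit stages too, so the flags on the tapes must lead back into it. The
machine simulates a trivial system without tapes that never halts, with all of its own cells
preserved. -/
theorem not_haltsFrom_of_spin (W : MH I M Q) {τ : I → ℕ → Bool} {q : Q} (hlim : W.lim ≠ W.halt)
    (hq : q ≠ W.halt) (h1 : W.act W.lim (fun i => τ i 0) = (fun i => τ i 0, .stay, q))
    (h2 : ∀ n, W.act q (fun i => τ i n) = (fun i => τ i n, .stay, q))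
    {c : (Q × (M → ℕ)) × (I → ℕ → Bool)} (hc : c.1.1 = q ∨ c.1 = (W.lim, fun _ => 0))
    (hcτ : c.2 = τ) : ¬ W.sys.HaltsFrom c := by
  let B : Sys Unit Empty := ⟨(), id, fun _ => False⟩
  have hsim : Sys.Sim W.sys B (fun i _ => i.elim) (fun _ _ => True) τ
      (fun a _ => a.2 = τ ∧ (a.1.1 = q ∨ a.1 = (W.lim, fun _ => 0))) := by
    refine ⟨fun a b _ j => j.elim, ?_, ?_⟩
    · rintro ⟨⟨s, pos⟩, τ'⟩ b ⟨rfl, h⟩ -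
      have hs : W.sys.step ((s, pos), τ') = ((q, pos), τ') := by
        rcases h with rfl | h
        · exact step_keep_stay W (h2 _)
        · obtain ⟨rfl, rfl⟩ := Prod.ext_iff.1 h
          exact step_keep_stay W h1
      refine ⟨((q, pos), τ'), ⟨rfl, Or.inl rfl⟩, ⟨?_, fun j => j.elim, fun i n _ => rfl⟩,
        ⟨0, hs, by simp⟩⟩
      rcases h with rfl | h
      · exact hq
      · obtain ⟨rfl, rfl⟩ := Prod.ext_iff.1 h
        exact hlim
    · intro τ' σ _ h
      exact ⟨funext fun i => funext fun n => h i n trivial, Or.inr rfl⟩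
  exact hsim.not_haltsFrom (b0 := ((), fun i => i.elim)) ⟨hcτ, hc⟩ fun ⟨_, h⟩ => h

end MH

/-! ### The universal machine -/

/-- The tapes of the universal machine: the program, the tapes of the simulated machine, flags at
cell `0`, and a tape that marks cell `0`. -/
inductive UTape
  | prog
  | sim (i : Fin (1 + 2))
  | init
  | check
  | seen
  | zero
  deriving DecidableEq

/-- The states of the universal machine. The pointer `some s` is at the row of the current state. -/
inductive UState
  | lim
  | halt
  | spin
  | scan
  | set
  | unset
  | read (s : Bool)
  | skip (b : Bool) (n : Fin 8) (s : Bool) (cont : Option (Fin 16 × Fin 4))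
  | count (s : Bool) (c : Fin 16) (m : Fin 4)
  | home (s : Bool) (c : Fin 16) (m : Fin 4)
  | write (s : Bool) (c : Fin 16) (m : Fin 4)
  deriving DecidableEq

instance : Finite UTape := Finite.of_equiv _ (proxy_equiv% UTape)
instance : Finite UState := Finite.of_equiv _ (proxy_equiv% UState)

namespace UState

def contState (s : Bool) : Option (Fin 16 × Fin 4) → UState
  | none => .read s
  | some (c, m) => .count s c m

/-- Skip `n` entries of the table with pointer `b`. -/
def skipFrom (b : Bool) (n : ℕ) (s : Bool) (cont : Option (Fin 16 × Fin 4)) : UState :=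
  match n with
  | 0 => contState s cont
  | n + 1 => if h : n < 8 then .skip b ⟨n, h⟩ s cont else .halt

/-- The state after counting `j` digits of an entry. -/
def countState (s : Bool) (j : ℕ) : UState :=
  .count s ⟨j % 16, Nat.mod_lt _ (by norm_num)⟩ ⟨min 3 (j / 16), by omega⟩

end UState

open UState

/-- The machine that simulates the program `p` on its first tape. Its heads are the simulated head
`none` and two pointers. First it checks that `p` has only finitely many digits `1`. -/
def universal : MH UTape (Option Bool) UState where
  lim := .lim
  halt := .halt
  hd
    | .scan => some true
    | .skip b _ _ _ => some b
    | .count s _ _ => some s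
    | .home s _ _ => some s
    | _ => none
  act
    | .lim, r =>
      if r .init then (Function.update (Function.update r .init false) .check true, .stay, .scan)
      -- This is the limit that ends the scan, or a later one inside the loop, where `check` and
      -- `seen` are both still set.
      else if r .check then
        if r .seen then (r, .stay, .spin)
        else (Function.update r .check false, .stay, .read true)
      -- A limit of the simulated run: both pointers are on cell 0, and skipping eight entries leads
      -- to row 1, that of the limit state.
      else (r, .stay, skipFrom true 8 true none)
    | .halt, r => (r, .stay, .halt)
    | .spin, r => (r, .stay, .spin)
    | .scan, r => if r .prog then (r, .right, .set) else (r, .right, .scan)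
    | .set, r => (Function.update r .seen true, .stay, .unset)
    | .unset, r => (Function.update r .seen false, .stay, .scan)
    | .read s, r =>
      (r, .stay, skipFrom s (Nat.ofBits fun i => r (.sim i)) s (some (0, 0)))
    | .skip b n s cont, r =>
      (r, .right, if r .prog then .skip b n s cont else skipFrom b n s cont)
    | .count s c m, r =>
      if r .prog then
        (r, .right, if c.1 = 15 then skipFrom (!s) 8 s (some (0, ⟨min 3 (m + 1), by omega⟩))
          else .count s ⟨(c + 1) % 16, Nat.mod_lt _ (by norm_num)⟩ m)
      else (r, .stay, .home s c m)
    | .home s c m, r => if r .zero then (r, .stay, .write s c m) else (r, .left, .home s c m)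
    | .write s c m, r =>
      (fun | .sim i => c.1.testBit i | i => r i, if c.1.testBit 3 then .right else .left,
        if m.1 = 2 then .halt else .read !s)

def uTape (P : Cantor) (σ : Fin (1 + 2) → Cantor) (f g h : Bool) : UTape → ℕ → Bool
  | .prog => P
  | .sim i => σ i
  | .init => fun n => f && decide (n = 0)
  | .check => fun n => g && decide (n = 0)
  | .seen => fun n => h && decide (n = 0)
  | .zero => fun n => decide (n = 0)

/-- Positions of the heads. -/
def uPos (s : Bool) (x y z : ℕ) : Option Bool → ℕ
  | none => x
  | some b => if b = s then y else z

theorem uPos_update_none (s : Bool) (x y z v : ℕ) :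
    Function.update (uPos s x y z) none v = uPos s v y z := by
  funext b; cases b <;> simp [uPos]

theorem uPos_update_self (s : Bool) (x y z v : ℕ) :
    Function.update (uPos s x y z) (some s) v = uPos s x v z := by
  funext b
  cases b with
  | none => simp [uPos]
  | some b => cases b <;> cases s <;> simp [uPos]

theorem uPos_update_other (s : Bool) (x y z v : ℕ) :
    Function.update (uPos s x y z) (some !s) v = uPos s x y v := by
  funext b
  cases b with
  | none => simp [uPos]
  | some b => cases b <;> cases s <;> simp [uPos]

theorem uPos_not (s : Bool) (x y z : ℕ) : uPos (!s) x y z = uPos s x z y := by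
  funext b
  cases b with
  | none => rfl
  | some b => cases b <;> cases s <;> rfl

theorem uPos_zero (s : Bool) : uPos s 0 0 0 = fun _ => 0 := by
  funext b
  cases b <;> simp [uPos]

/-! ### The universal machine simulates a program -/

section Simulation

variable {P : Cantor} {a : ℕ → ℕ} (hPa : Parse P a)

include hPa in
theorem path_skip {p} (τ : UTape → ℕ → Bool) (hτ : τ .prog = P) (b : Bool) (s : Bool)
    (cont : Option (Fin 16 × Fin 4)) (n : ℕ) (hn : n ≤ 8) (pos : Option Bool → ℕ) (e : ℕ)
    (hpos : pos (some b) = entryPos a e) (hp : ∀ q pos, q ≠ .halt → p ((q, pos), τ)) :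
    universal.sys.Path p ((skipFrom b n s cont, pos), τ)
      ((contState s cont, Function.update pos (some b) (entryPos a (e + n))), τ) := by
  induction n generalizing pos e with
  | zero => rw [add_zero, ← hpos, Function.update_eq_self]; exact Sys.Path.refl ..
  | succ n ih =>
    have hq : skipFrom b (n + 1) s cont = .skip b ⟨n, hn⟩ s cont := by
      rw [skipFrom, dif_pos (by omega)]
    have hone : ∀ j ≤ a e, universal.sys.Path p ((skipFrom b (n + 1) s cont, pos), τ)
        ((skipFrom b (n + 1) s cont, Function.update pos (some b) (entryPos a e + j)), τ) := by
      intro j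
      induction j with
      | zero => intro _; rw [add_zero, ← hpos, Function.update_eq_self]; exact Sys.Path.refl ..
      | succ j ihj =>
        intro hj
        refine (ihj (by omega)).tail (hp _ _ (by simp [hq])) ?_
        rw [hq, step_keep universal (d := .right) (q' := .skip b ⟨n, hn⟩ s cont)]
        · simp [universal, Dir.move, add_assoc]
        · simp [universal, hτ, (hPa e).1 j (by omega)]
    refine (hone (a e) le_rfl).trans (Sys.Path.head (hp _ _ (by simp [hq])) ?_
      (c' := ((skipFrom b n s cont, Function.update pos (some b) (entryPos a (e + 1))), τ)) ?_)
    · rw [hq, step_keep universal (d := .right) (q' := skipFrom b n s cont)]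
      · simp [universal, Dir.move, entryPos_succ]
      · simp [universal, hτ, (hPa e).2]
    · have := ih (by omega) (Function.update pos (some b) (entryPos a (e + 1))) (e + 1) (by simp)
      rwa [Function.update_idem, add_assoc, add_comm 1] at this

include hPa in
-- With one input tape, an action number `A` has its write digits and direction in `A % 16` and its
-- next state in `A / 16`, and a row has 8 entries. While one pointer counts the unary entry modulo
-- 16, the other one advances by a row every 16 digits, and so ends on the row of the next state. No
-- unbounded number has to be stored; the quotient, cut off at 3, is kept only to recognize the halt
-- state 2.
theorem path_count {p} (τ : UTape → ℕ → Bool) (hτ : τ .prog = P) (s : Bool) (x e : ℕ)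
    (hp : ∀ q pos, q ≠ .halt → p ((q, pos), τ)) (j : ℕ) (hj : j ≤ a e) :
    universal.sys.Path p
      ((countState s 0, uPos s x (entryPos a e) 0), τ)
      ((countState s j, uPos s x (entryPos a e + j) (entryPos a (8 * (j / 16)))), τ) := by
  induction j with
  | zero => exact Sys.Path.refl ..
  | succ j ih =>
    refine (ih (by omega)).trans ?_
    have hbit : P (entryPos a e + j) = true := (hPa e).1 j (by omega)
    by_cases h15 : j % 16 = 15
    · have h1 : (j + 1) / 16 = j / 16 + 1 := by omega
      have h2 : (j + 1) % 16 = 0 := by omega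
      refine Sys.Path.head (hp _ _ (by simp [countState])) (c' :=
        ((skipFrom (!s) 8 s (some (0, ⟨min 3 (min 3 (j / 16) + 1), by omega⟩)),
          uPos s x (entryPos a e + (j + 1)) (entryPos a (8 * (j / 16)))), τ)) ?_ ?_
      · rw [countState, step_keep universal (d := .right)
          (q' := skipFrom (!s) 8 s (some (0, ⟨min 3 (min 3 (j / 16) + 1), by omega⟩)))]
        · simp only [universal, Dir.move, uPos_update_self]
          simp [uPos, add_assoc]
        · simp [universal, hτ, uPos, hbit, h15]
      · have := path_skip hPa (p := p) τ hτ (!s) s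
          (some (0, ⟨min 3 (min 3 (j / 16) + 1), by omega⟩)) 8 le_rfl
          (uPos s x (entryPos a e + (j + 1)) (entryPos a (8 * (j / 16)))) (8 * (j / 16))
          (by cases s <;> simp [uPos]) hp
        rw [uPos_update_other] at this
        have h3 : countState s (j + 1) =
            contState s (some (0, ⟨min 3 (min 3 (j / 16) + 1), by omega⟩)) := by
          simp only [countState, contState, h1, h2]
          congr 2
          omega
        rw [h1, h3, mul_add]
        exact this
    · have h1 : (j + 1) / 16 = j / 16 := by omega
      have h2 : (j + 1) % 16 = j % 16 + 1 := by omega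
      refine Sys.Path.single (hp _ _ (by simp [countState])) ?_
      rw [countState, step_keep universal (d := .right) (q' := countState s (j + 1))]
      · simp only [universal, Dir.move, uPos_update_self, h1]
        simp [uPos, add_assoc]
      · simp [universal, hτ, uPos, hbit, h15, countState, h1]

theorem path_home_pointer {p} (τ : UTape → ℕ → Bool) (hτ : ∀ n, τ .zero n = decide (n = 0))
    (s : Bool) (c : Fin 16) (m : Fin 4) (x y z : ℕ)
    (hp : ∀ q pos, q ≠ .halt → p ((q, pos), τ)) :
    universal.sys.Path p ((.home s c m, uPos s x y z), τ)
      ((.write s c m, uPos s x 0 z), τ) := by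
  induction y with
  | zero =>
    refine Sys.Path.single (hp _ _ (by simp)) ?_
    rw [step_keep_stay universal (q' := .write s c m)]
    simp [universal, uPos, hτ]
  | succ y ih =>
    refine Sys.Path.head (hp _ _ (by simp)) ?_ ih
    rw [step_keep universal (d := .left) (q' := .home s c m)]
    · simp only [universal, Dir.move, uPos_update_self]
      simp [uPos]
    · simp [universal, uPos, hτ]

/-- The relation between the universal machine and the simulated one. -/
def URel (P : Cantor) (a : ℕ → ℕ) (c : (UState × (Option Bool → ℕ)) × (UTape → ℕ → Bool))
    (b : (ℕ × ℕ) × (Fin (1 + 2) → ℕ → Bool)) : Prop :=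
  (∃ s, c = ((if b.1.1 = haltState then .halt else .read s,
    uPos s b.1.2 (entryPos a (8 * b.1.1)) 0), uTape P b.2 false false false)) ∨
  c = universal.start (uTape P b.2 false false false) ∧ b.1 = (limitState, 0)

theorem universal_sim (p : ℕ) :
    Sys.Sim universal.sys (ittm 1 p) (fun i n => (.sim i, n)) (fun i _ => ∀ j, i ≠ .sim j)
      (uTape (ofNat p) (fun _ _ => false) false false false)
      (URel (ofNat p) fun e => (table p).getD e 0) := by
  set a : ℕ → ℕ := fun e => (table p).getD e 0 with ha
  have hPa : Parse (ofNat p) a := parse_table p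
  refine ⟨?_, ?_, ?_⟩
  · rintro c b (⟨s, rfl⟩ | ⟨rfl, -⟩) i n <;> rfl
  · rintro c ⟨⟨q, n⟩, σ⟩ hR hq'
    have hq : q ≠ haltState := hq'
    let B := universal.sys.Between (ittm 1 p) (fun i n => (.sim i, n)) (fun i _ => ∀ j, i ≠ .sim j)
      (uTape (ofNat p) (fun _ _ => false) false false false) ((q, n), σ)
    let τ := uTape (ofNat p) σ false false false
    have hB : ∀ q pos, q ≠ .halt → B ((q, pos), τ) := by
      intro q pos hq
      refine ⟨hq, fun i n => Or.inl rfl, fun i n hi => ?_⟩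
      cases i <;> first | rfl | exact absurd rfl (hi _)
    have main : ∀ s, ∃ c', URel (ofNat p) a c' ((ittm 1 p).step ((q, n), σ)) ∧
        B ((.read s, uPos s n (entryPos a (8 * q)) 0), τ) ∧
        universal.sys.Path B (universal.sys.step ((.read s, uPos s n (entryPos a (8 * q)) 0), τ))
          c' := by
      intro s
      let r : Fin (1 + 2) → Bool := fun i => σ i n
      have hr : Nat.ofBits r < 8 := Nat.ofBits_lt_two_pow r
      let e := 8 * q + Nat.ofBits r
      let A := a e
      have hact : action p q r = Action.ofCode 1 A := by
        rw [action_eq]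
        simp only [A, e, a]
        rw [mul_comm q]
        norm_num
      -- The two pointers have exchanged their roles: `!s` is on the row of the next state, and `s`
      -- has been sent home. The simulated tapes change only in the last step.
      refine ⟨((if (A / 16) = 2 then .halt else .read !s,
        uPos (!s) (if A.testBit 3 then n + 1 else n - 1) (entryPos a (8 * (A / 16))) 0),
        uTape (ofNat p) (fun i => Function.update (σ i) n (A.testBit i)) false false false),
        Or.inl ⟨!s, ?_⟩, hB _ _ (by simp), ?_⟩
      · simp only [ittm, Config.step]
        rw [show (action p q fun i => σ i n) = _ from hact]
        rfl
      have h1 : universal.sys.step ((.read s, uPos s n (entryPos a (8 * q)) 0), τ) =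
          ((skipFrom s (Nat.ofBits r) s (some (0, 0)), uPos s n (entryPos a (8 * q)) 0), τ) :=
        step_keep_stay universal rfl
      rw [h1]
      have h2 := path_skip hPa (p := B) τ rfl s s (some (0, 0)) (Nat.ofBits r) hr.le
        (uPos s n (entryPos a (8 * q)) 0) (8 * q) (by simp [uPos]) hB
      rw [uPos_update_self] at h2
      refine h2.trans ((path_count hPa (p := B) τ rfl s n e hB A le_rfl).trans ?_)
      refine Sys.Path.head (hB _ _ (by simp [countState])) (step_keep_stay universal
        (q' := .home s ⟨A % 16, Nat.mod_lt _ (by norm_num)⟩ ⟨min 3 (A / 16), by omega⟩) ?_)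
        ((path_home_pointer (p := B) τ (fun _ => rfl) s _ _ n _ _ hB).trans
          (Sys.Path.single (hB _ _ (by simp)) ?_))
      · have : τ .prog (entryPos a e + A) = false := (hPa e).2
        simp [universal, countState, uPos, this]
      · have hbit : ∀ i < 4, (A % 16).testBit i = A.testBit i := by
          intro i hi
          rw [show 16 = 2 ^ 4 by norm_num, Nat.testBit_mod_two_pow]
          simp [hi]
        have hm : min 3 (A / 16) = 2 ↔ A / 16 = 2 := by omega
        simp only [sys, stepAux, universal, hm]
        refine Prod.ext (Prod.ext rfl ?_) ?_
        · simp only [uPos_update_none, uPos_not]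
          congr 1
          rw [hbit 3 (by norm_num)]
          simp only [uPos]
          split_ifs <;> rfl
        · funext i
          cases i
          case sim i =>
            simp only [uTape, uPos, τ]
            rw [hbit i (by omega)]
          all_goals exact Function.update_eq_self _ _
    rcases hR with ⟨s, rfl⟩ | ⟨rfl, hb⟩
    · simp only [if_neg hq]
      exact main s
    · obtain ⟨rfl, rfl⟩ := Prod.ext_iff.1 hb
      obtain ⟨c', h1, h2, h3⟩ := main true
      refine ⟨c', h1, hB _ _ (by simp [universal]), ?_⟩
      have h4 : universal.sys.step (universal.start τ) =
          ((skipFrom true 8 true none, fun _ => 0), τ) := step_keep_stay universal rfl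
      have h5 := path_skip hPa (p := B) τ rfl true true none 8 le_rfl (fun _ => 0) 0 rfl hB
      rw [← uPos_zero true, uPos_update_self, zero_add] at h5
      rw [show uTape (ofNat p) σ false false false = τ from rfl, h4, ← uPos_zero true]
      exact h5.trans (Sys.Path.head h2 rfl h3)
  · intro τ σ h1 h2
    refine Or.inr ⟨?_, rfl⟩
    have : τ = uTape (ofNat p) σ false false false := by
      funext i n
      cases i
      case sim i => exact h1 i n
      all_goals exact h2 _ _ (by simp)
    rw [this]; rfl

theorem universal_haltsFrom_read_iff (p : ℕ) (x : Fin 1 → Cantor) :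
    universal.sys.HaltsFrom ((.read true, fun _ => 0),
      uTape (ofNat p) (initTape x) false false false) ↔ Halts p x := by
  rw [halts_iff]
  refine (universal_sim p).haltsFrom_iff ?_ (Or.inl ⟨true, ?_⟩)
  · rintro c b (⟨s, rfl⟩ | ⟨rfl, h⟩) hb
    · have hb : b.1.1 = haltState := hb
      refine ⟨0, ?_⟩
      rw [Sys.run_zero, if_pos hb]
      rfl
    · have hb : b.1.1 = haltState := hb
      rw [h] at hb
      exact absurd hb (by simp [limitState, haltState])
  · simp [startState, haltState, entryPos_zero, uPos_zero]

end Simulation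

/-! ### Checking that the first tape holds a natural number -/

section Scan

variable (P : Cantor) (σ : Fin (1 + 2) → Cantor)

def scanConf (n : ℕ) : (UState × (Option Bool → ℕ)) × (UTape → ℕ → Bool) :=
  ((.scan, uPos true 0 n 0), uTape P σ false true false)

theorem update_seen (g h : Bool) :
    (fun i => Function.update (uTape P σ false true g i) 0
      (Function.update (fun i => uTape P σ false true g i 0) .seen h i)) =
    uTape P σ false true h := by
  funext i n
  cases i
  case seen =>
    simp only [Function.update_self, uTape, Function.update_apply]
    split_ifs with hn <;> simp [hn]
  all_goals
    rw [Function.update_of_ne (fun h => UTape.noConfusion h), Function.update_eq_self]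
    rfl

theorem step_scan (n : ℕ) : universal.sys.step (scanConf P σ n) =
    ((if P n then .set else .scan, uPos true 0 (n + 1) 0), uTape P σ false true false) := by
  rw [scanConf, MH.step_keep universal (d := .right) (q' := if P n then .set else .scan)]
  · simp only [universal, Dir.move, uPos_update_self]
    simp [uPos]
  · simp only [universal, uTape, uPos]
    split_ifs <;> rfl

theorem step_set (n : ℕ) :
    universal.sys.step ((.set, uPos true 0 n 0), uTape P σ false true false) =
      ((.unset, uPos true 0 n 0), uTape P σ false true true) := by
  rw [MH.step_write_stay universal rfl]
  exact congrArg _ (update_seen P σ false true)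

theorem step_unset (n : ℕ) :
    universal.sys.step ((.unset, uPos true 0 n 0), uTape P σ false true true) =
      scanConf P σ n := by
  rw [MH.step_write_stay universal rfl]
  exact congrArg _ (update_seen P σ true false)

/-- The number of steps to reach cell `n` depends on the digits passed, since each 1 costs two extra
steps for the flag; `m ≥ n` suffices to see that all finite stages are covered. -/
theorem path_scan {p : (UState × (Option Bool → ℕ)) × (UTape → ℕ → Bool) → Prop}
    (hp : ∀ q pos h, q ≠ .halt → p ((q, pos), uTape P σ false true h)) (n : ℕ) :
    ∃ m ≥ n, universal.sys.step^[m] (scanConf P σ 0) = scanConf P σ n ∧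
      ∀ u < m, p (universal.sys.step^[u] (scanConf P σ 0)) := by
  induction n with
  | zero => exact ⟨0, le_rfl, rfl, by simp⟩
  | succ n ih =>
    obtain ⟨m, hm, h1, h2⟩ := ih
    have hone : p (universal.sys.step^[m] (scanConf P σ 0)) := by
      rw [h1]; exact hp _ _ _ (by simp)
    have hs1 : universal.sys.step^[m + 1] (scanConf P σ 0) =
        ((if P n then .set else .scan, uPos true 0 (n + 1) 0), uTape P σ false true false) := by
      rw [Function.iterate_succ_apply', h1, step_scan]
    by_cases hP : P n
    · rw [if_pos hP] at hs1
      have hs2 : universal.sys.step^[m + 2] (scanConf P σ 0) =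
          ((.unset, uPos true 0 (n + 1) 0), uTape P σ false true true) := by
        rw [Function.iterate_succ_apply', hs1, step_set]
      have hs3 : universal.sys.step^[m + 3] (scanConf P σ 0) = scanConf P σ (n + 1) := by
        rw [Function.iterate_succ_apply', hs2, step_unset]
      refine ⟨m + 3, by omega, hs3, fun u hu => ?_⟩
      obtain h | rfl | rfl | rfl : u < m ∨ u = m ∨ u = m + 1 ∨ u = m + 2 := by omega
      · exact h2 u h
      · exact hone
      · rw [hs1]; exact hp _ _ _ (by simp)
      · rw [hs2]; exact hp _ _ _ (by simp)
    · rw [if_neg hP] at hs1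
      refine ⟨m + 1, by omega, hs1, fun u hu => ?_⟩
      obtain h | rfl : u < m ∨ u = m := by omega
      · exact h2 u h
      · exact hone

theorem reach_scan : universal.sys.Reach (universal.start (uTape P σ true false false))
    (scanConf P σ 0) := by
  have h : universal.sys.step (universal.start (uTape P σ true false false)) = scanConf P σ 0 := by
    rw [MH.start, MH.step_write_stay universal rfl, scanConf, uPos_zero]
    refine Prod.ext rfl ?_
    funext i n
    cases i
    case init | check =>
      simp only [uTape, Function.update_apply]
      split_ifs <;> simp_all
    all_goals exact congrFun (Function.update_eq_self ..) n
  rw [← h]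
  exact Sys.Reach.step (by simp [universal, MH.sys, MH.start])

theorem reach_read {N : ℕ} (hN : ∀ n ≥ N, P n = false) :
    universal.sys.Reach (universal.start (uTape P σ true false false))
      ((.read true, fun _ => 0), uTape P σ false false false) := by
  refine (reach_scan P σ).trans ?_
  obtain ⟨m, -, h1, h2⟩ := path_scan P σ (p := fun c => ¬ universal.sys.halt c.1)
    (fun q pos h hq => hq) N
  refine (Sys.Path.reach ⟨m, h1, h2⟩ fun c hc => hc).trans ?_
  have h3 := Sys.reach_omega_of_const (s := universal.sys) (τ := uTape P σ false true false)
    (fun n => (.scan, uPos true 0 (N + n) 0)) (fun n => by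
      have := step_scan P σ (N + n)
      rwa [hN _ (by omega)] at this) (fun n => by simp [universal, MH.sys])
  refine h3.trans ?_
  have h4 : universal.sys.step (universal.sys.lim, uTape P σ false true false) =
      ((.read true, fun _ => 0), uTape P σ false false false) := by
    refine (MH.step_write_stay universal rfl).trans (Prod.ext rfl ?_)
    funext i n
    cases i
    case check =>
      simp only [uTape, Function.update_apply]
      split_ifs <;> simp_all
    all_goals exact congrFun (Function.update_eq_self ..) n
  rw [← h4]
  exact Sys.Reach.step (by simp [universal, MH.sys])

/-- The flag `seen` is up at infinitely many finite stages, so it is 1 at stage ω although it is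
always lowered again; from there the machine loops. -/
theorem not_haltsFrom_of_infinite (hP : ∀ N, ∃ n ≥ N, P n = true) :
    ¬ universal.sys.HaltsFrom (universal.start (uTape P σ true false false)) := by
  rw [(reach_scan P σ).haltsFrom_iff]
  have hfine : ∀ u : ℕ, universal.sys.step^[u] (scanConf P σ 0) ∈
      {c | ¬ universal.sys.halt c.1 ∧ ∃ h, c.2 = uTape P σ false true h} := by
    intro u
    obtain ⟨m, hm, -, h⟩ := path_scan P σ
      (p := fun c => ¬ universal.sys.halt c.1 ∧ ∃ h, c.2 = uTape P σ false true h)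
      (fun q pos h hq => ⟨hq, h, rfl⟩) (u + 1)
    exact h u (by omega)
  have hreach : universal.sys.Reach (scanConf P σ 0)
      (universal.start (uTape P σ false true true)) := by
    refine ⟨Ordinal.omega0, ?_, fun u hu => ?_⟩
    · ext1
      · exact Sys.run_limit_fst _ _ Ordinal.isSuccLimit_omega0
      funext i j
      rw [Bool.eq_iff_iff, Sys.run_limit_snd _ _ Ordinal.isSuccLimit_omega0]
      simp only [MH.start]
      -- Only `seen` varies during the scan, so the tapes with `seen` up bound all of them from
      -- above.
      have hle : ∀ h, uTape P σ false true h i j = true → uTape P σ false true true i j = true := by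
        intro h; cases i <;> simp [uTape]
      constructor
      · intro h
        obtain ⟨a, ha, -, h⟩ := h 0 Ordinal.omega0_pos
        obtain ⟨n, rfl⟩ := Ordinal.lt_omega0.1 ha
        rw [Sys.run_natCast] at h
        obtain ⟨-, h', h2⟩ := hfine n
        rw [h2] at h
        exact hle _ h
      · intro h b hb
        obtain ⟨N, rfl⟩ := Ordinal.lt_omega0.1 hb
        obtain ⟨n, hn, hPn⟩ := hP N
        obtain ⟨m, hm, h1, -⟩ := path_scan P σ (p := fun _ => True) (fun _ _ _ _ => trivial) n
        -- Two steps after cell `n` has been reached, the flag for its digit 1 has just been raised.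
        refine ⟨(m + 2 : ℕ), Ordinal.natCast_lt_omega0 _, by exact_mod_cast (by omega), ?_⟩
        rw [Sys.run_natCast, Function.iterate_succ_apply', Function.iterate_succ_apply', h1,
          step_scan, if_pos hPn, step_set]
        exact h
    · obtain ⟨n, rfl⟩ := Ordinal.lt_omega0.1 hu
      rw [Sys.run_natCast]
      exact (hfine n).1
  rw [hreach.haltsFrom_iff]
  exact MH.not_haltsFrom_of_spin universal (q := .spin) (by simp [universal]) (by simp [universal])
    rfl (fun n => rfl) (Or.inr rfl) rfl

end Scan

/-! ### Semi-decidability of both halting problems -/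

/-- The initial tapes of the universal machine: `pv` selects the program and `xv` the input. -/
def uIni {k : ℕ} (pv xv : (Fin k → Bool) → Bool) : (Fin k → Bool) → Bool → UTape → Bool :=
  fun v z i => match i with
    | .prog => pv v
    | .sim i => decide (i = 0) && xv v
    | .init => z
    | .zero => z
    | _ => false

theorem universal_haltsFrom_iff {k : ℕ} (pv xv : (Fin k → Bool) → Bool) (x : Fin k → Cantor) :
    universal.sys.HaltsFrom (universal.start (iniTape (uIni pv xv) x)) ↔
      ∃ p, (fun n => pv fun l => x l n) = ofNat p ∧ Halts p ![fun n => xv fun l => x l n] := by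
  have htape : iniTape (uIni pv xv) x = uTape (fun n => pv fun l => x l n)
      (initTape ![fun n => xv fun l => x l n]) true false false := by
    funext i n
    cases i
    case sim i => fin_cases i <;> simp [iniTape, uIni, uTape, initTape, Config.init]
    all_goals simp [iniTape, uIni, uTape]
  rw [htape]
  generalize (fun n => pv fun l => x l n) = P
  generalize ![fun n => xv fun l => x l n] = y
  by_cases hP : ∃ N, ∀ n ≥ N, P n = false
  · obtain ⟨N, hN⟩ := hP
    obtain ⟨p, hp⟩ := exists_ofNat_eq ((List.range N).map P)
    have hPp : P = ofNat p := by
      rw [hp]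
      funext n
      simp only [toReal, List.getD_eq_getElem?_getD, List.getElem?_map]
      by_cases h : n < N
      · simp [List.getElem?_range h]
      · rw [hN n (by omega), List.getElem?_eq_none (by simpa using h)]
        rfl
    rw [(reach_read P _ hN).haltsFrom_iff, hPp, universal_haltsFrom_read_iff]
    refine ⟨fun h => ⟨p, rfl, h⟩, ?_⟩
    rintro ⟨p', hp', h⟩
    have : p = p' := Nat.eq_of_testBit_eq fun i => congrFun hp' i
    rwa [this]
  · push Not at hP
    refine ⟨fun h => absurd h (not_haltsFrom_of_infinite P _ fun N => ?_), ?_⟩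
    · obtain ⟨n, hn, h⟩ := hP N
      exact ⟨n, hn, by simpa using h⟩
    · rintro ⟨p, rfl, -⟩
      exfalso
      obtain ⟨n, hn, h⟩ := hP p
      -- Since `p < 2 ^ p`, all digits of `p` from position `p` on are 0.
      exact h (Nat.testBit_lt_two_pow (n.lt_two_pow_self.trans_le' hn))

theorem three_le_card_uTape : 3 ≤ Nat.card UTape := by
  have : Function.Injective (UTape.sim) := fun i j h => by injection h
  simpa using Nat.card_le_card_of_injective _ this

theorem universal_lim_ne_halt : universal.lim ≠ universal.halt := by simp [universal]

theorem infSemiDecidable_of_haltsFrom {k : ℕ} {A : Set (Fin k → Cantor)}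
    (pv xv : (Fin k → Bool) → Bool) (hA : ∀ x, x ∈ A ↔
      ∃ p, (fun n => pv fun l => x l n) = ofNat p ∧ Halts p ![fun n => xv fun l => x l n]) :
    InfSemiDecidable A := by
  obtain ⟨p, -, hp⟩ := exists_program_of_multihead universal three_le_card_uTape
    universal_lim_ne_halt (uIni pv xv)
  refine ⟨p, ?_⟩
  funext x
  refine Part.ext' ?_ fun h1 h2 => ((hp x).2 h2).symm
  exact (hA x).trans ((universal_haltsFrom_iff pv xv x).symm.trans (hp x).1.symm)

theorem infSemiDecidable_boldHalt : InfSemiDecidable boldHalt := by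
  refine infSemiDecidable_of_haltsFrom (fun v => v 0) (fun v => v 1) fun x => ?_
  constructor
  · rintro ⟨p, y, rfl, h⟩
    exact ⟨p, rfl, h⟩
  · rintro ⟨p, hp, h⟩
    refine ⟨p, x 1, ?_, h⟩
    funext i
    fin_cases i
    · exact hp
    · rfl

theorem infSemiDecidable_lightHalt : InfSemiDecidable lightHalt := by
  have h0 : ofNat 0 = fun _ => false := by funext i; simp [ofNat]
  refine infSemiDecidable_of_haltsFrom (fun v => v 0) (fun _ => false) fun x => ?_
  rw [← h0]
  constructor
  · rintro ⟨p, rfl, h⟩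
    exact ⟨p, rfl, h⟩
  · rintro ⟨p, hp, h⟩
    refine ⟨p, ?_, h⟩
    funext i
    fin_cases i
    exact hp

end ITTM

namespace ITTM

open Order

/-! ### Programs that run a given program on its own code -/

/-- The row of the table for a state that writes a digit and enters the next state `n`. -/
def writerRow (n : ℕ) (b : Bool) : List ℕ := (16 * n + 8 + b.toNat) :: List.replicate 7 0

/-- The rows for the states from `n` on that write the first `m` digits of `P`. -/
def writerRows (n : ℕ) (P : Cantor) : ℕ → List ℕ
  | 0 => []
  | m + 1 => writerRows n P m ++ writerRow (n + m + 1) (P m)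

theorem length_writerRows (n : ℕ) (P : Cantor) (m : ℕ) : (writerRows n P m).length = 8 * m := by
  induction m with
  | zero => rfl
  | succ m ih => simp [writerRows, writerRow, ih]; ring

theorem writerRows_getD (n : ℕ) (P : Cantor) (m j : ℕ) (hj : j < m) :
    (writerRows n P m).getD (8 * j) 0 = 16 * (n + j + 1) + 8 + (P j).toNat := by
  induction m with
  | zero => omega
  | succ m ih =>
    rw [writerRows]
    by_cases h : j = m
    · subst h
      rw [List.getD_append_right _ _ _ _ (by rw [length_writerRows]), length_writerRows]
      simp [writerRow]
    · rw [List.getD_append _ _ _ _ (by rw [length_writerRows]; omega), ih (by omega)]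

theorem ofNat_last {p m : ℕ} (hm : p.bits.length = m + 1) : ofNat p m = true := by
  rw [Nat.size_eq_bits_len] at hm
  by_contra hf
  have : p < 2 ^ m := Nat.lt_pow_two_of_testBit _ fun i hi => by
    rcases hi.lt_or_eq with hi | rfl
    · exact Nat.testBit_lt_two_pow ((Nat.lt_size_self p).trans_le
        (Nat.pow_le_pow_right (by norm_num) (by omega)))
    · simpa [ofNat] using hf
  have := Nat.size_le.2 this
  omega

theorem ofNat_of_length_le {p m : ℕ} (hm : p.bits.length ≤ m) : ofNat p m = false := by
  rw [ofNat_eq_toReal, toReal, List.getD_eq_default _ _ hm]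

def singleDigit (b : Bool) : Fin (1 + 2) → Bool := fun i => decide (i = 0) && b

theorem ofBits_singleDigit (b : Bool) : Nat.ofBits (singleDigit b) = b.toNat := by
  cases b <;> rfl

theorem ofCode_writer (n : ℕ) (b : Bool) :
    Action.ofCode 1 (16 * n + 8 + b.toNat) = ⟨singleDigit b, true, n⟩ := by
  rw [← ofCode_actionCode, actionCode]
  congr 1
  have : Nat.ofBits (Fin.snoc (singleDigit b) true : Fin (1 + 3) → Bool) = 8 + b.toNat := by
    cases b <;> rfl
  rw [this]; ring

/-- Everything but the rows of the writer: `l` is the table for the machine to be run, and state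
`n` waits for the next limit. -/
def quoteTable (l : List ℕ) (n : ℕ) : List ℕ :=
  [actionCode (singleDigit false) false (n + 1), actionCode (singleDigit true) true n,
    0, 0, 0, 0, 0, 0] ++ l.drop 8 ++
    (List.range 8).map fun c => actionCode (fun j : Fin (1 + 2) => c.testBit j) true n

/-- On blank tapes the program `q` goes from the start state to the writer, which puts the digits of
`p` on the input tape. Then it waits for stage ω, where the limit state 1 with the head on cell 0
starts the machine of table `l` on input `p`. Row 0 is not needed by that machine and controls the
writing phase: reading 0 it starts the writer, reading 1 it starts waiting. -/
theorem quote_halts_iff {n : ℕ} {l : List ℕ} (hn : 2 < n) (hl : l.length = n * 2 ^ (1 + 2))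
    {p q : ℕ} (hp : p ≠ 0)
    (hq : ∀ i, (table q).getD i 0 =
      (quoteTable l n ++ writerRows (n + 1) (ofNat p) p.bits.length).getD i 0) :
    (∀ i, 2 ^ (1 + 2) ≤ i → i < l.length → (table q).getD i 0 = l.getD i 0) ∧
      (Halts q ![ofNat 0] ↔ (ittm 1 q).HaltsFrom ((1, 0), initTape ![ofNat p])) := by
  have hl8 : l.length = 8 * n := by rw [hl]; ring
  have hlen : (quoteTable l n).length = 8 * (n + 1) := by
    simp only [quoteTable, List.length_append, List.length_cons, List.length_nil,
      List.length_drop, List.length_map, List.length_range]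
    omega
  have hact : ∀ s (r : Fin (1 + 2) → Bool), action q s r =
      Action.ofCode 1 ((quoteTable l n ++ writerRows (n + 1) (ofNat p) p.bits.length).getD
        (8 * s + Nat.ofBits r) 0) := by
    intro s r; rw [action_eq, hq, mul_comm s]; norm_num
  have hact0 : action q 0 (singleDigit false) = ⟨singleDigit false, false, n + 1⟩ := by
    rw [hact, ofBits_singleDigit]; exact ofCode_actionCode ..
  have hact1 : action q 0 (singleDigit true) = ⟨singleDigit true, true, n⟩ := by
    rw [hact, ofBits_singleDigit]; exact ofCode_actionCode ..
  have hwait : ∀ r : Fin (1 + 2) → Bool, action q n r = ⟨r, true, n⟩ := by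
    intro r
    have hr : Nat.ofBits r < 8 := Nat.ofBits_lt_two_pow r
    rw [hact, List.getD_append _ _ _ _ (by rw [hlen]; omega), quoteTable,
      List.getD_append_right _ _ _ _ (by simp; omega)]
    have h1 : 8 * n + Nat.ofBits r - ([actionCode (singleDigit false) false (n + 1),
        actionCode (singleDigit true) true n, 0, 0, 0, 0, 0, 0] ++ l.drop 8).length =
        Nat.ofBits r := by
      simp; omega
    rw [h1, List.getD_eq_getElem?_getD, List.getElem?_map, List.getElem?_range hr]
    simp only [Option.map_some, Option.getD_some]
    rw [ofBits_testBit, ofCode_actionCode]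
  have hwrite : ∀ j < p.bits.length, action q (n + 1 + j) (singleDigit false) =
      ⟨singleDigit (ofNat p j), true, n + 1 + j + 1⟩ := by
    intro j hj
    rw [hact, ofBits_singleDigit, List.getD_append_right _ _ _ _ (by rw [hlen]; simp), hlen]
    have h1 : 8 * (n + 1 + j) + false.toNat - 8 * (n + 1) = 8 * j := by simp; omega
    rw [h1, writerRows_getD _ _ _ _ hj, ofCode_writer]
  -- The state after the last writer row is beyond the end of the table, where entries are 0: write
  -- zeros, move left, enter state 0. So the table needs no closing row.
  have hend : action q (n + 1 + p.bits.length) (singleDigit false) =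
      ⟨singleDigit false, false, 0⟩ := by
    rw [hact, List.getD_eq_default]
    · simp [Action.ofCode]; funext i; simp [singleDigit]
    · rw [List.length_append, hlen, length_writerRows]; omega
  constructor
  · intro i h8 hi
    rw [hq, List.getD_append _ _ _ _ (by rw [hlen]; omega), quoteTable,
      List.getD_append _ _ _ _ (by simp; omega), List.getD_append_right _ _ _ _ (by simpa using h8)]
    simp only [List.length_cons, List.length_nil, List.getD_eq_getElem?_getD, List.getElem?_drop]
    congr 2
    norm_num at h8 ⊢
    omega
  · let τ : ℕ → Fin (1 + 2) → Cantor := fun j i =>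
      if i = 0 then toReal (p.bits.take j) else fun _ => false
    have hτ0 : initTape ![ofNat 0] = τ 0 := by
      funext i j
      fin_cases i <;> simp [initTape, Config.init, τ, toReal, ofNat]
    have hτp : initTape ![ofNat p] = τ p.bits.length := by
      funext i j
      fin_cases i <;> simp [initTape, Config.init, τ, ofNat_eq_toReal]
    have hread : ∀ j m, p.bits.length ≤ m ∨ j ≤ m → (fun i => τ j i m) = singleDigit false := by
      intro j m h
      funext i
      by_cases hi : i = 0
      · subst hi
        simp only [τ, if_true, toReal, singleDigit]
        rw [List.getD_eq_default _ _ (by rw [List.length_take]; omega)]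
        rfl
      · simp [τ, hi, singleDigit]
    have hP : ∀ (s m : ℕ) τ, s ≠ 2 → ¬ (ittm 1 q).halt (((s, m), τ) :
        (ℕ × ℕ) × (Fin (1 + 2) → Cantor)).1 := fun s m τ hs => hs
    have hkeep : ∀ s m j, ∀ a : Action 1, action q s (fun i => τ j i m) = a →
        a.write = (fun i => τ j i m) → (ittm 1 q).step ((s, m), τ j) =
          ((a.next, if a.right then m + 1 else m - 1), τ j) := by
      rintro s m j a rfl h
      simp only [ittm, Config.step, h]
      refine Prod.ext rfl ?_
      funext i
      exact Function.update_eq_self ..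
    have h1 : (ittm 1 q).Reach ((0, 0), τ 0) ((n + 1, 0), τ 0) := by
      have h := hkeep 0 0 0 _ (by rw [hread _ _ (Or.inr le_rfl), hact0])
        (hread _ _ (Or.inr le_rfl)).symm
      have h' := Sys.Reach.step (hP 0 0 (τ 0) (by norm_num))
      rwa [h] at h'
    have h2 : ∀ j ≤ p.bits.length,
        (ittm 1 q).Reach ((n + 1, 0), τ 0) ((n + 1 + j, j), τ j) := by
      intro j
      induction j with
      | zero => intro _; exact Sys.Reach.refl ..
      | succ j ih =>
        intro hj
        refine (ih (by omega)).trans ?_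
        have h : (ittm 1 q).step ((n + 1 + j, j), τ j) = ((n + 1 + (j + 1), j + 1), τ (j + 1)) := by
          simp only [ittm, Config.step, hread j j (Or.inr le_rfl), hwrite j (by omega)]
          refine Prod.ext rfl ?_
          funext i
          by_cases hi : i = 0
          · subst hi
            have hlen' : (p.bits.take j).length = j := by rw [List.length_take]; omega
            have := update_toReal (p.bits.take j) (p.bits[j])
            rw [hlen', List.take_concat_get' _ _ (by omega)] at this
            simp only [τ, if_true]
            rw [← this]
            congr 1
            rw [ofNat_eq_toReal]
            simp [singleDigit, toReal, List.getElem?_eq_getElem (show j < p.bits.length by omega)]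
          · simp [τ, hi, singleDigit]
        rw [← h]
        exact Sys.Reach.step (hP _ _ _ (by omega))
    -- Here `p ≠ 0` matters: the head steps back onto the leading digit 1 of `p`, and this 1 tells
    -- state 0 that the writing is over.
    obtain ⟨m, hm⟩ : ∃ m, p.bits.length = m + 1 := Nat.exists_eq_succ_of_ne_zero <| by
      rw [Nat.size_eq_bits_len, ← Nat.pos_iff_ne_zero, Nat.size_pos]
      omega
    have h3 : (ittm 1 q).Reach ((n + 1 + p.bits.length, p.bits.length), τ p.bits.length)
        ((0, m), τ p.bits.length) := by
      have h := hkeep (n + 1 + p.bits.length) p.bits.length p.bits.length _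
        (by rw [hread _ _ (Or.inr le_rfl), hend]) (hread _ _ (Or.inr le_rfl)).symm
      have h' := Sys.Reach.step (hP _ p.bits.length (τ p.bits.length)
        (show n + 1 + p.bits.length ≠ 2 by omega))
      rw [h] at h'
      simpa [hm] using h'
    have hlast : (fun i => τ p.bits.length i m) = singleDigit true := by
      funext i
      by_cases hi : i = 0
      · subst hi
        simp only [τ, if_true, List.take_length, singleDigit, decide_true, Bool.true_and]
        rw [← ofNat_eq_toReal, ofNat_last hm]
      · simp [τ, hi, singleDigit]
    have h4 : (ittm 1 q).Reach ((0, m), τ p.bits.length) ((n, m + 1), τ p.bits.length) := by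
      have h := hkeep 0 m p.bits.length _ (by rw [hlast, hact1]) hlast.symm
      have h' := Sys.Reach.step (hP 0 m (τ p.bits.length) (by norm_num))
      rwa [h] at h'
    -- The waiting state runs to the right without changing the tapes, so they are unchanged at
    -- stage ω.
    have h5 : (ittm 1 q).Reach ((n, m + 1), τ p.bits.length) ((1, 0), τ p.bits.length) :=
      Sys.reach_omega_of_const (s := ittm 1 q) (fun i => (n, m + 1 + i))
        (fun i => hkeep n (m + 1 + i) p.bits.length _ (hwait _) rfl) (fun i => hP _ _ (τ 0) (by omega))
    rw [halts_iff, hτ0, hτp]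
    exact (h1.trans ((h2 _ le_rfl).trans (h3.trans (h4.trans h5)))).haltsFrom_iff

/-- The program that runs `p` on the input `p`, as a function of `p`. -/
theorem exists_quote : ∃ (l : List ℕ) (n : ℕ), ∀ p q, p ≠ 0 →
    ofNat q = toReal (enc (l ++ writerRows n (ofNat p) p.bits.length)) →
    (Halts q ![ofNat 0] ↔ Halts p ![ofNat p]) := by
  -- The universal machine is set up with the single input used both as program and as input.
  obtain ⟨N, l, hN, hl, -, h⟩ := exists_table_of_multihead universal three_le_card_uTape
    universal_lim_ne_halt (k := 1) (uIni (fun v => v 0) fun v => v 0)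
  refine ⟨quoteTable l N, N + 1, fun p q hp hq => ?_⟩
  have hq' := congrFun ((hq ▸ parse_table q).unique (parse_enc _))
  obtain ⟨h1, h2⟩ := quote_halts_iff hN hl hp hq'
  obtain ⟨h3, h4⟩ := h q h1 1 (by simp [haltState]) (fun _ => rfl) ![ofNat p]
  rw [h2]
  have hu := universal_haltsFrom_iff (fun v => v 0) (fun v => v 0) ![ofNat p]
  have hu' : universal.sys.HaltsFrom
      (universal.start (iniTape (uIni (fun v => v 0) fun v => v 0) ![ofNat p])) ↔
      Halts p ![ofNat p] := by
    rw [hu]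
    constructor
    · rintro ⟨p', hp', h⟩
      have : p = p' := Nat.eq_of_testBit_eq fun i => congrFun hp' i
      rw [← this] at h
      exact h
    · exact fun h => ⟨p, rfl, h⟩
  rw [← hu']
  refine ⟨fun h => by_contra fun h' => h4 h' h, fun h => ?_⟩
  obtain ⟨c, hc, hc', -⟩ := h3 h
  exact hc.haltsFrom_iff.2 ⟨0, by rw [Sys.run_zero]; exact hc'⟩

end ITTM

namespace ITTM

open Order MH

namespace MH

variable {I M Q : Type} [DecidableEq M]

theorem reach_keep (W : MH I M Q) {q : Q} {pos : M → ℕ} {τ : I → ℕ → Bool} (m : M) (d : Dir)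
    (q' : Q) (hq : q ≠ W.halt) (hm : W.hd q = m)
    (h : W.act q (fun i => τ i (pos m)) = (fun i => τ i (pos m), d, q')) :
    W.sys.Reach ((q, pos), τ) ((q', Function.update pos m (d.move (pos m))), τ) := by
  subst hm
  rw [← step_keep W h]
  exact Sys.Reach.step hq

theorem reach_write [DecidableEq I] (W : MH I M Q) {q : Q} {pos : M → ℕ} {τ : I → ℕ → Bool}
    (m : M) (j : I) (b : Bool) (d : Dir) (q' : Q) (hq : q ≠ W.halt) (hm : W.hd q = m)
    (h : W.act q (fun i => τ i (pos m)) =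
      (Function.update (fun i => τ i (pos m)) j b, d, q')) :
    W.sys.Reach ((q, pos), τ) ((q', Function.update pos m (d.move (pos m))),
      Function.update τ j (Function.update (τ j) (pos m) b)) := by
  subst hm
  have hs : W.sys.step ((q, pos), τ) =
      ((q', Function.update pos (W.hd q) (d.move (pos (W.hd q)))),
        Function.update τ j (Function.update (τ j) (pos (W.hd q)) b)) := by
    simp only [sys, stepAux, h]
    refine Prod.ext rfl ?_
    funext i
    by_cases hi : i = j
    · subst hi; simp
    · simp [hi]
  rw [← hs]
  exact Sys.Reach.step hq

end MH

/-! ### The diagonal machine -/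

/-- The tapes of the diagonal machine: those of the simulated machine, the input, a mark on the
input, a counter, flags at cell `0`, and a tape that marks cell `0`. -/
inductive DTape (k : ℕ)
  | sim (i : Fin (k + 2))
  | prog
  | mark
  | cnt
  | init
  | gen
  | loop
  | zero
  deriving DecidableEq

inductive DHead
  | sim
  | out
  | lead
  | follow
  | cnt
  deriving DecidableEq

/-- The states of the diagonal machine, for a prefix of length `u`, rows with at least `w` digits `1`,
and a simulated machine with `B` states. -/
inductive DState (u w B : ℕ)
  | lim
  | halt
  | spin
  | pre (i : Fin u)
  | lead
  | emit (i : Fin w)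
  | copy
  | copyOut
  | ext (i : Fin 16)
  | back
  | bit
  | tail (b m : Bool)
  | zeros (i : Fin 8) (m : Bool)
  | sim (q : Fin B)
  | rewind
  deriving DecidableEq

instance (k : ℕ) : Finite (DTape k) := Finite.of_equiv _ (proxy_equiv% (DTape k))
instance : Finite DHead := Finite.of_equiv _ (proxy_equiv% DHead)
instance (u w B : ℕ) : Finite (DState u w B) := Finite.of_equiv _ (proxy_equiv% (DState u w B))

namespace DState

variable {u w B : ℕ}

def preFrom (i : ℕ) : DState u w B := if h : i < u then .pre ⟨i, h⟩ else .lead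

def emitFrom (i : ℕ) : DState u w B := if h : i < w then .emit ⟨i, h⟩ else .copy

def extFrom (i : ℕ) : DState u w B := if h : i < 16 then .ext ⟨i, h⟩ else .back

def zerosFrom (i : ℕ) (m : Bool) : DState u w B :=
  if h : i < 8 then .zeros ⟨i, h⟩ m else if m then .lead else emitFrom 0

def simState (q : ℕ) : DState u w B :=
  if q = haltState then .rewind else if h : q < B then .sim ⟨q, h⟩ else .halt

end DState

open DState

/-- More than the number of every state that program `d` can enter. -/
def stateBound (d : ℕ) : ℕ := (table d).sum + 3

theorem next_lt_stateBound {k : ℕ} (d q : ℕ) (r : Fin (k + 2) → Bool) :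
    (action d q r).next < stateBound d := by
  rw [action_eq, stateBound, List.getD_eq_getElem?_getD]
  generalize q * 2 ^ (k + 2) + Nat.ofBits r = i
  have h : (table d)[i]?.getD 0 ≤ (table d).sum := by
    by_cases hi : i < (table d).length
    · rw [List.getElem?_eq_getElem hi]
      exact List.le_sum_of_mem (List.getElem_mem hi)
    · simp [List.getElem?_eq_none (not_lt.1 hi)]
  exact ((Nat.div_le_self ..).trans h).trans_lt (by omega)

/-- The machine that writes a prefix and the rows for writing its input on the first tape of program
`d`, then runs `d`, and halts if and only if the output of `d` begins with `0`. -/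
def diagonal (k d w : ℕ) (pre : List Bool) :
    MH (DTape k) DHead (DState pre.length w (stateBound d)) where
  lim := .lim
  halt := .halt
  hd
    | .pre _ | .emit _ | .copyOut | .tail _ _ | .zeros _ _ => .out
    | .lead => .lead
    | .copy | .ext _ | .back => .cnt
    | .bit => .follow
    | _ => .sim
  act
    | .lim, r =>
      if r .init then (Function.update r .init false, .stay, preFrom 0)
      else if r .gen then (Function.update r .gen false, .stay, simState startState)
      -- This flag keeps the machine in its loop at limits after a negative verdict; with all flags
      -- down, a limit belongs to the simulated run of `d`.
      else if r .loop then (r, .stay, .spin)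
      else (r, .stay, simState limitState)
    | .halt, r => (r, .stay, .halt)
    | .spin, r => (r, .stay, .spin)
    | .pre i, r => (Function.update r (.sim 0) pre[i], .right, preFrom (i + 1))
    | .lead, r =>
      -- Rows are generated only once a further 1 of the input has been found, and then for all
      -- digits up to it. So generation stops at the leading 1 of the input although its end is
      -- never recognized.
      if r .prog then (Function.update r .mark true, .right, emitFrom 0) else (r, .right, .lead)
    | .emit i, r => (Function.update r (.sim 0) true, .right, emitFrom (i + 1))
    | .copy, r => if r .cnt then (r, .right, .copyOut) else (r, .stay, extFrom 0)
    | .copyOut, r => (Function.update r (.sim 0) true, .right, .copy)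
    | .ext i, r => (Function.update r .cnt true, .right, extFrom (i + 1))
    | .back, r => if r .zero then (r, .stay, .bit) else (r, .left, .back)
    | .bit, r => (Function.update r .mark false, .right, .tail (r .prog) (r .mark))
    | .tail b m, r =>
      if b then (Function.update r (.sim 0) true, .right, zerosFrom 0 m)
      else (r, .stay, zerosFrom 0 m)
    | .zeros i m, r => (Function.update r (.sim 0) false, .right, zerosFrom (i + 1) m)
    | .sim q, r =>
      let a := action d q fun i => r (.sim i)
      (fun | .sim i => a.write i | i => r i, if a.right then .right else .left, simState a.next)
    | .rewind, r =>
      if r .zero then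
        if r (.sim (Fin.last (k + 1))) then (Function.update r .loop true, .stay, .spin)
        else (r, .stay, .halt)
      else (r, .left, .rewind)

variable {k : ℕ}

def dTape (P : Cantor) (σ : Fin (k + 2) → Cantor) (L C : Cantor) (f g h : Bool) :
    DTape k → ℕ → Bool
  | .sim i => σ i
  | .prog => P
  | .mark => L
  | .cnt => C
  | .init => fun n => f && decide (n = 0)
  | .gen => fun n => g && decide (n = 0)
  | .loop => fun n => h && decide (n = 0)
  | .zero => fun n => decide (n = 0)

/-- Positions of the heads. -/
def dPos (x o l f c : ℕ) : DHead → ℕ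
  | .sim => x
  | .out => o
  | .lead => l
  | .follow => f
  | .cnt => c

theorem dPos_zero : dPos 0 0 0 0 0 = fun _ => 0 := by funext h; cases h <;> rfl

theorem dPos_update (x o l f c v : ℕ) (h : DHead) :
    Function.update (dPos x o l f c) h v = match h with
      | .sim => dPos v o l f c
      | .out => dPos x v l f c
      | .lead => dPos x o v f c
      | .follow => dPos x o l v c
      | .cnt => dPos x o l f v := by
  funext h'
  cases h <;> cases h' <;> rfl

/-- The list `X` on the first simulated tape. -/
def firstTape (X : List Bool) : Fin (k + 2) → Cantor :=
  fun i => if i = 0 then toReal X else fun _ => false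

/-- The tapes while the list `X` is being generated, with the number `c` in the counter and the
mark `L`. -/
def genTape (P : Cantor) (X : List Bool) (c : ℕ) (L : Option ℕ) : DTape k → ℕ → Bool :=
  dTape P (firstTape X) (fun n => decide (L = some n)) (toReal (List.replicate c true))
    false true false

theorem genTape_append (P : Cantor) (X : List Bool) (c : ℕ) (L : Option ℕ) (b : Bool) :
    Function.update (genTape (k := k) P X c L) (.sim 0)
      (Function.update (genTape (k := k) P X c L (.sim 0)) X.length b) =
    genTape P (X ++ [b]) c L := by
  funext i
  by_cases h : i = .sim 0
  · subst h
    rw [Function.update_self]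
    simp only [genTape, dTape, firstTape, if_true]
    exact update_toReal X b
  · rw [Function.update_of_ne h]
    cases i
    case sim i =>
      have : i ≠ 0 := fun h' => h (h' ▸ rfl)
      simp [genTape, dTape, firstTape, this]
    all_goals rfl

theorem genTape_count (P : Cantor) (X : List Bool) (c : ℕ) (L : Option ℕ) :
    Function.update (genTape (k := k) P X c L) .cnt
      (Function.update (genTape (k := k) P X c L .cnt) c true) =
    genTape P X (c + 1) L := by
  have h := update_toReal (List.replicate c true) true
  rw [List.length_replicate, ← List.replicate_succ'] at h
  funext i
  cases i
  case cnt => rw [Function.update_self]; exact h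
  all_goals rfl

theorem genTape_mark (P : Cantor) (X : List Bool) (c l : ℕ) :
    Function.update (genTape (k := k) P X c none) .mark
      (Function.update (genTape (k := k) P X c none .mark) l true) =
    genTape P X c (some l) := by
  funext i
  cases i
  case mark =>
    rw [Function.update_self]
    funext n
    simp only [genTape, dTape, Function.update_apply]
    by_cases h : n = l
    · simp [h]
    · simp [h, Ne.symm h]
  all_goals rfl

theorem genTape_unmark (P : Cantor) (X : List Bool) (c f l : ℕ) :
    Function.update (genTape (k := k) P X c (some l)) .mark
      (Function.update (genTape (k := k) P X c (some l) .mark) f false) =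
    genTape P X c (if l = f then none else some l) := by
  funext i
  cases i
  case mark =>
    rw [Function.update_self]
    funext n
    simp only [genTape, dTape, Function.update_apply]
    split_ifs with h1 h2 h2
    · rfl
    · simp [h1, h2]
    · simp [h2, Ne.symm h1]
    · rfl
  all_goals rfl

section Generate

variable {d w : ℕ} {pre : List Bool} (P : Cantor)

/-- One step that appends a digit to the generated list. -/
theorem reach_append {q q' : DState pre.length w (stateBound d)} {X : List Bool} {c l f e : ℕ}
    {L : Option ℕ} (b : Bool) (hq : q ≠ .halt) (hd : (diagonal k d w pre).hd q = .out)
    (h : ∀ r, (diagonal k d w pre).act q r = (Function.update r (.sim 0) b, .right, q')) :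
    (diagonal k d w pre).sys.Reach ((q, dPos 0 X.length l f e), genTape P X c L)
      ((q', dPos 0 (X ++ [b]).length l f e), genTape P (X ++ [b]) c L) := by
  have := reach_write (diagonal k d w pre) (τ := genTape P X c L) (pos := dPos 0 X.length l f e)
    .out _ b .right _ hq hd (h _)
  simp only [dPos, genTape_append, dPos_update, Dir.move] at this
  rwa [List.length_append, List.length_singleton]

/-- Several steps that append digits to the generated list. -/
theorem reach_append_list (g : ℕ → DState pre.length w (stateBound d)) (Y : List Bool)
    {X : List Bool} {c l f e : ℕ} {L : Option ℕ} (hq : ∀ i < Y.length, g i ≠ .halt)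
    (hd : ∀ i < Y.length, (diagonal k d w pre).hd (g i) = .out)
    (h : ∀ (i : ℕ) (hi : i < Y.length), ∀ r, (diagonal k d w pre).act (g i) r =
      (Function.update r (.sim 0) Y[i], .right, g (i + 1))) :
    (diagonal k d w pre).sys.Reach ((g 0, dPos 0 X.length l f e), genTape P X c L)
      ((g Y.length, dPos 0 (X ++ Y).length l f e), genTape P (X ++ Y) c L) := by
  have key : ∀ i ≤ Y.length, (diagonal k d w pre).sys.Reach ((g 0, dPos 0 X.length l f e), genTape P X c L)
      ((g i, dPos 0 (X ++ Y.take i).length l f e), genTape P (X ++ Y.take i) c L) := by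
    intro i
    induction i with
    | zero => intro _; simpa using Sys.Reach.refl ..
    | succ i ih =>
      intro hi
      refine (ih (by omega)).trans ?_
      have := reach_append (k := k) P (X := X ++ Y.take i) (c := c) (l := l) (f := f) (e := e)
        (L := L) Y[i] (hq i hi) (hd i hi) (h i hi)
      rwa [List.append_assoc, List.take_concat_get' _ _ hi] at this
  simpa using key Y.length le_rfl

theorem reach_pre : (diagonal k d w pre).sys.Reach
    ((diagonal k d w pre).start (dTape P (fun _ _ => false) (fun _ => false) (fun _ => false) true true false))
      ((.lead, dPos 0 pre.length 0 0 0), genTape P pre 0 none) := by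
  have h1 := reach_write (diagonal k d w pre) (q := .lim) (pos := dPos 0 0 0 0 0)
    (τ := dTape P (fun _ _ => false) (fun _ => false) (fun _ => false) true true false)
    .sim .init false .stay (preFrom 0) (by simp [diagonal]) rfl (by simp [diagonal, dTape, dPos])
  have h2 : Function.update
      (dTape (k := k) P (fun _ _ => false) (fun _ => false) (fun _ => false) true true false) .init
      (Function.update (dTape (k := k) P (fun _ _ => false) (fun _ => false) (fun _ => false)
        true true false .init) 0 false) = genTape P [] 0 none := by
    funext i n
    cases i
    case init =>
      simp only [Function.update_self, genTape, dTape, Function.update_apply]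
      split_ifs <;> simp_all
    case sim i =>
      simp only [ne_eq, reduceCtorEq, not_false_eq_true, Function.update_of_ne, genTape, dTape,
        firstTape]
      split_ifs <;> rfl
    all_goals rfl
  refine Sys.Reach.trans (c' := ((preFrom 0, dPos 0 0 0 0 0), genTape P [] 0 none)) ?_ ?_
  · rw [← h2, MH.start, ← dPos_zero]
    simp only [dPos_update, dPos, Dir.move] at h1
    exact h1
  · have hlt : ∀ i (h : i < pre.length), (preFrom i : DState pre.length w (stateBound d)) =
        .pre ⟨i, h⟩ := fun i h => dif_pos h
    have := reach_append_list (k := k) (d := d) (w := w) (pre := pre) P (X := []) (c := 0) (l := 0) (f := 0)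
      (e := 0) (L := none) preFrom pre (fun i hi => by simp [hlt i hi])
      (fun i hi => by rw [hlt i hi]; rfl) (fun i hi r => by rw [hlt i hi]; rfl)
    simpa [preFrom] using this

theorem reach_copy {X : List Bool} {c l f : ℕ} {L : Option ℕ} (j : ℕ) (hj : j ≤ c) :
    (diagonal k d w pre).sys.Reach ((.copy, dPos 0 X.length l f 0), genTape P X c L)
      ((.copy, dPos 0 (X ++ List.replicate j true).length l f j),
        genTape P (X ++ List.replicate j true) c L) := by
  induction j with
  | zero => simpa using Sys.Reach.refl ..
  | succ j ih =>
    refine (ih (by omega)).trans (Sys.Reach.trans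
      (c' := ((.copyOut, dPos 0 (X ++ List.replicate j true).length l f (j + 1)),
        genTape P (X ++ List.replicate j true) c L)) ?_ ?_)
    · have := reach_keep (diagonal k d w pre) (q := .copy)
        (pos := dPos 0 (X ++ List.replicate j true).length l f j)
        (τ := genTape P (X ++ List.replicate j true) c L) .cnt .right .copyOut
        (by simp [diagonal]) rfl
        (by
          have : j < c := hj
          simp [diagonal, genTape, dTape, dPos, toReal, this])
      simpa only [dPos_update, dPos, Dir.move] using this
    · have := reach_append (k := k) (d := d) (w := w) (pre := pre) P
        (X := X ++ List.replicate j true) (c := c) (l := l) (f := f) (e := j + 1) (L := L)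
        (q := .copyOut) (q' := .copy) true (by simp) rfl (fun r => rfl)
      rwa [List.append_assoc, ← List.replicate_succ'] at this

theorem reach_ext {X : List Bool} {c o l f : ℕ} {L : Option ℕ} :
    (diagonal k d w pre).sys.Reach ((.copy, dPos 0 o l f c), genTape P X c L)
      ((.back, dPos 0 o l f (c + 16)), genTape P X (c + 16) L) := by
  have h0 : (diagonal k d w pre).sys.Reach ((.copy, dPos 0 o l f c), genTape P X c L)
      ((extFrom 0, dPos 0 o l f c), genTape P X c L) := by
    have := reach_keep (diagonal k d w pre) (q := .copy)
      (pos := dPos 0 o l f c) (τ := genTape P X c L) .cnt .stay (extFrom 0)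
      (by simp [diagonal]) rfl
      (by simp [diagonal, genTape, dTape, dPos, toReal])
    simpa only [dPos_update, dPos, Dir.move] using this
  refine h0.trans ?_
  have key : ∀ i ≤ 16, (diagonal k d w pre).sys.Reach ((extFrom 0, dPos 0 o l f c), genTape P X c L)
      ((extFrom i, dPos 0 o l f (c + i)), genTape P X (c + i) L) := by
    intro i
    induction i with
    | zero => intro _; exact Sys.Reach.refl ..
    | succ i ih =>
      intro hi
      refine (ih (by omega)).trans ?_
      have hq : (extFrom i : DState pre.length w (stateBound d)) = .ext ⟨i, hi⟩ := dif_pos hi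
      have := reach_write (diagonal k d w pre) (q := .ext ⟨i, hi⟩) (pos := dPos 0 o l f (c + i))
        (τ := genTape P X (c + i) L) .cnt _ _ _ _ (by simp [diagonal]) rfl rfl
      rw [hq]
      simp only [dPos, genTape_count, dPos_update, Dir.move] at this
      exact this
  exact key 16 le_rfl

theorem reach_counter_home {X : List Bool} {c o l f : ℕ} {L : Option ℕ} (e : ℕ) :
    (diagonal k d w pre).sys.Reach ((.back, dPos 0 o l f e), genTape P X c L)
      ((.bit, dPos 0 o l f 0), genTape P X c L) := by
  induction e with
  | zero =>
    have := reach_keep (diagonal k d w pre) (q := .back)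
      (pos := dPos 0 o l f 0) (τ := genTape P X c L) .cnt .stay .bit
      (by simp [diagonal]) rfl
      (by simp [diagonal, genTape, dTape, dPos])
    simpa only [dPos_update, dPos, Dir.move] using this
  | succ e ih =>
    refine Sys.Reach.trans ?_ ih
    have := reach_keep (diagonal k d w pre) (q := .back)
      (pos := dPos 0 o l f (e + 1)) (τ := genTape P X c L) .cnt .left .back
      (by simp [diagonal]) rfl
      (by simp [diagonal, genTape, dTape, dPos])
    simp only [dPos_update, dPos, Dir.move] at this
    exact this

theorem reach_bit {X : List Bool} {c l l' f : ℕ} :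
    (diagonal k d w pre).sys.Reach ((.bit, dPos 0 X.length l' f 0), genTape P X c (some l))
      ((if l = f then .lead else emitFrom 0,
          dPos 0 (X ++ (List.replicate (P f).toNat true ++ List.replicate 8 false)).length
            l' (f + 1) 0),
        genTape P (X ++ (List.replicate (P f).toNat true ++ List.replicate 8 false)) c
          (if l = f then none else some l)) := by
  generalize hL : (if l = f then none else some l) = L
  have h1 : (diagonal k d w pre).sys.Reach ((.bit, dPos 0 X.length l' f 0), genTape P X c (some l))
      ((.tail (P f) (decide (l = f)), dPos 0 X.length l' (f + 1) 0), genTape P X c L) := by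
    have := reach_write (diagonal k d w pre) (q := .bit) (pos := dPos 0 X.length l' f 0)
      (τ := genTape P X c (some l)) .follow _ _ _ _ (by simp [diagonal]) rfl rfl
    simp only [dPos, genTape_unmark, dPos_update, Dir.move, hL] at this
    simpa [genTape, dTape] using this
  have h2 : (diagonal k d w pre).sys.Reach
      ((.tail (P f) (decide (l = f)), dPos 0 X.length l' (f + 1) 0), genTape P X c L)
      ((zerosFrom 0 (decide (l = f)),
        dPos 0 (X ++ List.replicate (P f).toNat true).length l' (f + 1) 0),
        genTape P (X ++ List.replicate (P f).toNat true) c L) := by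
    cases P f
    · have := reach_keep (diagonal k d w pre) (q := .tail false (decide (l = f)))
        (pos := dPos 0 X.length l' (f + 1) 0) (τ := genTape P X c L) .out .stay _
        (by simp [diagonal]) rfl rfl
      simpa [dPos_update, dPos, Dir.move] using this
    · exact reach_append P true (by simp) rfl fun r => rfl
  refine (h1.trans h2).trans ?_
  have hlt : ∀ (i : ℕ) (h : i < 8) m,
      (zerosFrom i m : DState pre.length w (stateBound d)) = .zeros ⟨i, h⟩ m := fun i h m => dif_pos h
  have h3 := reach_append_list (k := k) (d := d) (w := w) (pre := pre) P
    (X := X ++ List.replicate (P f).toNat true) (c := c) (l := l') (f := f + 1)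
    (e := 0) (L := L) (fun i => zerosFrom i (decide (l = f))) (List.replicate 8 false)
    (fun i hi => by rw [hlt i (by simpa using hi)]; simp)
    (fun i hi => by rw [hlt i (by simpa using hi)]; rfl)
    (fun i hi r => by rw [hlt i (by simpa using hi), List.getElem_replicate]; rfl)
  rw [List.append_assoc] at h3
  simpa [zerosFrom] using h3

end Generate

end ITTM

/-! ### Generating the self-quoting program -/

namespace ITTM

open Order MH DState

theorem enc_append (l l' : List ℕ) : enc (l ++ l') = enc l ++ enc l' := by simp [enc]

theorem enc_writerRow (n : ℕ) (b : Bool) : enc (writerRow n b) =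
    List.replicate (16 * n + 8) true ++ (List.replicate b.toNat true ++ List.replicate 8 false) := by
  rw [← List.append_assoc, ← List.replicate_add]
  simp [enc, writerRow, List.replicate_succ]

section Generate

variable {k d n : ℕ} {t : List ℕ} (P : Cantor)

/-- The generated list after `f` rows. -/
def rowsCode (t : List ℕ) (n : ℕ) (P : Cantor) (f : ℕ) : List Bool := enc (t ++ writerRows n P f)

/-- Row `f` begins with an entry `16 * (n + f + 1) + 8 + P f` in unary. It is split as the machine
produces it: a constant part from the state, `16 * f` from the counter tape, and the digit itself.
Of the eight zeros one closes this entry and seven are the remaining entries 0 of the row. -/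
theorem rowsCode_succ (f : ℕ) : rowsCode t n P (f + 1) =
    rowsCode t n P f ++ List.replicate (16 * (n + 1) + 8) true ++ List.replicate (16 * f) true ++
      (List.replicate (P f).toNat true ++ List.replicate 8 false) := by
  rw [rowsCode, writerRows, ← List.append_assoc, enc_append, enc_writerRow, rowsCode,
    show 16 * (n + f + 1) + 8 = 16 * (n + 1) + 8 + 16 * f by ring, List.replicate_add]
  simp only [List.append_assoc]

theorem reach_row (l f l' : ℕ) :
    (diagonal k d (16 * (n + 1) + 8) (enc t)).sys.Reach
      ((emitFrom 0, dPos 0 (rowsCode t n P f).length l' f 0),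
        genTape P (rowsCode t n P f) (16 * f) (some l))
      ((if l = f then .lead else emitFrom 0, dPos 0 (rowsCode t n P (f + 1)).length l' (f + 1) 0),
        genTape P (rowsCode t n P (f + 1)) (16 * (f + 1)) (if l = f then none else some l)) := by
  have hlt : ∀ i (h : i < 16 * (n + 1) + 8),
      (emitFrom i : DState (enc t).length (16 * (n + 1) + 8) (stateBound d)) = .emit ⟨i, h⟩ :=
    fun i h => dif_pos h
  have h1 := reach_append_list (k := k) (d := d) (w := 16 * (n + 1) + 8) (pre := enc t) P
    (X := rowsCode t n P f) (c := 16 * f) (l := l') (f := f) (e := 0) (L := some l) emitFrom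
    (List.replicate (16 * (n + 1) + 8) true)
    (fun i hi => by rw [hlt i (by simpa using hi)]; simp)
    (fun i hi => by rw [hlt i (by simpa using hi)]; rfl)
    (fun i hi r => by rw [hlt i (by simpa using hi), List.getElem_replicate]; rfl)
  have h2 : (emitFrom (List.replicate (16 * (n + 1) + 8) true).length :
      DState (enc t).length (16 * (n + 1) + 8) (stateBound d)) = .copy := by simp [emitFrom]
  rw [h2] at h1
  rw [rowsCode_succ, mul_add]
  exact h1.trans ((reach_copy P _ le_rfl).trans ((reach_ext P).trans
    ((reach_counter_home P _).trans (reach_bit P))))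

theorem reach_rows {f l : ℕ} (hf : f ≤ l) (l' : ℕ) :
    (diagonal k d (16 * (n + 1) + 8) (enc t)).sys.Reach
      ((emitFrom 0, dPos 0 (rowsCode t n P f).length l' f 0),
        genTape P (rowsCode t n P f) (16 * f) (some l))
      ((.lead, dPos 0 (rowsCode t n P (l + 1)).length l' (l + 1) 0),
        genTape P (rowsCode t n P (l + 1)) (16 * (l + 1)) none) := by
  induction hf using Nat.decreasingInduction with
  | self => simpa using reach_row (k := k) (d := d) (n := n) (t := t) P l l l'
  | of_succ f hf ih =>
    have := reach_row (k := k) (d := d) (n := n) (t := t) P l f l'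
    rw [if_neg hf.ne', if_neg hf.ne'] at this
    exact this.trans ih

/-- The invariant of the scan: behind the leading head, rows are missing only for digits 0 that no 1
has followed so far. -/
theorem reach_lead (l : ℕ) : ∃ f ≤ l, (∀ i, f ≤ i → i < l → P i = false) ∧
    (diagonal k d (16 * (n + 1) + 8) (enc t)).sys.Reach
      ((.lead, dPos 0 (enc t).length 0 0 0), genTape P (enc t) 0 none)
      ((.lead, dPos 0 (rowsCode t n P f).length l f 0),
        genTape P (rowsCode t n P f) (16 * f) none) := by
  induction l with
  | zero =>
    refine ⟨0, le_rfl, by simp, ?_⟩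
    have : rowsCode t n P 0 = enc t := by simp [rowsCode, writerRows]
    rw [this]
    exact Sys.Reach.refl ..
  | succ l ih =>
    obtain ⟨f, hf, hP, h⟩ := ih
    cases hl : P l with
    | false =>
      refine ⟨f, by omega, fun i h1 h2 => ?_, h.trans ?_⟩
      · obtain h3 | rfl : i < l ∨ i = l := by omega
        · exact hP i h1 h3
        · exact hl
      · have := reach_keep (diagonal k d (16 * (n + 1) + 8) (enc t)) (q := .lead)
          (pos := dPos 0 (rowsCode t n P f).length l f 0)
          (τ := genTape P (rowsCode t n P f) (16 * f) none) .lead .right .lead (by simp [diagonal])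
          rfl (by simp [diagonal, genTape, dTape, dPos, hl])
        simpa only [dPos_update, dPos, Dir.move] using this
    | true =>
      refine ⟨l + 1, le_rfl, fun i h1 h2 => by omega, h.trans (Sys.Reach.trans ?_
        (reach_rows P hf (l + 1)))⟩
      have := reach_write (diagonal k d (16 * (n + 1) + 8) (enc t)) (q := .lead)
        (pos := dPos 0 (rowsCode t n P f).length l f 0)
        (τ := genTape P (rowsCode t n P f) (16 * f) none) .lead .mark true .right (emitFrom 0)
        (by simp [diagonal]) rfl (by simp [diagonal, genTape, dTape, dPos, hl])
      simpa only [dPos_update, dPos, Dir.move, genTape_mark] using this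

/-- Once the leading head has passed the last 1, it moves on without changing the tapes, so stage ω
shows the finished code. The flag `gen`, still up, identifies this limit as the beginning of the run
of `d`. -/
theorem reach_simulation (p : ℕ) :
    (diagonal k d (16 * (n + 1) + 8) (enc t)).sys.Reach
      ((diagonal k d (16 * (n + 1) + 8) (enc t)).start
        (dTape (ofNat p) (fun _ _ => false) (fun _ => false) (fun _ => false) true true false))
      ((simState startState, dPos 0 0 0 0 0),
        dTape (ofNat p) (firstTape (rowsCode t n (ofNat p) p.bits.length)) (fun _ => false)
          (toReal (List.replicate (16 * p.bits.length) true)) false false false) := by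
  obtain ⟨f, hf, hP, h⟩ := reach_lead (k := k) (d := d) (n := n) (t := t) (ofNat p) p.bits.length
  -- The digits from `f` on are 0, but the last of the `p.bits.length` digits is 1; hence no row is
  -- missing.
  obtain rfl : f = p.bits.length := by
    by_contra hne
    obtain ⟨m, hm⟩ : ∃ m, p.bits.length = m + 1 := Nat.exists_eq_succ_of_ne_zero (by omega)
    have := hP m (by omega) (by omega)
    rw [ofNat_last hm] at this
    cases this
  refine ((reach_pre _).trans h).trans ?_
  have hω := Sys.reach_omega_of_const (s := (diagonal k d (16 * (n + 1) + 8) (enc t)).sys)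
    (τ := genTape (ofNat p) (rowsCode t n (ofNat p) p.bits.length) (16 * p.bits.length) none)
    (fun i => (.lead, dPos 0 (rowsCode t n (ofNat p) p.bits.length).length (p.bits.length + i)
      p.bits.length 0))
    (fun i => by
      rw [step_keep (d := .right) (q' := .lead)]
      · simp [diagonal, dPos_update, dPos, Dir.move, add_assoc]
      · have : ofNat p (p.bits.length + i) = false := ofNat_of_length_le le_self_add
        simp [diagonal, genTape, dTape, dPos, this])
    (fun i => by simp [diagonal, MH.sys])
  refine hω.trans ?_
  have := reach_write (diagonal k d (16 * (n + 1) + 8) (enc t)) (q := .lim)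
    (pos := dPos 0 0 0 0 0)
    (τ := genTape (ofNat p) (rowsCode t n (ofNat p) p.bits.length) (16 * p.bits.length) none)
    .sim .gen false .stay (simState startState) (by simp [diagonal]) rfl
    (by simp [diagonal, genTape, dTape, dPos])
  simp only [dPos_update, dPos, Dir.move] at this
  convert this using 2
  · exact congrArg (Prod.mk _) dPos_zero.symm
  · funext i m
    cases i
    case gen =>
      simp only [Function.update_self, genTape, dTape, Function.update_apply]
      split_ifs <;> simp_all
    case mark => simp [genTape, dTape]
    all_goals rfl

end Generate

/-! ### Running the supposed decision procedure inside the diagonal machine -/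

section Simulate

variable {k d w : ℕ} {pre : List Bool} (P L C : Cantor)

/-- The relation between the diagonal machine and the simulated one. -/
def DRel (d w : ℕ) (pre : List Bool)
    (c : (DState pre.length w (stateBound d) × (DHead → ℕ)) × (DTape k → ℕ → Bool))
    (b : (ℕ × ℕ) × (Fin (k + 2) → ℕ → Bool)) : Prop :=
  (b.1.1 < stateBound d ∧
    c = ((simState b.1.1, dPos b.1.2 0 0 0 0), dTape P b.2 L C false false false)) ∨
  (c = (diagonal k d w pre).start (dTape P b.2 L C false false false) ∧ b.1 = (limitState, 0))

/-- Since `d` is fixed, its action table is part of the finite control, and each step of `d` is a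
single step here; a limit costs one additional step to enter the simulated limit state. -/
theorem diagonal_sim : Sys.Sim (diagonal k d w pre).sys (ittm k d) (fun i n => (.sim i, n))
    (fun i _ => ∀ j, i ≠ .sim j) (dTape P (fun _ _ => false) L C false false false)
    (DRel P L C d w pre) := by
  refine ⟨?_, ?_, ?_⟩
  · rintro c b (⟨-, rfl⟩ | ⟨rfl, -⟩) i n <;> rfl
  · rintro c ⟨⟨q, n⟩, σ⟩ hR hq'
    have hq : q ≠ haltState := hq'
    let B := (diagonal k d w pre).sys.Between (ittm k d) (fun i n => (.sim i, n))
      (fun i _ => ∀ j, i ≠ .sim j) (dTape P (fun _ _ => false) L C false false false) ((q, n), σ)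
    let τ : DTape k → ℕ → Bool := dTape P σ L C false false false
    have hB : ∀ q pos, q ≠ .halt → B ((q, pos), τ) := by
      intro q pos hq
      refine ⟨hq, fun i n => Or.inl rfl, fun i n hi => ?_⟩
      cases i <;> first | rfl | exact absurd rfl (hi _)
    have main : q < stateBound d →
        B ((simState q, dPos n 0 0 0 0), τ) ∧ DRel P L C d w pre
          ((diagonal k d w pre).sys.step ((simState q, dPos n 0 0 0 0), τ))
          ((ittm k d).step ((q, n), σ)) := by
      intro hlt
      have hs : (simState q : DState pre.length w (stateBound d)) = .sim ⟨q, hlt⟩ := by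
        rw [simState, if_neg hq, dif_pos hlt]
      rw [hs]
      refine ⟨hB _ _ (by simp), Or.inl ⟨next_lt_stateBound .., ?_⟩⟩
      simp only [MH.sys, stepAux, diagonal, ittm, Config.step, dPos_update]
      refine Prod.ext (Prod.ext rfl ?_) ?_
      · simp only [dPos, dTape, τ]
        congr 1
        split_ifs <;> rfl
      · funext i
        cases i
        case sim i => rfl
        all_goals exact Function.update_eq_self _ _
    rcases hR with ⟨hlt, rfl⟩ | ⟨rfl, hb⟩
    · exact ⟨_, (main hlt).2, (main hlt).1, Sys.Path.refl ..⟩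
    · obtain ⟨rfl, rfl⟩ := Prod.ext_iff.1 hb
      have hlt : (1 : ℕ) < stateBound d := by rw [stateBound]; omega
      refine ⟨_, (main hlt).2, hB _ _ (by simp [diagonal]), ?_⟩
      have h : (diagonal k d w pre).sys.step ((diagonal k d w pre).start τ) =
          ((simState limitState, fun _ => 0), τ) :=
        step_keep_stay _ (by simp [diagonal, τ, dTape])
      rw [show dTape P σ L C false false false = τ from rfl, h, ← dPos_zero]
      exact Sys.Path.single (main hlt).1 rfl
  · intro τ σ h1 h2
    refine Or.inr ⟨?_, rfl⟩
    have : τ = dTape P σ L C false false false := by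
      funext i n
      cases i
      case sim i => exact h1 i n
      all_goals exact h2 _ _ (by simp)
    rw [this]; rfl

theorem reach_rewind (σ : Fin (k + 2) → Cantor) (n : ℕ) : (diagonal k d w pre).sys.Reach
    ((.rewind, dPos n 0 0 0 0), dTape P σ L C false false false)
    ((.rewind, dPos 0 0 0 0 0), dTape P σ L C false false false) := by
  induction n with
  | zero => exact Sys.Reach.refl ..
  | succ n ih =>
    refine Sys.Reach.trans ?_ ih
    have := reach_keep (diagonal k d w pre) (q := .rewind)
      (pos := dPos (n + 1) 0 0 0 0) (τ := dTape P σ L C false false false) .sim .left .rewind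
      (by simp [diagonal]) rfl (by simp [diagonal, dTape, dPos])
    simp only [dPos_update, dPos, Dir.move] at this
    exact this

theorem haltsFrom_rewind_iff (σ : Fin (k + 2) → Cantor) : (diagonal k d w pre).sys.HaltsFrom
    ((.rewind, dPos 0 0 0 0 0), dTape P σ L C false false false) ↔
      σ (Fin.last (k + 1)) 0 = false := by
  cases hσ : σ (Fin.last (k + 1)) 0 with
  | false =>
    have h := reach_keep (diagonal k d w pre) (q := .rewind)
      (pos := dPos 0 0 0 0 0) (τ := dTape P σ L C false false false) .sim .stay .halt
      (by simp [diagonal]) rfl (by simp [diagonal, dTape, dPos, hσ])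
    simp only [iff_true]
    exact h.haltsFrom_iff.2 ⟨0, by rw [Sys.run_zero]; rfl⟩
  | true =>
    have h := reach_write (diagonal k d w pre) (q := .rewind)
      (pos := dPos 0 0 0 0 0) (τ := dTape P σ L C false false false) .sim .loop true .stay .spin
      (by simp [diagonal]) rfl (by simp [diagonal, dTape, dPos, hσ])
    simp only [Bool.true_eq_false, iff_false]
    rw [h.haltsFrom_iff]
    refine not_haltsFrom_of_spin (diagonal k d w pre) (q := .spin) (by simp [diagonal])
      (by simp [diagonal]) ?_ (fun n => rfl) (Or.inl rfl) rfl
    simp [diagonal, dTape, dPos]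

theorem haltsFrom_simulation_iff {σ : Fin (k + 2) → Cantor} {c}
    (hc : (ittm k d).Reach ((startState, 0), σ) c) (hh : c.1.1 = haltState) :
    (diagonal k d w pre).sys.HaltsFrom
      ((simState startState, dPos 0 0 0 0 0), dTape P σ L C false false false) ↔
        c.2 (Fin.last (k + 1)) 0 = false := by
  obtain ⟨a, ha, hR⟩ := (diagonal_sim (w := w) (pre := pre) P L C).reach
    (Or.inl ⟨show startState < stateBound d by rw [stateBound, startState]; omega, rfl⟩) hc
  rw [ha.haltsFrom_iff]
  rcases hR with ⟨-, rfl⟩ | ⟨-, h⟩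
  · rw [hh, show (simState haltState : DState pre.length w (stateBound d)) = .rewind from rfl,
      (reach_rewind P L C ..).haltsFrom_iff, haltsFrom_rewind_iff]
  · rw [h] at hh
    exact absurd hh (by simp [limitState, haltState])

end Simulate

/-! ### Undecidability of both halting problems -/

theorem ofNat_injective : Function.Injective ofNat :=
  fun _ _ h => Nat.eq_of_testBit_eq fun i => congrFun h i

/-- The input `(q, 0, …, 0)`. -/
def padInput (k q : ℕ) : Fin k → Cantor := fun i => if (i : ℕ) = 0 then ofNat q else ofNat 0

/-- The initial tapes of the diagonal machine. -/
def dIni (k : ℕ) (v : Fin 1 → Bool) (z : Bool) : DTape k → Bool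
  | .prog => v 0
  | .init | .gen | .zero => z
  | _ => false

/-- Let `p` be a program for the diagonal machine built from `d`, and `q` the program that runs `p`
on `p`. Then `p` halts on `p` if and only if `d` rejects `q`, that is, if and only if `q` does not
halt on 0, that is, if and only if `p` does not halt on `p`. Padding with zeros serves both sets:
(q, 0) belongs to H exactly if q belongs to h. -/
theorem not_exists_decider {k : ℕ} (hk : 0 < k) (d : ℕ)
    (hd : ∀ q, ∃ h : (phi d (padInput k q)).Dom,
      (phi d (padInput k q)).get h 0 = true ↔ Halts q ![ofNat 0]) : False := by
  obtain ⟨t, n, hquote⟩ := exists_quote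
  have hcard : 3 ≤ Nat.card (DTape k) := by
    let g : Option (Fin (k + 2)) → DTape k := fun o => o.elim .prog .sim
    have hg : Function.Injective g := by
      rintro (_ | i) (_ | j) h <;> simp_all [g]
    have := Nat.card_le_card_of_injective g hg
    simp at this
    omega
  obtain ⟨p, hp, hE⟩ := exists_program_of_multihead (diagonal k d (16 * (n + 1) + 8) (enc t)) hcard
    (by simp [diagonal]) (dIni k)
  obtain ⟨q, hq⟩ := exists_ofNat_eq (rowsCode t n (ofNat p) p.bits.length)
  obtain ⟨hdom, hout⟩ := hd q
  obtain ⟨c, hc, hh, hval⟩ := exists_reach_of_dom hdom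
  have hini : iniTape (dIni k) ![ofNat p] =
      dTape (ofNat p) (fun _ _ => false) (fun _ => false) (fun _ => false) true true false := by
    funext i m
    cases i <;> simp [iniTape, dIni, dTape]
  have hfirst : initTape (padInput k q) = firstTape (rowsCode t n (ofNat p) p.bits.length) := by
    funext i m
    simp only [firstTape, ← hq, initTape, Config.init, padInput]
    by_cases hi : i = 0
    · subst hi
      simp [hk]
    · have : (i : ℕ) ≠ 0 := fun h => hi (Fin.ext h)
      split_ifs
      · simp [ofNat]
      · rfl
  have h1 := (hE ![ofNat p]).1
  -- After these rewritings `h1` says that the first output digit of `d` is 1 if and only if it is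
  -- 0.
  rw [hini, (reach_simulation p).haltsFrom_iff, ← hfirst,
    haltsFrom_simulation_iff _ _ _ hc hh, hval, ← hquote p q hp hq, ← hout] at h1
  simp at h1

theorem not_infDecidable_of_mem_iff {k : ℕ} (hk : 0 < k) {A : Set (Fin k → Cantor)}
    (hA : ∀ q, padInput k q ∈ A ↔ Halts q ![ofNat 0]) : ¬ InfDecidable A := by
  rintro ⟨d, hd⟩
  refine not_exists_decider hk d fun q => ?_
  rw [← congrFun hd (padInput k q), ← hA]
  refine ⟨Part.some_dom _, ?_⟩
  rw [Part.get_some]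
  split_ifs with h <;> simp [h, ofNat]

theorem not_infDecidable_boldHalt : ¬ InfDecidable boldHalt := by
  refine not_infDecidable_of_mem_iff two_pos fun q => ⟨?_, fun h => ⟨q, ofNat 0, ?_, h⟩⟩
  · rintro ⟨p, x, hv, h⟩
    obtain rfl : q = p := ofNat_injective (congrFun hv 0)
    obtain rfl : ofNat 0 = x := congrFun hv 1
    exact h
  · funext i
    fin_cases i <;> rfl

theorem not_infDecidable_lightHalt : ¬ InfDecidable lightHalt := by
  refine not_infDecidable_of_mem_iff one_pos fun q => ⟨?_, fun h => ⟨q, ?_, h⟩⟩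
  · rintro ⟨p, hv, h⟩
    obtain rfl : q = p := ofNat_injective (congrFun hv 0)
    exact h
  · funext i
    fin_cases i
    rfl

end ITTM

theorem mainTheorem5 :
    (ITTM.InfSemiDecidable ITTM.boldHalt ∧ ¬ ITTM.InfDecidable ITTM.boldHalt) ∧
      (ITTM.InfSemiDecidable ITTM.lightHalt ∧ ¬ ITTM.InfDecidable ITTM.lightHalt) := by
  exact ⟨⟨ITTM.infSemiDecidable_boldHalt, ITTM.not_infDecidable_boldHalt⟩,
    ITTM.infSemiDecidable_lightHalt, ITTM.not_infDecidable_lightHalt⟩
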